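/- Let $S^2$ be the unit sphere in $\mathbb{R}^3$ with its geodesic distance $|ab|$; for non-antipodal $a,b\in S^2$ let $ab$ be the shorter great-circle arc joining them. A set $C\subseteq S^2$ is convex if $|ab|<\pi$ and $ab\subseteq C$ for all $a,b\in C$; a convex body is a closed convex set with non-empty interior. The convex hull of a subset of a convex set is the intersection of all convex sets containing it. A convex polygon is the convex hull of $k\ge 3$ points (its vertices) which lie in some convex set and none of which lies in the convex hull of the others. The disk of center $p\in S^2$ and radius $r\in(0,\pi/2]$ is $\{x\in S^2: |px|\le r\}$; disks of radius $\pi/2$ are hemispheres. A lune is the intersection of two different hemispheres whose centers are not antipodal; its thickness is the distance between the centers of the two semicircles bounding it. The thickness $\Delta(C)$ of a convex body $C$ is the minimal thickness of a lune containing $C$. A convex body $C$ is reduced if $\Delta(R)<\Delta(C)$ for every convex body $R\subsetneq C$. A regular triangle is a convex polygon with three vertices, sides of equal length and equal interior angles. Let $\omega\in(0,\pi/2)$ and put $$\gamma=\arcsin\frac{-\cos\omega+\sqrt{\cos^2\omega+8}}{4},\qquad R(\omega)=\arcsin\Big(\frac{2}{\sqrt3}\sqrt{1-\frac{1}{4\sin^2\gamma}}\Big).$$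 (a) Every reduced convex polygon $V\subset S^2$ with $\Delta(V)=\omega$ is contained in a disk of radius $R(\omega)$. (b) The bound is attained by the regular triangle: there is a regular triangle of thickness $\omega$, and every regular triangle $T$ of thickness $\omega$ is reduced and $R(\omega)$ is the smallest radius $r\in(0,\pi/2]$ of a disk containing $T$. (c) Consequently $R(\omega)$ is the smallest $r\in(0,\pi/2]$ such that every reduced convex polygon of thickness $\omega$ is contained in a disk of radius $r$. -/

import Mathlib

namespace SphericalPolygon

noncomputable section

/-- The unit sphere of three-dimensional Euclidean space. -/
abbrev S2 : Type := Metric.sphere (0 : EuclideanSpace ℝ (Fin 3)) 1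

/-- Spherical (geodesic) distance: the length of the shorter great-circle arc between two points. -/
def sdist (a b : S2) : ℝ :=
  InnerProductGeometry.angle (a : EuclideanSpace ℝ (Fin 3)) (b : EuclideanSpace ℝ (Fin 3))

/-- The arc `ab`, the shorter part of the great circle through the points `a`, `b` (used only for
points that are not antipodes; it is `{a}` for `a = b`): all unit vectors that are nonnegative
combinations of `a` and `b`. -/
def arc (a b : S2) : Set S2 :=
  {x | ∃ s t : ℝ, 0 ≤ s ∧ 0 ≤ t ∧
    (x : EuclideanSpace ℝ (Fin 3)) = s • (a : EuclideanSpace ℝ (Fin 3)) + t • (b : EuclideanSpace ℝ (Fin 3))}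

/-- Spherically convex sets: they contain no antipodes, and with any two points the arc
between them. -/
def IsConvex (C : Set S2) : Prop :=
  ∀ a ∈ C, ∀ b ∈ C, sdist a b < Real.pi ∧ arc a b ⊆ C

/-- Convex bodies: closed convex sets with nonempty interior (relative to the sphere). -/
def IsConvexBody (C : Set S2) : Prop :=
  IsClosed C ∧ IsConvex C ∧ (interior C).Nonempty

/-- The spherical disk with center `k` and radius `r`. -/
def disk (k : S2) (r : ℝ) : Set S2 := {x | sdist k x ≤ r}

/-- The hemisphere with center `g`. -/
def hemisphere (g : S2) : Set S2 := disk g (Real.pi / 2)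

/-- The pair of hemispheres with centers `g`, `h` bounds a lune: they are different and their
centers are not antipodes. -/
def IsLunePair (g h : S2) : Prop := g ≠ h ∧ g ≠ -h

/-- The lune that is the intersection of the hemispheres with centers `g` and `h`. -/
def lune (g h : S2) : Set S2 := hemisphere g ∩ hemisphere h

/-- The component of `q` orthogonal to `p`; it is the direction at `p` of the arc `pq`. -/
def tangentDir (p q : S2) : EuclideanSpace ℝ (Fin 3) :=
  (q : EuclideanSpace ℝ (Fin 3)) -
    (inner ℝ (p : EuclideanSpace ℝ (Fin 3)) (q : EuclideanSpace ℝ (Fin 3))) •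
      (p : EuclideanSpace ℝ (Fin 3))

/-- The thickness of the lune of `g` and `h`: the distance between the centers of the two
semicircles that bound it. The semicircle `{x | ⟪g, x⟫ = 0, 0 ≤ ⟪h, x⟫}` has as its center the
unit vector in the direction `tangentDir g h`, and the other one that of `tangentDir h g`; the
angle does not depend on the lengths of these vectors. -/
def luneThickness (g h : S2) : ℝ :=
  InnerProductGeometry.angle (tangentDir g h) (tangentDir h g)

/-- The thickness of a convex body: the minimal thickness of a lune that contains it (for a convex
body this infimum is attained). -/
def thickness (C : Set S2) : ℝ :=
  sInf {t | ∃ g h : S2, IsLunePair g h ∧ C ⊆ lune g h ∧ t = luneThickness g h}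

/-- Reduced convex bodies: every convex body that is a proper subset has smaller thickness. -/
def IsReducedBody (C : Set S2) : Prop :=
  IsConvexBody C ∧ ∀ R : Set S2, IsConvexBody R → R ⊂ C → thickness R < thickness C

/-- The convex hull of a subset of a convex set: the intersection of all convex sets that
contain it. -/
def hull (A : Set S2) : Set S2 := ⋂₀ {D | IsConvex D ∧ A ⊆ D}

/-- The set `V` is a spherically convex `k`-gon with vertices `v 0, …, v (k-1)`: the convex hull of
`k ≥ 3` points of some convex set, none of which lies in the convex hull of the others. (In
particular the points are distinct.) -/
def IsConvexGon (k : ℕ) (v : Fin k → S2) (V : Set S2) : Prop :=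
  3 ≤ k ∧ (∃ D : Set S2, IsConvex D ∧ Set.range v ⊆ D) ∧
    (∀ i, v i ∉ hull (v '' {j | j ≠ i})) ∧ V = hull (Set.range v)

/-- Spherically convex polygons. -/
def IsConvexPolygon (V : Set S2) : Prop :=
  ∃ (k : ℕ) (v : Fin k → S2), IsConvexGon k v V

/-- The angle at `p` between the arcs `pq` and `pr`. -/
def vertexAngle (q p r : S2) : ℝ :=
  InnerProductGeometry.angle (tangentDir p q) (tangentDir p r)

/-- Regular spherical triangles: spherically convex triangles with sides of equal length and equal
interior angles. -/
def IsRegularTriangle (V : Set S2) : Prop :=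
  ∃ v : Fin 3 → S2, IsConvexGon 3 v V ∧
    (sdist (v 0) (v 1) = sdist (v 1) (v 2) ∧ sdist (v 1) (v 2) = sdist (v 2) (v 0)) ∧
    (vertexAngle (v 2) (v 0) (v 1) = vertexAngle (v 0) (v 1) (v 2) ∧
      vertexAngle (v 0) (v 1) (v 2) = vertexAngle (v 1) (v 2) (v 0))

/-- The angle `γ` that belongs to the thickness `ω`. -/
def gammaAngle (ω : ℝ) : ℝ :=
  Real.arcsin ((-Real.cos ω + Real.sqrt (Real.cos ω ^ 2 + 8)) / 4)

/-- The covering radius that belongs to the thickness `ω`. -/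
def coverRadius (ω : ℝ) : ℝ :=
  Real.arcsin (2 / Real.sqrt 3 * Real.sqrt (1 - 1 / (4 * Real.sin (gammaAngle ω) ^ 2)))

end

end SphericalPolygon

open SphericalPolygon

/-! Points are unit vectors, a convex set is treated through the cone over it, and a lune through
its two inner normals: its thickness is π minus their angle. Write c = cos ω.

Altitudes. Truncating a reduced polygon near a vertex e lowers the thickness, so an optimal lune of
the truncated body has a foot on the cut. Letting the cut shrink to e gives a lune of thickness ω
around the polygon with e as the center of one semicircle and a foot q in the polygon as the center
of the other (`IsReducedBody.exists_foot`).

Combinatorics. Optimality puts each foot on a side opposite to its vertex. A side determines its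
altitude, so vertices and sides correspond bijectively; as altitudes cross, both sides of an
altitude balance. Hence n = 2p + 1 and the side opposite to w i joins w (i + p) to w (i + p + 1)
(`AltitudePolygon.two_mul_eq`).

Diameter. The largest vertex distance d occurs at some pair w a, w (a + p) (`inner_le_of_between`).
The feet cut the sides into pieces of which equal ones come in pairs, so the two boundary chains
joining this pair have pieces in common except for two of length μ a. The longer chain is enclosed
by the triangle over the base w a, w (a + p) whose legs lie along the two opposite sides
(`chain_length_le`). Therefore d is at most the sum of the parts of the legs between feet and apex,
and trigonometry in this triangle yields c cos (d/2) ≤ cos d (`cos_le_of_le_add`,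
`AltitudePolygon.diameter_pair`).

Covering. This bounds all inner products of vertices below by `sideInner c`, and Jung's theorem on
the sphere (`exists_disk_center`) turns the bound into the covering radius. In the regular triangle
the altitudes end at the midpoints of the sides and c cos (d/2) = cos d holds. Its thickness is the
length of its altitudes (`EquilateralTriangle.cos_thickness`); it is reduced because a convex body
missing a vertex leaves room to tilt a lune; and averaging over the vertices shows that no smaller
disk contains it. -/

namespace SphericalPolygon

noncomputable section

open scoped RealInnerProductSpace NNReal
open InnerProductGeometry Filter Topology

/-! ### Determinants, cross products and Gram identities -/

/-- Three-dimensional Euclidean space. -/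
abbrev E3 : Type := EuclideanSpace ℝ (Fin 3)

/-- The determinant of three vectors. -/
def det3 (a b c : E3) : ℝ :=
  a 0 * (b 1 * c 2 - b 2 * c 1) - a 1 * (b 0 * c 2 - b 2 * c 0) + a 2 * (b 0 * c 1 - b 1 * c 0)

/-- The cross product of two vectors. -/
def cross3 (a b : E3) : E3 :=
  !₂[a 1 * b 2 - a 2 * b 1, a 2 * b 0 - a 0 * b 2, a 0 * b 1 - a 1 * b 0]

lemma inner_eq_sum (a b : E3) : ⟪a, b⟫ = a 0 * b 0 + a 1 * b 1 + a 2 * b 2 := by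
  simp [PiLp.inner_apply, Fin.sum_univ_three, mul_comm]

lemma cross3_zero (a b : E3) : cross3 a b 0 = a 1 * b 2 - a 2 * b 1 := rfl
lemma cross3_one (a b : E3) : cross3 a b 1 = a 2 * b 0 - a 0 * b 2 := rfl
lemma cross3_two (a b : E3) : cross3 a b 2 = a 0 * b 1 - a 1 * b 0 := rfl

lemma ext3 {a b : E3} (h0 : a 0 = b 0) (h1 : a 1 = b 1) (h2 : a 2 = b 2) : a = b := by
  ext i; fin_cases i <;> assumption

lemma inner_cross3 (a b x : E3) : ⟪cross3 a b, x⟫ = det3 a b x := by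
  simp only [inner_eq_sum, det3, cross3_zero, cross3_one, cross3_two]; ring

lemma det3_add_right (a b x y : E3) : det3 a b (x + y) = det3 a b x + det3 a b y := by
  simp only [det3, PiLp.add_apply]; ring

lemma det3_smul_right (a b x : E3) (t : ℝ) : det3 a b (t • x) = t * det3 a b x := by
  simp only [det3, PiLp.smul_apply, smul_eq_mul]; ring

lemma det3_add_mid (a b x y : E3) : det3 a (x + y) b = det3 a x b + det3 a y b := by
  simp only [det3, PiLp.add_apply]; ring

lemma det3_smul_mid (a b x : E3) (t : ℝ) : det3 a (t • x) b = t * det3 a x b := by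
  simp only [det3, PiLp.smul_apply, smul_eq_mul]; ring

lemma det3_swap_right (a b c : E3) : det3 a c b = - det3 a b c := by
  simp only [det3]; ring

lemma det3_swap_left (a b c : E3) : det3 b a c = - det3 a b c := by
  simp only [det3]; ring

lemma det3_rotate (a b c : E3) : det3 b c a = det3 a b c := by
  simp only [det3]; ring

lemma det3_self_left (a b : E3) : det3 a a b = 0 := by
  simp only [det3]; ring

lemma det3_self_outer (a b : E3) : det3 a b a = 0 := by
  simp only [det3]; ring

lemma det3_self_right (a b : E3) : det3 a b b = 0 := by
  simp only [det3]; ring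

lemma det3_neg (a b c : E3) : det3 (-a) (-b) (-c) = - det3 a b c := by
  simp only [det3, PiLp.neg_apply]; ring

/-- The linear relation between four vectors of a three-dimensional space. -/
lemma det3_relation (a b c d : E3) :
    det3 b c d • a - det3 a c d • b + det3 a b d • c - det3 a b c • d = 0 := by
  apply ext3 <;> simp only [det3, PiLp.add_apply, PiLp.sub_apply, PiLp.smul_apply, smul_eq_mul,
    PiLp.zero_apply] <;> ring

/-- The Plücker relation in the quotient by `a`. -/
lemma det3_pluecker (a b c d e : E3) :
    det3 a b c * det3 a d e - det3 a b d * det3 a c e + det3 a b e * det3 a c d = 0 := by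
  simp only [det3]; ring

lemma det3_smul_eq (a b c h : E3) :
    det3 a b c • h = ⟪h, a⟫ • cross3 b c + ⟪h, b⟫ • cross3 c a + ⟪h, c⟫ • cross3 a b := by
  apply ext3 <;> simp only [det3, inner_eq_sum, PiLp.add_apply, PiLp.smul_apply, smul_eq_mul,
    cross3_zero, cross3_one, cross3_two] <;> ring

lemma eq_zero_of_inner_eq_zero {a b c h : E3} (hd : det3 a b c ≠ 0) (ha : ⟪h, a⟫ = 0)
    (hb : ⟪h, b⟫ = 0) (hc : ⟪h, c⟫ = 0) : h = 0 := by
  have := det3_smul_eq a b c h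
  rw [ha, hb, hc] at this
  simpa [hd] using this

/-- Pairing h with the four-vector relation leaves two terms: h and `det3 a b` both vanish on a and
b. The sign of the determinant thus tells on which side of the line through a and b a supporting
functional could be negative. -/
lemma inner_mul_det3 {a b h : E3} (ha : ⟪h, a⟫ = 0) (hb : ⟪h, b⟫ = 0) (x y : E3) :
    ⟪h, x⟫ * det3 a b y = ⟪h, y⟫ * det3 a b x := by
  have := congrArg (fun v => ⟪h, v⟫) (det3_relation a b x y)
  simp only [inner_add_right, inner_sub_right, inner_smul_right, ha, hb, inner_zero_right] at this
  linarith

/-- The product of two determinants with the same first two vectors is a Gram determinant. -/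
lemma det3_mul_det3 (a b x y : E3) : det3 a b x * det3 a b y =
    ⟪a, a⟫ * (⟪b, b⟫ * ⟪x, y⟫ - ⟪b, y⟫ * ⟪b, x⟫) - ⟪a, b⟫ * (⟪a, b⟫ * ⟪x, y⟫ - ⟪b, y⟫ * ⟪a, x⟫)
      + ⟪a, y⟫ * (⟪a, b⟫ * ⟪b, x⟫ - ⟪b, b⟫ * ⟪a, x⟫) := by
  simp only [det3, inner_eq_sum]; ring

/-! ### Two altitudes of the same length -/

/-- The normal at the foot of an altitude is determined by the other normal and so is the altitude:
two altitudes of the same length with the same normal at the foot agree. -/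
lemma altitude_unique {c : ℝ} (hc0 : 0 < c) (hc1 : c < 1) {e q e' q' : E3} (hq : ‖q‖ = 1)
    (he' : ‖e'‖ = 1) (hq' : ‖q'‖ = 1) (heq : ⟪e, q⟫ = c) (heq' : ⟪e', q'⟫ = c)
    (hh : e - c • q = e' - c • q') (hg : c * ⟪e', e⟫ ≤ ⟪q', e⟫) : e = e' ∧ q = q' := by
  have h1 : e = e' - c • q' + c • q := by rw [← hh]; abel
  have hqq : ⟪q', q'⟫ = 1 := by rw [real_inner_self_eq_norm_sq, hq']; norm_num
  have hee : ⟪e', e'⟫ = 1 := by rw [real_inner_self_eq_norm_sq, he']; norm_num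
  have hqq1 : ⟪q, q⟫ = 1 := by rw [real_inner_self_eq_norm_sq, hq]; norm_num
  have h2 : ⟪e', q⟫ = c * ⟪q', q⟫ := by
    have : ⟪e - c • q, q⟫ = 0 := by rw [inner_sub_left, real_inner_smul_left, heq, hqq1]; ring
    rw [hh, inner_sub_left, real_inner_smul_left] at this
    linarith
  rw [h1] at hg
  simp only [inner_add_right, inner_sub_right, real_inner_smul_right, hqq, hee, heq', h2,
    real_inner_comm e' q'] at hg
  -- After substitution the hypothesis `hg` reads c(1 - c²)(1 - ⟪q', q⟫) ≤ 0.
  have h3 : 1 ≤ ⟪q', q⟫ := by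
    by_contra hlt
    push Not at hlt
    have : 0 < c * (1 - c ^ 2) * (1 - ⟪q', q⟫) := by
      apply mul_pos (mul_pos hc0 (by nlinarith)) (by linarith)
    nlinarith
  have h4 : ⟪q', q⟫ = 1 := le_antisymm (by
    have := real_inner_le_norm q' q
    rwa [hq, hq', mul_one] at this) h3
  have h5 : q' = q := (inner_eq_one_iff_of_norm_eq_one hq' hq).1 h4
  subst h5
  exact ⟨sub_left_injective hh, rfl⟩

/-- Here a, a', b, b' stand for ⟪e, e'⟫, ⟪q, e'⟫, ⟪e, q'⟫, ⟪q, q'⟫, and D, D' for the determinants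
of e' and q' against e, q, up to a common sign. The linear hypotheses are the strip conditions, the
quadratic ones Gram identities. They force D' ≤ cD and D ≤ cD', which is impossible for c < 1. -/
lemma altitude_crossing_aux {c : ℝ} (hc0 : 0 < c) (hc1 : c < 1) {a b a' b' D D' : ℝ}
    (hD : 0 < D) (hD' : 0 < D')
    (h1 : c * a' ≤ a) (h2 : c * a ≤ a') (h3 : c * b' ≤ b) (h4 : c * b ≤ b')
    (h5 : c * b ≤ a) (h6 : c * a ≤ b) (h7 : c * b' ≤ a') (h8 : c * a' ≤ b')
    (hx : (1 - c ^ 2) - (a ^ 2 + a' ^ 2 - 2 * c * a * a') = D ^ 2)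
    (hy : (1 - c ^ 2) - (b ^ 2 + b' ^ 2 - 2 * c * b * b') = D' ^ 2)
    (hxy : c * (1 - c ^ 2) - (a * b + a' * b' - c * (a * b' + a' * b)) = D * D') : False := by
  have hc2 : 0 < 1 - c ^ 2 := by nlinarith
  have ha : 0 < a := by
    by_contra h
    push Not at h
    have : a = 0 := by nlinarith
    have : a' = 0 := by nlinarith
    have : b = 0 := by nlinarith
    have : b' = 0 := by nlinarith
    subst_vars
    have e1 : D ^ 2 = 1 - c ^ 2 := by linarith
    have e2 : D' ^ 2 = 1 - c ^ 2 := by linarith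
    have e3 : D * D' = c * (1 - c ^ 2) := by linarith
    have e4 : (c * (1 - c ^ 2)) ^ 2 = (1 - c ^ 2) * (1 - c ^ 2) := by
      rw [← e3, mul_pow, e1, e2]
    nlinarith [mul_pos hc2 (mul_pos hc2 hc2)]
  have ha' : 0 < a' := by nlinarith
  have hb : 0 < b := by nlinarith
  have hb' : 0 < b' := by nlinarith
  have key : ∀ x y : ℝ, 0 < x → c * x ≤ y → 0 ≤ (1 - c ^ 2) - D ^ 2 →
      y * ((1 - c ^ 2) - D ^ 2) ≤ x * (c * (1 - c ^ 2) - D * D') → D' ≤ c * D := by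
    intro x y hx0 hxy0 hr h
    have h9 := mul_le_mul_of_nonneg_right hxy0 hr
    have h10 : x * (D * D') ≤ x * (D * (c * D)) := by linarith
    exact le_of_mul_le_mul_left (le_of_mul_le_mul_left h10 hx0) hD
  have key' : ∀ x y : ℝ, 0 < x → c * x ≤ y → 0 ≤ (1 - c ^ 2) - D' ^ 2 →
      y * ((1 - c ^ 2) - D' ^ 2) ≤ x * (c * (1 - c ^ 2) - D * D') → D ≤ c * D' := by
    intro x y hx0 hxy0 hr h
    have h9 := mul_le_mul_of_nonneg_right hxy0 hr
    have h10 : x * (D' * D) ≤ x * (D' * (c * D')) := by linarith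
    exact le_of_mul_le_mul_left (le_of_mul_le_mul_left h10 hx0) hD'
  have r1 : 0 ≤ (1 - c ^ 2) - D ^ 2 := by
    linarith [sq_nonneg (a - c * a'), mul_nonneg hc2.le (mul_pos ha' ha').le]
  have r2 : 0 ≤ (1 - c ^ 2) - D' ^ 2 := by
    linarith [sq_nonneg (b - c * b'), mul_nonneg hc2.le (mul_pos hb' hb').le]
  have hfin : D' ≤ c * D → D ≤ c * D' → False := fun h h' => by
    have h9 : c * D' ≤ c * (c * D) := mul_le_mul_of_nonneg_left h hc0.le
    have h10 : 0 < D * (1 - c ^ 2) := mul_pos hD hc2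
    linarith
  -- The differences needed for `key` and `key'` factor as a b' - a' b times the slack of a strip
  -- inequality; the sign of the first factor decides which strip inequalities to use.
  rcases le_total 0 (a * b' - a' * b) with hT | hT
  · apply hfin
    · apply key a b ha h6 r1
      have : a * (c * (1 - c ^ 2) - D * D') - b * ((1 - c ^ 2) - D ^ 2)
        = (a * b' - a' * b) * (a' - c * a) := by rw [← hx, ← hxy]; ring
      linarith [mul_nonneg hT (sub_nonneg.2 h2)]
    · apply key' b' a' hb' h7 r2
      have : b' * (c * (1 - c ^ 2) - D * D') - a' * ((1 - c ^ 2) - D' ^ 2)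
        = (a * b' - a' * b) * (b - c * b') := by rw [← hy, ← hxy]; ring
      linarith [mul_nonneg hT (sub_nonneg.2 h3)]
  · apply hfin
    · apply key a' b' ha' h8 r1
      have : a' * (c * (1 - c ^ 2) - D * D') - b' * ((1 - c ^ 2) - D ^ 2)
        = -(a * b' - a' * b) * (a - c * a') := by rw [← hx, ← hxy]; ring
      linarith [mul_nonneg (neg_nonneg.2 hT) (sub_nonneg.2 h1)]
    · apply key' b a hb h5 r2
      have : b * (c * (1 - c ^ 2) - D * D') - a * ((1 - c ^ 2) - D' ^ 2)
        = -(a * b' - a' * b) * (b' - c * b) := by rw [← hy, ← hxy]; ring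
      linarith [mul_nonneg (neg_nonneg.2 hT) (sub_nonneg.2 h4)]

/-- `eq` is an arc of length `arccos c` and the point `x` lies in the lune with the centers `e`, `q`
of its bounding semicircles. -/
def InStrip (c : ℝ) (e q x : E3) : Prop := c * ⟪e, x⟫ ≤ ⟪q, x⟫ ∧ c * ⟪q, x⟫ ≤ ⟪e, x⟫

/-- Two altitudes of the same length cross: the ends of one are not strictly on the same side of
the other. -/
lemma altitude_crossing {c : ℝ} (hc0 : 0 < c) (hc1 : c < 1) {e q e' q' : E3} (he : ‖e‖ = 1)
    (hq : ‖q‖ = 1) (he' : ‖e'‖ = 1) (hq' : ‖q'‖ = 1) (heq : ⟪e, q⟫ = c) (heq' : ⟪e', q'⟫ = c)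
    (h1 : InStrip c e q e') (h2 : InStrip c e q q') (h3 : InStrip c e' q' e)
    (h4 : InStrip c e' q' q) (hD : 0 < det3 e q e' * det3 e q q') : False := by
  have n1 : ⟪e, e⟫ = 1 := by rw [real_inner_self_eq_norm_sq, he]; norm_num
  have n2 : ⟪q, q⟫ = 1 := by rw [real_inner_self_eq_norm_sq, hq]; norm_num
  have n3 : ⟪e', e'⟫ = 1 := by rw [real_inner_self_eq_norm_sq, he']; norm_num
  have n4 : ⟪q', q'⟫ = 1 := by rw [real_inner_self_eq_norm_sq, hq']; norm_num
  obtain ⟨h1a, h1b⟩ := h1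
  obtain ⟨h2a, h2b⟩ := h2
  obtain ⟨h3a, h3b⟩ := h3
  obtain ⟨h4a, h4b⟩ := h4
  rw [real_inner_comm e e', real_inner_comm e q'] at h3a h3b
  rw [real_inner_comm q e', real_inner_comm q q'] at h4a h4b
  have hx := det3_mul_det3 e q e' e'
  have hy := det3_mul_det3 e q q' q'
  have hxy := det3_mul_det3 e q e' q'
  rw [n1, n2, n3, heq] at hx
  rw [n1, n2, n4, heq] at hy
  rw [n1, n2, heq', heq] at hxy
  have key : ∀ D D' : ℝ, 0 < D → 0 < D' → D * D = det3 e q e' * det3 e q e' →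
      D' * D' = det3 e q q' * det3 e q q' → D * D' = det3 e q e' * det3 e q q' → False := by
    intro D D' hD hD' e1 e2 e3
    rw [hx] at e1
    rw [hy] at e2
    rw [hxy] at e3
    exact altitude_crossing_aux hc0 hc1 hD hD' h1b h1a h2b h2a h3b h3a h4b h4a
      (by linear_combination -e1) (by linear_combination -e2) (by linear_combination -e3)
  rcases pos_and_pos_or_neg_and_neg_of_mul_pos hD with ⟨p1, p2⟩ | ⟨p1, p2⟩
  · exact key _ _ p1 p2 rfl rfl rfl
  · exact key (-det3 e q e') (-det3 e q q') (by linarith) (by linarith) (by ring) (by ring)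
      (by ring)

/-! ### Convex chains and the enclosing triangle -/

lemma angle_eq_add_of_combination {x y z : E3} {r a b : ℝ} (hy : y ≠ 0) (hr : 0 < r) (ha : 0 ≤ a)
    (hb : 0 ≤ b) (h : r • y = a • x + b • z) : angle x z = angle x y + angle y z := by
  apply angle_eq_angle_add_add_angle_add_of_mem_span hy
  rw [Submodule.mem_span_pair]
  refine ⟨(a / r).toNNReal, (b / r).toNNReal, ?_⟩
  rw [NNReal.smul_def, NNReal.smul_def, Real.coe_toNNReal _ (by positivity),
    Real.coe_toNNReal _ (by positivity)]
  have : y = r⁻¹ • (r • y) := by rw [smul_smul, inv_mul_cancel₀ hr.ne', one_smul]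
  rw [this, h, smul_add, smul_smul, smul_smul]
  congr 2 <;> field_simp

/-- The intersection of the lines through the first and the last side of the convex chain
`y i, …, y (m + 1)`. -/
def chainApex (y : ℕ → E3) (m i : ℕ) : E3 :=
  det3 (y i) (y m) (y (m + 1)) • y (i + 1) - det3 (y (i + 1)) (y m) (y (m + 1)) • y i

lemma chainApex_eq (y : ℕ → E3) (m i : ℕ) : chainApex y m i =
    det3 (y i) (y (i + 1)) (y (m + 1)) • y m - det3 (y i) (y (i + 1)) (y m) • y (m + 1) := by
  have := det3_relation (y i) (y (i + 1)) (y m) (y (m + 1))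
  rw [chainApex, ← sub_eq_zero, ← neg_eq_zero, ← this]
  abel

lemma chainApex_ne_zero {y : ℕ → E3} {m i : ℕ} (him : i < m)
    (hpos : ∀ i j k, i < j → j < k → k ≤ m + 1 → 0 < det3 (y i) (y j) (y k)) :
    chainApex y m i ≠ 0 := by
  intro h
  have h1 : det3 (y i) (y (m + 1)) (chainApex y m i) = 0 := by
    rw [h]; simp [det3]
  rw [chainApex_eq, sub_eq_add_neg, ← neg_smul, det3_add_right, det3_smul_right, det3_smul_right,
    det3_self_right, mul_zero, add_zero, mul_eq_zero, det3_swap_right (y i) (y m)] at h1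
  have h2 := hpos i (i + 1) (m + 1) (by omega) (by omega) le_rfl
  have h3 := hpos i m (m + 1) (by omega) (by omega) le_rfl
  rcases h1 with h1 | h1 <;> linarith

lemma det3_nonneg_of_le {y : ℕ → E3} {m : ℕ}
    (hpos : ∀ i j k, i < j → j < k → k ≤ m + 1 → 0 < det3 (y i) (y j) (y k)) {i j k : ℕ}
    (hij : i ≤ j) (hjk : j ≤ k) (hk : k ≤ m + 1) : 0 ≤ det3 (y i) (y j) (y k) := by
  rcases hij.eq_or_lt with rfl | hij
  · rw [det3_self_left]
  rcases hjk.eq_or_lt with rfl | hjk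
  · rw [det3_self_right]
  exact (hpos i j k hij hjk hk).le

/-- A convex chain is not longer than the two arcs through the apex that enclose it. -/
lemma chain_length_le {y : ℕ → E3} {m : ℕ}
    (hpos : ∀ i j k, i < j → j < k → k ≤ m + 1 → 0 < det3 (y i) (y j) (y k)) (l : ℕ) :
    ∀ i, i + l + 1 = m → ∑ j ∈ Finset.Ico i (m + 1), angle (y j) (y (j + 1)) ≤
      angle (y i) (chainApex y m i) + angle (chainApex y m i) (y (m + 1)) := by
  induction l with
  | zero =>
    intro i hi
    have hm : m = i + 1 := by omega
    subst hm
    have hP : chainApex y (i + 1) i = det3 (y i) (y (i + 1)) (y (i + 1 + 1)) • y (i + 1) := by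
      rw [chainApex, det3_self_left, zero_smul, sub_zero]
    have h0 := hpos i (i + 1) (i + 1 + 1) (by omega) (by omega) le_rfl
    rw [Finset.sum_Ico_succ_top (by omega), Finset.sum_Ico_succ_top (by omega), Finset.Ico_self,
      Finset.sum_empty, hP, angle_smul_right_of_pos _ _ h0, angle_smul_left_of_pos _ _ h0]
    linarith
  | succ l ih =>
    intro i hi
    have ih' := ih (i + 1) (by omega)
    rw [Finset.sum_eq_sum_Ico_succ_bot (by omega)]
    have hy : y (i + 1) ≠ 0 := by
      intro h
      have := hpos i (i + 1) m (by omega) (by omega) (by omega)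
      rw [h] at this
      simp [det3] at this
    have e1 : angle (y i) (chainApex y m i) =
        angle (y i) (y (i + 1)) + angle (y (i + 1)) (chainApex y m i) := by
      apply angle_eq_add_of_combination hy (hpos i m (m + 1) (by omega) (by omega) le_rfl)
        (det3_nonneg_of_le hpos (i := i + 1) (j := m) (k := m + 1) (by omega) (by omega) le_rfl)
        zero_le_one
      rw [chainApex]
      module
    -- The apex of the shortened chain lies on the arc from the old apex to the last vertex; the
    -- sign needed for this comes from the Plücker relation.
    have e2 : angle (chainApex y m i) (y (m + 1)) = angle (chainApex y m i)
        (chainApex y m (i + 1)) + angle (chainApex y m (i + 1)) (y (m + 1)) := by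
      have hb : 0 ≤ det3 (y (i + 1)) (y (i + 1 + 1)) (y (m + 1)) * det3 (y i) (y (i + 1)) (y m)
          - det3 (y i) (y (i + 1)) (y (m + 1)) * det3 (y (i + 1)) (y (i + 1 + 1)) (y m) := by
        have hp := det3_pluecker (y (i + 1)) (y i) (y (i + 1 + 1)) (y m) (y (m + 1))
        have h1 := hpos i (i + 1) (i + 1 + 1) (by omega) (by omega) (by omega)
        have h2 := hpos (i + 1) m (m + 1) (by omega) (by omega) le_rfl
        rw [det3_swap_left (y i), det3_swap_left (y i), det3_swap_left (y i)] at hp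
        nlinarith [mul_pos h1 h2]
      apply angle_eq_add_of_combination (chainApex_ne_zero (by omega) hpos)
        (hpos i (i + 1) (m + 1) (by omega) (by omega) le_rfl)
        (hpos (i + 1) (i + 1 + 1) (m + 1) (by omega) (by omega) le_rfl).le hb
      rw [chainApex_eq, chainApex_eq]
      module
    have e3 := angle_le_angle_add_angle (y (i + 1)) (chainApex y m i) (chainApex y m (i + 1))
    linarith

/-- The base of the isosceles triangle with the given altitude is at most twice the part of a leg
between the foot of an altitude and the apex only if the foot is not beyond the middle. -/
lemma cos_le_of_le_add {c μ τ τ' d : ℝ} (hc0 : 0 < c) (hc1 : c < 1) (hμ : 0 ≤ μ) (hτ : 0 ≤ τ)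
    (hτ' : 0 ≤ τ') (hd0 : 0 ≤ d) (hd1 : d ≤ Real.pi / 2) (h1 : μ + τ ≤ Real.pi)
    (h2 : μ + τ' ≤ Real.pi) (e1 : Real.cos (μ + τ') = c * Real.cos τ)
    (e2 : Real.cos (μ + τ) = c * Real.cos τ') (e3 : Real.cos d = c * Real.cos μ)
    (hle : d ≤ τ + τ') : c * Real.cos (d / 2) ≤ Real.cos d := by
  have hpi := Real.pi_pos
  -- The cosine relations are symmetric in τ and τ' and force the triangle to be isosceles: the
  -- longer of the two would have the smaller cosine on one side and the larger on the other.
  have key : ∀ τ τ' : ℝ, 0 ≤ τ → τ ≤ τ' → μ + τ' ≤ Real.pi →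
      Real.cos (μ + τ') = c * Real.cos τ → Real.cos (μ + τ) = c * Real.cos τ' → τ' ≤ τ := by
    intro τ τ' hτ hle h2 e1 e2
    have : Real.cos (μ + τ') ≤ Real.cos (μ + τ) :=
      Real.cos_le_cos_of_nonneg_of_le_pi (by linarith) h2 (by linarith)
    rw [e1, e2] at this
    have := le_of_mul_le_mul_left this hc0
    by_contra hlt
    push Not at hlt
    have := Real.cos_lt_cos_of_nonneg_of_le_pi hτ (by linarith) hlt
    linarith
  have heq : τ' = τ := by
    rcases le_total τ τ' with h | h
    · exact le_antisymm (key τ τ' hτ h h2 e1 e2) h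
    · exact le_antisymm h (key τ' τ hτ' h h1 e2 e1)
  subst heq
  -- If μ ≤ d/2, then cos d = c cos μ finishes. Otherwise τ ≥ d/2 is contradicted below.
  rcases le_or_gt μ (d / 2) with hμd | hμd
  · rw [e3]
    exact mul_le_mul_of_nonneg_left
      (Real.cos_le_cos_of_nonneg_of_le_pi hμ (by linarith) hμd) hc0.le
  exfalso
  have hcosτ : 0 < Real.cos τ' := by
    by_contra hcon
    push Not at hcon
    have hle2 : Real.cos (μ + τ') ≤ Real.cos τ' :=
      Real.cos_le_cos_of_nonneg_of_le_pi hτ h1 (by linarith)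
    have h0 : Real.cos τ' = 0 := by nlinarith
    have hlt : Real.cos (μ + τ') < Real.cos τ' :=
      Real.cos_lt_cos_of_nonneg_of_le_pi hτ h1 (by linarith)
    rw [e1, h0] at hlt
    linarith
  have hμπ : μ < Real.pi := by
    rcases eq_or_lt_of_le (show μ ≤ Real.pi by linarith) with h | h
    · have : Real.cos d = -c := by rw [e3, h, Real.cos_pi]; ring
      have := Real.cos_nonneg_of_neg_pi_div_two_le_of_le (by linarith) hd1
      linarith
    · exact h
  have hS : 0 < Real.sin μ := Real.sin_pos_of_pos_of_lt_pi (by linarith) hμπ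
  have hsτ : 0 ≤ Real.sin τ' := Real.sin_nonneg_of_nonneg_of_le_pi hτ (by linarith)
  have e4 := e1
  rw [Real.cos_add] at e4
  have hC : 0 < Real.cos μ := by
    have : 0 < Real.cos μ * Real.cos τ' := by
      nlinarith [mul_nonneg hS.le hsτ, mul_pos hc0 hcosτ]
    exact pos_of_mul_pos_left this hcosτ.le
  set δ := d / 2 with hδ
  have hk : 0 < Real.cos δ := Real.cos_pos_of_mem_Ioo ⟨by linarith, by linarith⟩
  have hσ : 0 ≤ Real.sin δ := Real.sin_nonneg_of_nonneg_of_le_pi (by linarith) (by linarith)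
  have hcosd : Real.cos d = Real.cos δ ^ 2 - Real.sin δ ^ 2 := by
    rw [← Real.cos_two_mul']; congr 1; ring
  have hcosd0 := Real.cos_nonneg_of_neg_pi_div_two_le_of_le (by linarith) hd1
  have hτδ : 0 ≤ Real.sin τ' * Real.cos δ - Real.cos τ' * Real.sin δ := by
    rw [← Real.sin_sub]
    exact Real.sin_nonneg_of_nonneg_of_le_pi (by linarith) (by linarith)
  have hμδ : 0 < Real.sin μ * Real.cos δ - Real.cos μ * Real.sin δ := by
    rw [← Real.sin_sub]
    exact Real.sin_pos_of_pos_of_lt_pi (by linarith) (by linarith)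
  have e5 : Real.cos τ' * (Real.cos μ ^ 2 - Real.cos d) =
      Real.sin μ * Real.cos μ * Real.sin τ' := by
    rw [e3]; linear_combination Real.cos μ * e4
  -- This is sin (τ' - δ) ≥ 0 with τ' eliminated by `e5`.
  have e6 : 0 ≤ (Real.cos μ ^ 2 - Real.cos d) * Real.cos δ
      - Real.sin μ * Real.cos μ * Real.sin δ := by
    have : 0 ≤ Real.cos τ' * ((Real.cos μ ^ 2 - Real.cos d) * Real.cos δ
        - Real.sin μ * Real.cos μ * Real.sin δ) := by
      have := mul_nonneg (mul_pos hS hC).le hτδ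
      linear_combination this - Real.cos δ * e5
    exact nonneg_of_mul_nonneg_right this hcosτ
  have p1 := Real.sin_sq_add_cos_sq μ
  have p2 := Real.sin_sq_add_cos_sq δ
  -- The right-hand side is -sin (μ - δ) sin (μ + d), written out in sines and cosines of μ and δ.
  have e7 : (Real.cos μ ^ 2 - Real.cos d) * Real.cos δ - Real.sin μ * Real.cos μ * Real.sin δ =
      -(Real.sin μ * Real.cos δ - Real.cos μ * Real.sin δ) *
        (2 * Real.sin δ * Real.cos δ * Real.cos μ
          + Real.sin μ * (Real.cos δ ^ 2 - Real.sin δ ^ 2)) := by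
    rw [hcosd]
    linear_combination (-Real.cos μ ^ 2 * Real.cos δ + Real.sin μ * Real.cos μ * Real.sin δ) * p2
      + (Real.cos δ ^ 2 - Real.sin δ ^ 2) * Real.cos δ * p1
  have hpos : 0 < 2 * Real.sin δ * Real.cos δ * Real.cos μ
      + Real.sin μ * (Real.cos δ ^ 2 - Real.sin δ ^ 2) := by
    rw [← hcosd]
    rcases eq_or_lt_of_le hcosd0 with h | h
    · have : Real.sin δ ≠ 0 := by
        intro h0
        rw [h0, ← h] at hcosd
        nlinarith
      have : 0 < Real.sin δ := lt_of_le_of_ne hσ this.symm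
      rw [← h]; positivity
    · have := mul_pos hS h
      have : 0 ≤ 2 * Real.sin δ * Real.cos δ * Real.cos μ := by positivity
      linarith
  rw [e7] at e6
  nlinarith [mul_pos hμδ hpos]

/-! ### Polygons in which every vertex has an altitude -/

/-- A convex spherical polygon with the vertices `w 0, …, w (n - 1)` in positive cyclic order
(continued periodically), such that every vertex `w i` is the center of one of the two semicircles
bounding a lune of thickness `arccos c` that contains the polygon; `q i` is the center of the other
semicircle. The last condition says that no lune containing the polygon is narrower. -/
structure AltitudePolygon (c : ℝ) (n : ℤ) (w q : ℤ → E3) : Prop where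
  three_le : 3 ≤ n
  c_pos : 0 < c
  c_lt_one : c < 1
  periodic_w : Function.Periodic w n
  periodic_q : Function.Periodic q n
  norm_w : ∀ i, ‖w i‖ = 1
  norm_q : ∀ i, ‖q i‖ = 1
  det_pos : ∀ i j k, i < j → j < k → k < i + n → 0 < det3 (w i) (w j) (w k)
  inner_w_q : ∀ i, ⟪w i, q i⟫ = c
  strip : ∀ i k, InStrip c (w i) (q i) (w k)
  cone : ∀ i, q i ∈ Submodule.span ℝ≥0 (Set.range w)
  optimal : ∀ x y : E3, (∀ k, 0 ≤ ⟪x, w k⟫) → (∀ k, 0 ≤ ⟪y, w k⟫) → -(c * (‖x‖ * ‖y‖)) ≤ ⟪x, y⟫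

/-- The normal vector (not normalized) at the far end of the altitude from `e` to `q`. -/
def farNormal (c : ℝ) (e q : E3) : E3 := e - c • q

lemma farNormal_inner (c : ℝ) (e q x : E3) : ⟪farNormal c e q, x⟫ = ⟪e, x⟫ - c * ⟪q, x⟫ := by
  rw [farNormal, inner_sub_left, real_inner_smul_left]

lemma inner_self_eq_one {x : E3} (h : ‖x‖ = 1) : ⟪x, x⟫ = 1 := by
  rw [real_inner_self_eq_norm_sq, h]; norm_num

lemma farNormal_inner_self {c : ℝ} {e q : E3} (he : ‖e‖ = 1) (hq : ‖q‖ = 1) (h : ⟪e, q⟫ = c) :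
    ⟪farNormal c e q, farNormal c e q⟫ = 1 - c ^ 2 := by
  rw [farNormal, inner_sub_left, inner_sub_right, inner_sub_right, real_inner_smul_left,
    real_inner_smul_left, real_inner_smul_right, real_inner_smul_right, real_inner_comm e q, h,
    inner_self_eq_one he, inner_self_eq_one hq]
  ring

/-- Both normals have squared length 1 - c², so their angle has cosine -c: they bound a lune of
thickness arccos c. -/
lemma farNormal_inner_swap {c : ℝ} {e q : E3} (he : ‖e‖ = 1) (hq : ‖q‖ = 1) (h : ⟪e, q⟫ = c) :
    ⟪farNormal c q e, farNormal c e q⟫ = -(c * (1 - c ^ 2)) := by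
  rw [farNormal, farNormal, inner_sub_left, inner_sub_right, inner_sub_right, real_inner_smul_left,
    real_inner_smul_left, real_inner_smul_right, real_inner_smul_right, real_inner_comm e q, h,
    inner_self_eq_one he, inner_self_eq_one hq]
  ring

/-- A face of a finitely generated cone is generated by the generators it contains. -/
lemma span_face {s : Set E3} {y : E3} (hy : ∀ v ∈ s, 0 ≤ ⟪y, v⟫) {x : E3}
    (hx : x ∈ Submodule.span ℝ≥0 s) :
    0 ≤ ⟪y, x⟫ ∧ (⟪y, x⟫ = 0 → x ∈ Submodule.span ℝ≥0 {v ∈ s | ⟪y, v⟫ = 0}) := by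
  induction hx using Submodule.span_induction with
  | mem v hv => exact ⟨hy v hv, fun h => Submodule.subset_span ⟨hv, h⟩⟩
  | zero => exact ⟨by simp, fun _ => Submodule.zero_mem _⟩
  | add a b _ _ ha hb =>
    rw [inner_add_right]
    refine ⟨add_nonneg ha.1 hb.1, fun h => Submodule.add_mem _ (ha.2 ?_) (hb.2 ?_)⟩ <;>
      linarith [ha.1, hb.1]
  | smul r a _ ha =>
    rw [NNReal.smul_def, real_inner_smul_right]
    refine ⟨mul_nonneg r.2 ha.1, fun h => ?_⟩
    rcases mul_eq_zero.1 h with h | h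
    · rw [h, zero_smul]; exact Submodule.zero_mem _
    · exact Submodule.smul_mem _ r (ha.2 h)

namespace AltitudePolygon

variable {c : ℝ} {n : ℤ} {w q : ℤ → E3}

lemma exists_rep (H : AltitudePolygon c n w q) (i k : ℤ) :
    ∃ k' m, i ≤ k' ∧ k' < i + n ∧ k' = k + m * n := by
  have hn := H.three_le
  refine ⟨i + (k - i) % n, -((k - i) / n), ?_, ?_, ?_⟩
  · have := Int.emod_nonneg (k - i) (b := n) (by omega); omega
  · have := Int.emod_lt_of_pos (k - i) (b := n) (by omega); omega
  · have := Int.emod_add_mul_ediv (k - i) n; linarith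

lemma w_add_mul (H : AltitudePolygon c n w q) (k m : ℤ) : w (k + m * n) = w k :=
  H.periodic_w.int_mul m k

lemma q_add_mul (H : AltitudePolygon c n w q) (k m : ℤ) : q (k + m * n) = q k :=
  H.periodic_q.int_mul m k

lemma w_add (H : AltitudePolygon c n w q) (k : ℤ) : w (k + n) = w k := H.periodic_w k

lemma ne_of_lt (H : AltitudePolygon c n w q) {i j : ℤ} (hij : i < j) (hj : j < i + n) :
    w i ≠ w j := by
  intro h
  have hn := H.three_le
  rcases lt_or_ge (j + 1) (i + n) with h1 | h1
  · have := H.det_pos i j (j + 1) hij (by omega) h1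
    rw [h, det3_self_left] at this
    exact lt_irrefl _ this
  · have := H.det_pos i (i + 1) j (by omega) (by omega) hj
    rw [h, det3_self_outer] at this
    exact lt_irrefl _ this

lemma eq_of_w_eq (H : AltitudePolygon c n w q) {a i j : ℤ} (hi : a ≤ i) (hi' : i < a + n)
    (hj : a ≤ j) (hj' : j < a + n) (h : w i = w j) : i = j := by
  rcases lt_trichotomy i j with h1 | h1 | h1
  · exact absurd h (H.ne_of_lt h1 (by omega))
  · exact h1
  · exact absurd h.symm (H.ne_of_lt h1 (by omega))

lemma q_eq_of_w_eq (H : AltitudePolygon c n w q) {i j : ℤ} (h : w i = w j) : q i = q j := by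
  obtain ⟨k, m, hk, hk', e⟩ := H.exists_rep i j
  have hn := H.three_le
  have : i = k := H.eq_of_w_eq (a := i) le_rfl (by omega) hk hk' (by rw [h, e, H.w_add_mul])
  rw [this, e, H.q_add_mul]

lemma three_zeros (H : AltitudePolygon c n w q) {y : E3} (hy : y ≠ 0) {a b d : ℤ} (hab : a < b)
    (hbd : b < d) (hd : d < a + n) (ha : ⟪y, w a⟫ = 0) (hb : ⟪y, w b⟫ = 0)
    (hd0 : ⟪y, w d⟫ = 0) : False :=
  hy (eq_zero_of_inner_eq_zero (H.det_pos a b d hab hbd hd).ne' ha hb hd0)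

/-- If neither boundary arc between w a and w b were a single side, w (a + 1) and w (b + 1) would
lie strictly on opposite sides of their line. A nonnegative functional vanishing at w a and w b
would then vanish at w (a + 1) too, giving three zeros. -/
lemma zeros_adjacent (H : AltitudePolygon c n w q) {y : E3} (hy : y ≠ 0)
    (hnn : ∀ k, 0 ≤ ⟪y, w k⟫) {a b : ℤ} (hab : a < b) (hb : b < a + n) (ha0 : ⟪y, w a⟫ = 0)
    (hb0 : ⟪y, w b⟫ = 0) : b = a + 1 ∨ b + 1 = a + n := by
  by_contra hcon
  push Not at hcon
  have h1 := H.det_pos a (a + 1) b (by omega) (by omega) hb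
  have h2 := H.det_pos a b (b + 1) hab (by omega) (by omega)
  have h3 := inner_mul_det3 ha0 hb0 (w (a + 1)) (w (b + 1))
  rw [det3_swap_right (w a) (w (a + 1))] at h3
  have h4 : ⟪y, w (a + 1)⟫ = 0 := by
    nlinarith [mul_nonneg (hnn (a + 1)) h2.le, mul_nonneg (hnn (b + 1)) h1.le, hnn (a + 1)]
  exact H.three_zeros hy (by omega) (by omega) hb ha0 h4 hb0

/-- The side with the end points `w m` and `w (m + 1)` is opposite to `w i`. -/
structure IsOpposite (c : ℝ) (n : ℤ) (w q : ℤ → E3) (i m : ℤ) : Prop where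
  lt : i < m
  lt' : m + 1 < i + n
  left : ⟪farNormal c (w i) (q i), w m⟫ = 0
  right : ⟪farNormal c (w i) (q i), w (m + 1)⟫ = 0
  combination : ∃ α β : ℝ, 0 ≤ α ∧ 0 ≤ β ∧ q i = α • w m + β • w (m + 1)

lemma far_nonneg (H : AltitudePolygon c n w q) (i k : ℤ) :
    0 ≤ ⟪farNormal c (w i) (q i), w k⟫ := by
  rw [farNormal_inner]; linarith [(H.strip i k).2]

lemma near_nonneg (H : AltitudePolygon c n w q) (i k : ℤ) :
    0 ≤ ⟪farNormal c (q i) (w i), w k⟫ := by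
  rw [farNormal_inner]; linarith [(H.strip i k).1]

lemma one_sub_sq_pos (H : AltitudePolygon c n w q) : 0 < 1 - c ^ 2 := by
  have := H.c_pos; have := H.c_lt_one; nlinarith

lemma far_inner_self (H : AltitudePolygon c n w q) (i : ℤ) :
    ⟪farNormal c (w i) (q i), farNormal c (w i) (q i)⟫ = 1 - c ^ 2 :=
  farNormal_inner_self (H.norm_w i) (H.norm_q i) (H.inner_w_q i)

lemma near_inner_self (H : AltitudePolygon c n w q) (i : ℤ) :
    ⟪farNormal c (q i) (w i), farNormal c (q i) (w i)⟫ = 1 - c ^ 2 :=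
  farNormal_inner_self (H.norm_q i) (H.norm_w i) (by rw [real_inner_comm]; exact H.inner_w_q i)

lemma far_ne_zero (H : AltitudePolygon c n w q) (i : ℤ) : farNormal c (w i) (q i) ≠ 0 := by
  intro h
  have := H.far_inner_self i
  rw [h, inner_zero_left] at this
  linarith [H.one_sub_sq_pos]

lemma near_ne_zero (H : AltitudePolygon c n w q) (i : ℤ) : farNormal c (q i) (w i) ≠ 0 := by
  intro h
  have := H.near_inner_self i
  rw [h, inner_zero_left] at this
  linarith [H.one_sub_sq_pos]

lemma far_inner_vertex (H : AltitudePolygon c n w q) (i : ℤ) :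
    0 < ⟪farNormal c (w i) (q i), w i⟫ := by
  rw [farNormal_inner, inner_self_eq_one (H.norm_w i), real_inner_comm, H.inner_w_q]
  linarith [H.one_sub_sq_pos]

lemma near_inner_vertex (H : AltitudePolygon c n w q) (i : ℤ) :
    ⟪farNormal c (q i) (w i), w i⟫ = 0 := by
  rw [farNormal_inner, inner_self_eq_one (H.norm_w i), real_inner_comm, H.inner_w_q]
  ring

lemma far_inner_foot (H : AltitudePolygon c n w q) (i : ℤ) :
    ⟪farNormal c (w i) (q i), q i⟫ = 0 := by
  rw [farNormal_inner, inner_self_eq_one (H.norm_q i), H.inner_w_q]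
  ring

/-- Strict inequalities survive a small perturbation. -/
lemma eventually_perturb (H : AltitudePolygon c n w q) {y v : E3} (hy : ∀ k, 0 ≤ ⟪y, w k⟫)
    (hv : ∀ k, ⟪y, w k⟫ = 0 → 0 ≤ ⟪v, w k⟫) :
    ∀ᶠ t : ℝ in 𝓝[>] 0, ∀ k, 0 ≤ ⟪y + t • v, w k⟫ := by
  have h1 : ∀ k, ∀ᶠ t : ℝ in 𝓝[>] 0, 0 ≤ ⟪y + t • v, w k⟫ := by
    intro k
    rcases (hy k).eq_or_lt with h | h
    · filter_upwards [self_mem_nhdsWithin] with t ht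
      rw [inner_add_left, real_inner_smul_left, ← h, zero_add]
      exact mul_nonneg (le_of_lt ht) (hv k h.symm)
    · have hc : Continuous fun t : ℝ => ⟪y + t • v, w k⟫ := by fun_prop
      have : ∀ᶠ t : ℝ in 𝓝 0, 0 < ⟪y + t • v, w k⟫ :=
        (hc.tendsto 0).eventually (lt_mem_nhds (by simpa using h))
      exact (this.filter_mono nhdsWithin_le_nhds).mono fun t ht => ht.le
  have h2 : ∀ᶠ t : ℝ in 𝓝[>] 0, ∀ k ∈ Finset.Ico 0 n, 0 ≤ ⟪y + t • v, w k⟫ :=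
    (Finset.eventually_all _).2 fun k _ => h1 k
  filter_upwards [h2] with t ht k
  obtain ⟨k', m, a1, a2, rfl⟩ := H.exists_rep 0 k
  rw [← H.w_add_mul k m]
  exact ht _ (Finset.mem_Ico.2 ⟨a1, by omega⟩)

/-- The normals of an optimal lune cannot be turned about the common perpendicular. -/
lemma no_perturb (H : AltitudePolygon c n w q) {x y v : E3} (hx : ∀ k, 0 ≤ ⟪x, w k⟫)
    (hy : ∀ k, 0 ≤ ⟪y, w k⟫) (hxx : ⟪x, x⟫ = 1 - c ^ 2) (hyy : ⟪y, y⟫ = 1 - c ^ 2)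
    (hxy : ⟪x, y⟫ = -(c * (1 - c ^ 2))) (hv : v ≠ 0) (hvx : ⟪x, v⟫ = 0) (hvy : ⟪y, v⟫ = 0)
    (h1 : ∀ k, ⟪x, w k⟫ = 0 → 0 ≤ ⟪v, w k⟫) (h2 : ∀ k, ⟪y, w k⟫ = 0 → ⟪v, w k⟫ ≤ 0) : False := by
  have e1 := H.eventually_perturb hx h1
  have e2 := H.eventually_perturb (v := -v) hy (fun k hk => by
    rw [inner_neg_left]; linarith [h2 k hk])
  obtain ⟨t, ⟨ht1, ht2⟩, ht⟩ := ((e1.and e2).and self_mem_nhdsWithin).exists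
  have ht0 : (0 : ℝ) < t := ht
  have h3 := H.optimal _ _ ht1 ht2
  have hvv : 0 < ⟪v, v⟫ := real_inner_self_pos.2 hv
  have n1 : ‖x + t • v‖ ^ 2 = 1 - c ^ 2 + t ^ 2 * ⟪v, v⟫ := by
    rw [← real_inner_self_eq_norm_sq]
    simp only [inner_add_left, inner_add_right, real_inner_smul_left, real_inner_smul_right,
      real_inner_comm x v, hvx, hxx]
    ring
  have n2 : ‖y + t • -v‖ ^ 2 = 1 - c ^ 2 + t ^ 2 * ⟪v, v⟫ := by
    rw [← real_inner_self_eq_norm_sq]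
    simp only [inner_add_left, inner_add_right, real_inner_smul_left, real_inner_smul_right,
      inner_neg_left, inner_neg_right, real_inner_comm y v, hvy, hyy]
    ring
  have n3 : ‖y + t • -v‖ = ‖x + t • v‖ :=
    (sq_eq_sq₀ (norm_nonneg _) (norm_nonneg _)).1 (n2.trans n1.symm)
  rw [n3, ← sq, n1] at h3
  simp only [inner_add_left, inner_add_right, real_inner_smul_left, real_inner_smul_right,
      inner_neg_right, real_inner_comm y v, hvy, hxy, hvx] at h3
  have : 0 < t ^ 2 * ⟪v, v⟫ * (1 - c) :=
    mul_pos (mul_pos (pow_pos ht0 2) hvv) (by linarith [H.c_lt_one])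
  nlinarith

lemma inner_cross_normals {e p : E3} : ⟪farNormal c e p, cross3 e p⟫ = 0 ∧
    ⟪farNormal c p e, cross3 e p⟫ = 0 := by
  rw [real_inner_comm, inner_cross3, real_inner_comm, inner_cross3]
  simp only [farNormal, sub_eq_add_neg, ← neg_smul, det3_add_right, det3_smul_right,
    det3_self_outer, det3_self_right]
  simp

/-- If the foot of an altitude is a vertex, then the near normal vanishes at another vertex on the
same side of the altitude as another zero of the far normal. -/
lemma exists_near_zero (H : AltitudePolygon c n w q) {i a : ℤ} (hqa : q i = w a) (ε : ℝ)
    (hε : ε ≠ 0) (hne : cross3 (w i) (w a) ≠ 0)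
    (h : ∀ k, ⟪farNormal c (w i) (q i), w k⟫ = 0 → 0 ≤ ε * det3 (w i) (w a) (w k)) :
    ∃ k, ⟪farNormal c (q i) (w i), w k⟫ = 0 ∧ 0 < ε * det3 (w i) (w a) (w k) := by
  by_contra hcon
  push Not at hcon
  have hort := inner_cross_normals (c := c) (e := w i) (p := w a)
  rw [← hqa] at hort hne h hcon
  refine H.no_perturb (x := farNormal c (q i) (w i)) (y := farNormal c (w i) (q i))
    (v := (-ε) • cross3 (w i) (q i)) (H.near_nonneg i) (H.far_nonneg i) (H.near_inner_self i)
    (H.far_inner_self i) (farNormal_inner_swap (H.norm_w i) (H.norm_q i) (H.inner_w_q i))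
    (smul_ne_zero (neg_ne_zero.2 hε) hne) (by rw [real_inner_smul_right, hort.2, mul_zero])
    (by rw [real_inner_smul_right, hort.1, mul_zero]) ?_ ?_
  · intro k hk
    rw [real_inner_smul_left, inner_cross3]
    linarith [hcon k hk]
  · intro k hk
    rw [real_inner_smul_left, inner_cross3]
    linarith [h k hk]

end AltitudePolygon

namespace AltitudePolygon

variable {c : ℝ} {n : ℤ} {w q : ℤ → E3}

lemma det_ne_zero (H : AltitudePolygon c n w q) {i a b : ℤ} (hia : i < a) (ha : a < i + n)
    (hib : i < b) (hb : b < i + n) (hab : a ≠ b) : det3 (w i) (w a) (w b) ≠ 0 := by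
  rcases lt_or_gt_of_ne hab with h | h
  · exact (H.det_pos i a b hia h hb).ne'
  · rw [det3_swap_right]; exact (neg_neg_of_pos (H.det_pos i b a hib h ha)).ne

lemma cross_ne_zero (H : AltitudePolygon c n w q) {i a : ℤ} (hia : i < a) (ha : a < i + n) :
    cross3 (w i) (w a) ≠ 0 := by
  have hn := H.three_le
  intro h
  obtain ⟨b, hb, hb', hab⟩ : ∃ b, i < b ∧ b < i + n ∧ a ≠ b := by
    rcases eq_or_ne a (i + 1) with h | h
    · exact ⟨i + 2, by omega, by omega, by omega⟩
    · exact ⟨i + 1, by omega, by omega, by omega⟩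
  apply H.det_ne_zero hia ha hb hb' hab
  rw [← inner_cross3, h, inner_zero_left]

/-- Every vertex has an opposite side. -/
lemma exists_opposite (H : AltitudePolygon c n w q) (i : ℤ) : ∃ m, IsOpposite c n w q i m := by
  have hn := H.three_le
  set y := farNormal c (w i) (q i) with hy
  -- The far normal vanishes at the foot, so the foot lies in the face generated by the vertices at
  -- which this normal vanishes.
  have hmem : q i ∈ Submodule.span ℝ≥0 {v ∈ Set.range w | ⟪y, v⟫ = 0} :=
    (span_face (by rintro v ⟨k, rfl⟩; exact H.far_nonneg i k) (H.cone i)).2 (H.far_inner_foot i)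
  have hq0 : q i ≠ 0 := by
    intro h; have := H.norm_q i; rw [h, norm_zero] at this; norm_num at this
  -- representatives of the zeros
  have hrep : ∀ k, ⟪y, w k⟫ = 0 → ∃ k', i < k' ∧ k' < i + n ∧ w k' = w k := by
    intro k hk
    obtain ⟨k', m, h1, h2, rfl⟩ := H.exists_rep i k
    refine ⟨_, lt_of_le_of_ne h1 ?_, h2, H.w_add_mul k m⟩
    intro h
    have hpos : 0 < ⟪y, w i⟫ := H.far_inner_vertex i
    have e : ⟪y, w i⟫ = ⟪y, w k⟫ :=
      congrArg (fun v => ⟪y, v⟫) ((congrArg w h).trans (H.w_add_mul k m))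
    linarith
  obtain ⟨a, ha1, ha2, ha0⟩ : ∃ a, i < a ∧ a < i + n ∧ ⟪y, w a⟫ = 0 := by
    by_contra hcon
    push Not at hcon
    have : {v ∈ Set.range w | ⟪y, v⟫ = 0} = ∅ := by
      rw [Set.eq_empty_iff_forall_notMem]
      rintro v ⟨⟨k, rfl⟩, hk⟩
      obtain ⟨k', h1, h2, h3⟩ := hrep k hk
      exact hcon k' h1 h2 (h3 ▸ hk)
    rw [this, Submodule.span_empty] at hmem
    exact hq0 hmem
  by_cases hb : ∃ b, i < b ∧ b < i + n ∧ ⟪y, w b⟫ = 0 ∧ b ≠ a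
  · obtain ⟨m, hm1, hm2, hm3, hm4⟩ :
        ∃ m, i < m ∧ m + 1 < i + n ∧ ⟪y, w m⟫ = 0 ∧ ⟪y, w (m + 1)⟫ = 0 := by
      obtain ⟨b, hb1, hb2, hb0, hba⟩ := hb
      rcases lt_or_gt_of_ne hba with h | h
      · rcases H.zeros_adjacent (H.far_ne_zero i) (H.far_nonneg i) h (by omega) hb0 ha0 with h' | h'
        · exact ⟨b, hb1, by omega, hb0, h' ▸ ha0⟩
        · omega
      · rcases H.zeros_adjacent (H.far_ne_zero i) (H.far_nonneg i) h (by omega) ha0 hb0 with h' | h'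
        · exact ⟨a, ha1, by omega, ha0, h' ▸ hb0⟩
        · omega
    refine ⟨m, hm1, hm2, hm3, hm4, ?_⟩
    have hsub : {v ∈ Set.range w | ⟪y, v⟫ = 0} ⊆ {w m, w (m + 1)} := by
      rintro v ⟨⟨k, rfl⟩, hk⟩
      obtain ⟨k', h1, h2, h3⟩ := hrep k hk
      rw [← h3] at hk ⊢
      by_contra hne
      simp only [Set.mem_insert_iff, Set.mem_singleton_iff, not_or] at hne
      have n1 : k' ≠ m := fun h => hne.1 (by rw [h])
      have n2 : k' ≠ m + 1 := fun h => hne.2 (by rw [h])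
      rcases lt_or_ge k' m with h | h
      · exact H.three_zeros (H.far_ne_zero i) h (by omega) (by omega) hk hm3 hm4
      · exact H.three_zeros (H.far_ne_zero i) (by omega) (show m + 1 < k' by omega) (by omega)
          hm3 hm4 hk
    obtain ⟨α, β, h⟩ := Submodule.mem_span_pair.1 (Submodule.span_mono hsub hmem)
    exact ⟨α, β, α.2, β.2, by rw [← h, NNReal.smul_def, NNReal.smul_def]⟩
  -- With a single zero the foot is the vertex w a, and the far normal can be turned either way. By
  -- optimality the near normal is then blocked on both sides of the altitude, which together with w
  -- i gives it three zeros.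
  · exfalso
    push Not at hb
    have hsub : {v ∈ Set.range w | ⟪y, v⟫ = 0} ⊆ {w a} := by
      rintro v ⟨⟨k, rfl⟩, hk⟩
      obtain ⟨k', h1, h2, h3⟩ := hrep k hk
      rw [← h3] at hk ⊢
      rw [hb k' h1 h2 hk]
      rfl
    obtain ⟨α, h⟩ := Submodule.mem_span_singleton.1 (Submodule.span_mono hsub hmem)
    have hqa : q i = w a := by
      have h1 := congrArg norm h
      rw [NNReal.smul_def, norm_smul, H.norm_w, H.norm_q, mul_one, Real.norm_eq_abs,
        abs_of_nonneg α.coe_nonneg] at h1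
      rw [← h, NNReal.smul_def, h1, one_smul]
    have hz : ∀ k, ⟪y, w k⟫ = 0 → w k = w a := by
      intro k hk
      obtain ⟨k', h1, h2, h3⟩ := hrep k hk
      rw [← h3] at hk ⊢
      rw [hb k' h1 h2 hk]
    have key : ∀ ε : ℝ, ε ≠ 0 → ∃ k, ⟪farNormal c (q i) (w i), w k⟫ = 0 ∧
        0 < ε * det3 (w i) (w a) (w k) := fun ε hε =>
      H.exists_near_zero hqa ε hε (H.cross_ne_zero ha1 ha2) (fun k hk => by
        rw [hz k hk, det3_self_right, mul_zero])
    obtain ⟨k₁, z₁, p₁⟩ := key 1 one_ne_zero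
    obtain ⟨k₂, z₂, p₂⟩ := key (-1) (by norm_num)
    obtain ⟨a₁, m₁, b₁, d₁, f₁⟩ := H.exists_rep i k₁
    obtain ⟨a₂, m₂, b₂, d₂, f₂⟩ := H.exists_rep i k₂
    rw [← H.w_add_mul k₁ m₁, ← f₁] at z₁ p₁
    rw [← H.w_add_mul k₂ m₂, ← f₂] at z₂ p₂
    have g₁ : i ≠ a₁ := by rintro rfl; rw [det3_self_outer] at p₁; linarith
    have g₂ : i ≠ a₂ := by rintro rfl; rw [det3_self_outer] at p₂; linarith
    have g₃ : a₁ ≠ a₂ := by rintro rfl; linarith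
    have hz0 := H.near_inner_vertex i
    rcases lt_or_gt_of_ne g₃ with h | h
    · exact H.three_zeros (H.near_ne_zero i) (by omega) h d₂ hz0 z₁ z₂
    · exact H.three_zeros (H.near_ne_zero i) (by omega) h d₁ hz0 z₂ z₁

/-- A supporting vector of given length is determined by a side it vanishes on. -/
lemma normal_unique (H : AltitudePolygon c n w q) {x y : E3} (hx0 : x ≠ 0)
    (hx : ∀ k, 0 ≤ ⟪x, w k⟫) (hy : ∀ k, 0 ≤ ⟪y, w k⟫) (hxy : ⟪x, x⟫ = ⟪y, y⟫) {m : ℤ}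
    (h1 : ⟪x, w m⟫ = 0) (h2 : ⟪x, w (m + 1)⟫ = 0) (h3 : ⟪y, w m⟫ = 0)
    (h4 : ⟪y, w (m + 1)⟫ = 0) : x = y := by
  have hn := H.three_le
  have hd := H.det_pos m (m + 1) (m + 1 + 1) (by omega) (by omega) (by omega)
  set u := ⟪x, w (m + 1 + 1)⟫ with hu
  set v := ⟪y, w (m + 1 + 1)⟫ with hv
  have hv0 : v • x - u • y = 0 := by
    apply eq_zero_of_inner_eq_zero hd.ne' <;>
      simp only [inner_sub_left, real_inner_smul_left, h1, h2, h3, h4, ← hu, ← hv] <;> ring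
  have hupos : 0 < u := by
    rcases (hx (m + 1 + 1)).eq_or_lt with h | h
    · exact (H.three_zeros hx0 (by omega) (by omega) (by omega) h1 h2 h.symm).elim
    · exact h
  have h5 : v • x = u • y := sub_eq_zero.1 hv0
  have h6 : v ^ 2 * ⟪x, x⟫ = u ^ 2 * ⟪x, x⟫ := by
    have := congrArg (fun z => ⟪z, z⟫) h5
    simp only [real_inner_smul_left, real_inner_smul_right, ← hxy] at this
    linarith
  have h7 : v ^ 2 = u ^ 2 := mul_right_cancel₀ (real_inner_self_pos.2 hx0).ne' h6
  have h8 : v = u := (sq_eq_sq₀ (hy _) hupos.le).1 h7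
  rw [h8] at h5
  exact smul_right_injective _ hupos.ne' h5

/-- Opposite sides of different vertices are different. -/
lemma IsOpposite.inj (H : AltitudePolygon c n w q) {i j m m' r : ℤ} (h : IsOpposite c n w q i m)
    (h' : IsOpposite c n w q j m') (hr : m' = m + r * n) : w i = w j ∧ q i = q j := by
  have h1 := h'.left
  have h2 := h'.right
  rw [hr, H.w_add_mul] at h1
  rw [hr, add_right_comm, H.w_add_mul] at h2
  have heq := H.normal_unique (H.far_ne_zero i) (H.far_nonneg i) (H.far_nonneg j)
    ((H.far_inner_self i).trans (H.far_inner_self j).symm) h.left h.right h1 h2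
  exact altitude_unique H.c_pos H.c_lt_one (H.norm_q i) (H.norm_w j)
    (H.norm_q j) (H.inner_w_q i) (H.inner_w_q j) heq (H.strip j i).1

/-- Every side is opposite to a vertex. -/
lemma exists_vertex_opposite (H : AltitudePolygon c n w q) (b : ℤ) :
    ∃ z m r, IsOpposite c n w q z m ∧ m = b + r * n := by
  have hn := H.three_le
  choose F hF using H.exists_opposite
  choose σ r h1 h2 h3 using fun k => H.exists_rep 0 (F k)
  have hmaps : ∀ k ∈ Finset.Ico 0 n, σ k ∈ Finset.Ico 0 n := fun k _ =>
    Finset.mem_Ico.2 ⟨h1 k, by have := h2 k; omega⟩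
  have hinj : Set.InjOn σ (Finset.Ico 0 n) := by
    intro k hk k' hk' hkk
    simp only [Finset.coe_Ico, Set.mem_Ico] at hk hk'
    rw [h3, h3] at hkk
    have := (IsOpposite.inj H (r := r k - r k') (hF k) (hF k') (by linarith)).1
    exact H.eq_of_w_eq hk.1 (by omega) hk'.1 (by omega) this
  -- There are as many sides as vertices, so an injective assignment of opposite sides is
  -- surjective.
  have hsurj := Finset.surjOn_of_injOn_of_card_le σ hmaps hinj le_rfl
  obtain ⟨b', m, hb1, hb2, hb3⟩ := H.exists_rep 0 b
  obtain ⟨z, -, hz⟩ := hsurj (Finset.mem_coe.2 (Finset.mem_Ico.2 ⟨hb1, by omega⟩))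
  refine ⟨z, F z, m - r z, hF z, ?_⟩
  rw [h3] at hz
  linarith

/-- If the foot of the altitude from `w i` is a vertex `w a`, then `w i` is the foot of the altitude
from `w a`. -/
lemma foot_symm (H : AltitudePolygon c n w q) {i a : ℤ} (hqa : q i = w a) : q a = w i := by
  have hn := H.three_le
  obtain ⟨a', r, ha1, ha2, har⟩ := H.exists_rep i a
  have hwa : w a' = w a := by rw [har, H.w_add_mul]
  rw [← H.q_eq_of_w_eq hwa]
  rw [← hwa] at hqa
  clear hwa har
  have hia : i < a' := by
    refine lt_of_le_of_ne ha1 ?_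
    rintro rfl
    have := H.inner_w_q i
    rw [hqa, inner_self_eq_one (H.norm_w _)] at this
    linarith [H.c_lt_one]
  obtain ⟨m, hm⟩ := H.exists_opposite i
  have hmi := hm.lt
  have hmi' := hm.lt'
  have hz0 := H.near_inner_vertex i
  -- a second zero of the near normal
  obtain ⟨k, hk0, hkdet⟩ : ∃ k, ⟪farNormal c (q i) (w i), w k⟫ = 0 ∧
      det3 (w i) (w a') (w k) ≠ 0 := by
    have hz : ∀ k, ⟪farNormal c (w i) (q i), w k⟫ = 0 → w k = w m ∨ w k = w (m + 1) := by
      intro k hk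
      obtain ⟨k', r, h1, h2, rfl⟩ := H.exists_rep i k
      rw [← H.w_add_mul k r] at hk ⊢
      by_contra hne
      rw [not_or] at hne
      have n0 : k + r * n ≠ i := fun h => (H.far_inner_vertex i).ne' (by rwa [h] at hk)
      have n1 : k + r * n ≠ m := fun h => hne.1 (by rw [h])
      have n2 : k + r * n ≠ m + 1 := fun h => hne.2 (by rw [h])
      rcases lt_or_ge (k + r * n) m with h | h
      · exact H.three_zeros (H.far_ne_zero i) h (by omega) (by omega) hk hm.left hm.right
      · exact H.three_zeros (H.far_ne_zero i) (by omega) (show m + 1 < k + r * n by omega) (by omega)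
          hm.left hm.right hk
    have ham : a' = m ∨ a' = m + 1 := by
      have : ⟪farNormal c (w i) (q i), w a'⟫ = 0 := by rw [← hqa]; exact H.far_inner_foot i
      rcases hz a' this with h | h
      · left; exact H.eq_of_w_eq ha1 ha2 (by omega) (by omega) h
      · right; exact H.eq_of_w_eq ha1 ha2 (by omega) (by omega) h
    have hd := H.det_pos i m (m + 1) hmi (by omega) hmi'
    rcases ham with rfl | rfl
    · obtain ⟨k, h1, h2⟩ := H.exists_near_zero hqa 1 one_ne_zero (H.cross_ne_zero hia ha2)
        (fun k hk => by
          rcases hz k hk with h | h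
          · rw [h, det3_self_right, mul_zero]
          · rw [h, one_mul]; exact hd.le)
      exact ⟨k, h1, by linarith⟩
    · obtain ⟨k, h1, h2⟩ := H.exists_near_zero hqa (-1) (by norm_num) (H.cross_ne_zero hia ha2)
        (fun k hk => by
          rcases hz k hk with h | h
          · rw [h, det3_swap_right]; linarith
          · rw [h, det3_self_right, mul_zero])
      exact ⟨k, h1, by linarith⟩
  -- The second zero must be adjacent to w i, so the near normal vanishes along a whole side ending
  -- at w i.
  obtain ⟨b, hb1, hb2⟩ : ∃ b, ⟪farNormal c (q i) (w i), w b⟫ = 0 ∧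
      ⟪farNormal c (q i) (w i), w (b + 1)⟫ = 0 := by
    obtain ⟨k', r, h1, h2, rfl⟩ := H.exists_rep i k
    rw [← H.w_add_mul k r] at hk0 hkdet
    have n0 : k + r * n ≠ i := fun h => hkdet (by rw [h, det3_self_outer])
    rcases H.zeros_adjacent (H.near_ne_zero i) (H.near_nonneg i) (by omega) h2 hz0 hk0 with h | h
    · exact ⟨i, hz0, h ▸ hk0⟩
    · exact ⟨k + r * n, hk0, by rw [h, H.w_add]; exact hz0⟩
  -- That side is opposite to some w z. The far normal of w z and the near normal of w i have equal
  -- length and the same zero side, hence agree, and `altitude_unique` identifies the altitude from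
  -- w z with the reversed altitude from w i.
  obtain ⟨z, m', r, hz, hr⟩ := H.exists_vertex_opposite b
  have h1 := hz.left
  have h2 := hz.right
  rw [hr, H.w_add_mul] at h1
  rw [hr, add_right_comm, H.w_add_mul] at h2
  have heq := H.normal_unique (H.far_ne_zero z) (H.far_nonneg z) (H.near_nonneg i)
    ((H.far_inner_self z).trans (H.near_inner_self i).symm) h1 h2 hb1 hb2
  have hcomm : ⟪q i, w i⟫ = c := by rw [real_inner_comm]; exact H.inner_w_q i
  have := altitude_unique H.c_pos H.c_lt_one (H.norm_q z) (H.norm_q i)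
    (H.norm_w i) (H.inner_w_q z) hcomm heq (H.strip i z).2
  rw [hqa] at this
  rw [← H.q_eq_of_w_eq this.1, this.2]

end AltitudePolygon

/-! ### Crossing altitudes and the parity of the number of vertices -/

namespace AltitudePolygon

variable {c : ℝ} {n : ℤ} {w q : ℤ → E3}

/-- The point reflection of the polygon, with reversed labelling. -/
lemma mirror (H : AltitudePolygon c n w q) :
    AltitudePolygon c n (fun i => -w (-i)) (fun i => -q (-i)) where
  three_le := H.three_le
  c_pos := H.c_pos
  c_lt_one := H.c_lt_one
  periodic_w i := by
    have := H.w_add_mul (-i) (-1)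
    rw [neg_one_mul, ← sub_eq_add_neg] at this
    simp only [neg_add', this]
  periodic_q i := by
    have := H.q_add_mul (-i) (-1)
    rw [neg_one_mul, ← sub_eq_add_neg] at this
    simp only [neg_add', this]
  norm_w i := by rw [norm_neg, H.norm_w]
  norm_q i := by rw [norm_neg, H.norm_q]
  -- Negating three vectors and reversing their order each change the sign of the determinant.
  det_pos i j k hij hjk hk := by
    have h1 := H.det_pos (-k) (-j) (-i) (by omega) (by omega) (by omega)
    rw [det3_neg, det3_swap_left, neg_neg, ← det3_rotate, ← det3_rotate]
    exact h1
  inner_w_q i := by rw [inner_neg_neg]; exact H.inner_w_q _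
  strip i k := by
    have := H.strip (-i) (-k)
    unfold InStrip at *
    simpa only [inner_neg_neg] using this
  cone i := by
    have := Submodule.mem_map_of_mem (f := (-LinearMap.id : E3 →ₗ[ℝ≥0] E3)) (H.cone (-i))
    rw [Submodule.map_span] at this
    refine Submodule.span_mono ?_ this
    rintro v ⟨x, ⟨k, rfl⟩, rfl⟩
    exact ⟨-k, by simp⟩
  optimal x y hx hy := by
    have := H.optimal (-x) (-y) (fun k => by simpa using hx (-k)) (fun k => by simpa using hy (-k))
    simpa using this

lemma IsOpposite.mirror (H : AltitudePolygon c n w q) {i m : ℤ} (h : IsOpposite c n w q i m) :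
    IsOpposite c n (fun i => -w (-i)) (fun i => -q (-i)) (-i - n) (-m - 1) := by
  have e1 : -(-i - n) = i + n := by ring
  have e2 : -(-m - 1) = m + 1 := by ring
  have e3 : -(-m - 1 + 1) = m := by ring
  have e4 : ∀ x y z : E3, ⟪farNormal c (-x) (-y), -z⟫ = ⟪farNormal c x y, z⟫ := by
    intro x y z
    rw [farNormal_inner, farNormal_inner, inner_neg_neg, inner_neg_neg]
  refine ⟨by have := h.lt'; omega, by have := h.lt; omega, ?_, ?_, ?_⟩
  · simp only [e1, e2, e4, H.periodic_w i, H.periodic_q i]; exact h.right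
  · simp only [e1, e3, e4, H.periodic_w i, H.periodic_q i]; exact h.left
  · obtain ⟨α, β, hα, hβ, e⟩ := h.combination
    refine ⟨β, α, hβ, hα, ?_⟩
    simp only [e1, e2, e3, H.periodic_q i, e]
    module

/-- The strip conditions are linear and the foot lies in the cone over the vertices. -/
lemma strip_foot (H : AltitudePolygon c n w q) (i k : ℤ) : InStrip c (w i) (q i) (q k) := by
  have h1 := (span_face (y := farNormal c (w i) (q i))
    (by rintro v ⟨k, rfl⟩; exact H.far_nonneg i k) (H.cone k)).1
  have h2 := (span_face (y := farNormal c (q i) (w i))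
    (by rintro v ⟨k, rfl⟩; exact H.near_nonneg i k) (H.cone k)).1
  rw [farNormal_inner] at h1 h2
  exact ⟨by linarith, by linarith⟩

lemma crossing (H : AltitudePolygon c n w q) (i k : ℤ) :
    det3 (w i) (q i) (w k) * det3 (w i) (q i) (q k) ≤ 0 := by
  by_contra h
  push Not at h
  exact altitude_crossing H.c_pos H.c_lt_one (H.norm_w i) (H.norm_q i) (H.norm_w k) (H.norm_q k)
    (H.inner_w_q i) (H.inner_w_q k) (H.strip i k) (H.strip_foot i k) (H.strip k i)
    (H.strip_foot k i) h

/-- If the foot of the altitude from `w i` is the first end point `w m` of the opposite side, then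
the side opposite to `w m` ends at `w i`. -/
lemma opposite_of_foot_eq (H : AltitudePolygon c n w q) {i m m' : ℤ}
    (h : IsOpposite c n w q i m) (hq : q i = w m) (h' : IsOpposite c n w q m m') :
    m' = i + n - 1 := by
  have hn := H.three_le
  have h1 := h.lt; have h2 := h.lt'; have h3 := h'.lt; have h4 := h'.lt'
  have hqm := H.foot_symm hq
  -- zeros of the far normal of `w m`
  have hfar : farNormal c (w m) (q m) = farNormal c (q i) (w i) := by rw [hq, hqm]
  -- All zeros of the far normal lie at or beyond w m, so the near normal must have a zero strictly
  -- beyond. Adjacency to w i leaves only the index i + n - 1.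
  obtain ⟨k, hk0, hk⟩ := H.exists_near_zero hq 1 one_ne_zero (H.cross_ne_zero h1 (by omega))
    (fun k hk => by
      obtain ⟨k', r, a1, a2, rfl⟩ := H.exists_rep i k
      rw [← H.w_add_mul k r] at hk ⊢
      rw [one_mul]
      rcases lt_trichotomy (k + r * n) m with h5 | h5 | h5
      · have : k + r * n ≠ i := fun h => (H.far_inner_vertex i).ne' (by rwa [h] at hk)
        exact (H.three_zeros (H.far_ne_zero i) h5 (by omega) (by omega) hk h.left h.right).elim
      · rw [h5, det3_self_right]
      · exact (H.det_pos i m _ h1 h5 a2).le)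
  obtain ⟨k', r, a1, a2, rfl⟩ := H.exists_rep i k
  rw [← H.w_add_mul k r] at hk hk0
  rw [one_mul] at hk
  set b := k + r * n with hb
  have n0 : b ≠ i := fun h => hk.ne' (by rw [h, det3_self_outer])
  have n1 : m < b := by
    rcases lt_trichotomy b m with h5 | h5 | h5
    · have := H.det_pos i b m (by omega) h5 (by omega)
      rw [det3_swap_right] at this
      linarith
    · rw [h5, det3_self_right] at hk; exact absurd hk (lt_irrefl _)
    · exact h5
  have hb' : b = i + n - 1 := by
    rcases H.zeros_adjacent (H.near_ne_zero i) (H.near_nonneg i) (by omega) a2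
      (H.near_inner_vertex i) hk0 with h5 | h5 <;> omega
  rw [← hfar] at hk0
  have hend : ⟪farNormal c (w m) (q m), w (b + 1)⟫ = 0 := by
    rw [hfar, show b + 1 = i + n by omega, H.w_add]; exact H.near_inner_vertex i
  rw [← hb']
  rcases lt_trichotomy m' b with h5 | h5 | h5
  · exact (H.three_zeros (H.far_ne_zero m) h5 (show b < b + 1 by omega) (by omega) h'.left
      hk0 hend).elim
  · exact h5
  · exact (H.three_zeros (H.far_ne_zero m) h5 (show m' < m' + 1 by omega) (by omega) hk0
      h'.left h'.right).elim

/-- The opposite sides of the vertices on one side of an altitude lie on the other side. -/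
lemma opposite_separated (H : AltitudePolygon c n w q) {i m k j r : ℤ}
    (h : IsOpposite c n w q i m) (hk : i < k) (hkm : k ≤ m)
    (h' : IsOpposite c n w q k (j + r * n)) (hj : i ≤ j) (hj' : j < i + n) : m < j := by
  by_contra hcon
  push Not at hcon
  have h1 := h.lt; have h2 := h.lt'
  have hwk : w k ≠ w i := fun e => H.ne_of_lt hk (by omega) e.symm
  have hjm : j ≠ m := by
    rintro rfl
    exact hwk (IsOpposite.inj H h h' rfl).1.symm
  obtain ⟨α, β, hα, hβ, hq⟩ := h.combination
  obtain ⟨α', β', hα', hβ', hq'⟩ := h'.combination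
  rw [add_right_comm, H.w_add_mul, H.w_add_mul] at hq'
  have hdet : ∀ x, det3 (w i) (q i) x =
      α * det3 (w i) (w m) x + β * det3 (w i) (w (m + 1)) x := by
    intro x
    rw [hq, det3_add_mid, det3_smul_mid, det3_smul_mid]
  -- the case in which the foot of the altitude is the vertex `w m`
  have hspecial : q i = w m → k ≠ m := by
    rintro e rfl
    have := H.opposite_of_foot_eq h e h'
    obtain rfl | hr := eq_or_ne r 0
    · omega
    · rcases lt_or_gt_of_ne hr with hr | hr
      · have := h'.lt; nlinarith [H.three_le]
      · have := h'.lt'; nlinarith [H.three_le]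
  have hαβ : α ≠ 0 ∨ β ≠ 0 := by
    by_contra h0
    push Not at h0
    have := H.norm_q i
    rw [hq, h0.1, h0.2, zero_smul, zero_smul, add_zero, norm_zero] at this
    norm_num at this
  have hβ0 : β = 0 → q i = w m := by
    intro h0
    have e := hq
    rw [h0, zero_smul, add_zero] at e
    have := congrArg norm e
    rw [norm_smul, H.norm_w, H.norm_q, mul_one, Real.norm_eq_abs, abs_of_nonneg hα] at this
    rw [e, ← this, one_smul]
  -- The vertices after w i up to w m lie strictly on the negative side of the altitude, except for
  -- w m when it is itself the foot.
  have hneg : ∀ l, i < l → l ≤ m → ¬ (l = m ∧ β = 0) → det3 (w i) (q i) (w l) < 0 := by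
    intro l hl hlm hne
    rw [hdet]
    have d2 : det3 (w i) (w (m + 1)) (w l) < 0 := by
      rw [det3_swap_right]; linarith [H.det_pos i l (m + 1) hl (by omega) h2]
    rcases hlm.eq_or_lt with rfl | hlm
    · rw [det3_self_right, mul_zero, zero_add]
      exact mul_neg_of_pos_of_neg (lt_of_le_of_ne hβ fun e => hne ⟨rfl, e.symm⟩) d2
    · have d1 : det3 (w i) (w m) (w l) < 0 := by
        rw [det3_swap_right]; linarith [H.det_pos i l m hl hlm (by omega)]
      rcases hαβ with h0 | h0
      · have := mul_neg_of_pos_of_neg (lt_of_le_of_ne hα h0.symm) d1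
        have := mul_nonpos_of_nonneg_of_nonpos hβ d2.le
        linarith
      · have := mul_neg_of_pos_of_neg (lt_of_le_of_ne hβ h0.symm) d2
        have := mul_nonpos_of_nonneg_of_nonpos hα d1.le
        linarith
  have hkneg : det3 (w i) (q i) (w k) < 0 :=
    hneg k hk hkm fun ⟨e1, e2⟩ => hspecial (hβ0 e2) e1
  have hnonpos : ∀ l, i ≤ l → l ≤ m → det3 (w i) (q i) (w l) ≤ 0 := by
    intro l hl hlm
    rcases hl.eq_or_lt with rfl | hl
    · rw [det3_self_outer]
    · by_cases e : l = m ∧ β = 0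
      · rw [e.1, ← hβ0 e.2, det3_self_right]
      · exact (hneg l hl hlm e).le
  have hcr := H.crossing i k
  -- Since altitudes cross, the foot of w k is on the nonnegative side. If its side were among the
  -- vertices i, …, m, the foot would lie on the altitude line; what remains are coincidences with
  -- an end of the altitude, excluded by `foot_symm`.
  have hqk : 0 ≤ det3 (w i) (q i) (q k) := by
    by_contra hlt
    push Not at hlt
    nlinarith [mul_pos_of_neg_of_neg hkneg hlt]
  rw [hq', det3_add_right, det3_smul_right, det3_smul_right] at hqk
  have t1 := mul_nonpos_of_nonneg_of_nonpos hα' (hnonpos j hj (by omega))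
  have t2 := mul_nonpos_of_nonneg_of_nonpos hβ' (hnonpos (j + 1) (by omega) (by omega))
  have t1' : α' = 0 ∨ det3 (w i) (q i) (w j) = 0 := mul_eq_zero.1 (by linarith)
  have t2' : β' = 0 ∨ det3 (w i) (q i) (w (j + 1)) = 0 := mul_eq_zero.1 (by linarith)
  have unit_smul : ∀ (t : ℝ) (l : ℤ), 0 ≤ t → q k = t • w l → q k = w l := by
    intro t l ht e
    have := congrArg norm e
    rw [norm_smul, H.norm_w, H.norm_q, mul_one, Real.norm_eq_abs, abs_of_nonneg ht] at this
    rw [e, ← this, one_smul]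
  -- the foot of the altitude from `w k` is not an end of the altitude from `w i`
  have hqki : q k ≠ w i := by
    intro e
    have e2 := H.foot_symm e
    by_cases e3 : k = m
    · subst e3
      exact hspecial e2 rfl
    · rw [e2] at hkneg
      rw [det3_self_right] at hkneg
      exact lt_irrefl _ hkneg
  have hqkm : β = 0 → q k ≠ w m := by
    intro e0 e
    have e1 := H.foot_symm (hβ0 e0)
    have e2 := H.foot_symm e
    exact hwk (e2.symm.trans e1)
  rcases t1' with e1 | e1
  · rw [e1, zero_smul, zero_add] at hq'
    have hqk' := unit_smul _ _ hβ' hq'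
    rcases t2' with e2 | e2
    · have := H.norm_q k
      rw [hq', e2, zero_smul, norm_zero] at this
      norm_num at this
    · by_cases e : j + 1 = m ∧ β = 0
      · exact hqkm e.2 (e.1 ▸ hqk')
      · exact (hneg (j + 1) (by omega) (by omega) e).ne e2
  · have hji : j = i := by
      by_contra hne
      exact (hneg j (by omega) (by omega) (by omega)).ne e1
    rcases t2' with e2 | e2
    · rw [e2, zero_smul, add_zero] at hq'
      exact hqki (hji ▸ unit_smul _ _ hα' hq')
    · by_cases e : j + 1 = m ∧ β = 0
      · exact hspecial (hβ0 e.2) (by omega)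
      · exact (hneg (j + 1) (by omega) (by omega) e).ne e2

/-- The m - i vertices w (i + 1), …, w m have distinct opposite sides, whose first indices lie
strictly between m and i + n. There are i + n - m - 1 such indices. -/
lemma two_mul_le (H : AltitudePolygon c n w q) {i m : ℤ} (h : IsOpposite c n w q i m) :
    2 * (m - i) + 1 ≤ n := by
  have hn := H.three_le
  choose F hF using H.exists_opposite
  choose σ r h1 h2 h3 using fun k => H.exists_rep i (F k)
  have hF' : ∀ k, F k = σ k + (-r k) * n := fun k => by rw [h3]; ring
  have hmaps : ∀ k ∈ Finset.Ioc i m, σ k ∈ Finset.Ioo m (i + n) := by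
    intro k hk
    rw [Finset.mem_Ioc] at hk
    exact Finset.mem_Ioo.2
      ⟨H.opposite_separated h hk.1 hk.2 (hF' k ▸ hF k) (h1 k) (h2 k), h2 k⟩
  have hinj : Set.InjOn σ (Finset.Ioc i m) := by
    intro k hk k' hk' hkk
    simp only [Finset.coe_Ioc, Set.mem_Ioc] at hk hk'
    rw [h3, h3] at hkk
    have := (IsOpposite.inj H (r := r k - r k') (hF k) (hF k') (by linarith)).1
    have := h.lt'
    exact H.eq_of_w_eq (a := i) (by omega) (by omega) (by omega) (by omega) ‹_›
  have := Finset.card_le_card_of_injOn σ hmaps hinj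
  rw [Int.card_Ioc, Int.card_Ioo] at this
  have := h.lt
  have := h.lt'
  omega

/-- The polygon has an odd number `2 * p + 1` of vertices and the side opposite to `w i` has the end
points `w (i + p)` and `w (i + p + 1)`. -/
lemma two_mul_eq (H : AltitudePolygon c n w q) {i m : ℤ} (h : IsOpposite c n w q i m) :
    2 * (m - i) + 1 = n := by
  have h1 := H.two_mul_le h
  -- Point reflection interchanges the two sides of the altitude and gives the reverse inequality.
  have h2 := H.mirror.two_mul_le (h.mirror H)
  omega

end AltitudePolygon

/-! ### The diameter of the vertex set -/

lemma cos_angle_of_norm {x y : E3} (hx : ‖x‖ = 1) (hy : ‖y‖ = 1) :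
    Real.cos (angle x y) = ⟪x, y⟫ := by
  rw [cos_angle, hx, hy]; simp

lemma angle_eq_arccos {x y : E3} (hx : ‖x‖ = 1) (hy : ‖y‖ = 1) :
    angle x y = Real.arccos ⟪x, y⟫ := by
  rw [angle, hx, hy]; simp

/-- A vertex `y` between the vertices `x` and `u` is not farther from `x` than `u`, if the distance
of `x` and `y` is maximal; here `q` is the foot of the altitude from `u`, and `z` lies beyond `q` on
the side opposite to `u` that ends in `x`. -/
lemma inner_le_of_between {c : ℝ} (hc0 : 0 < c) (hc1 : c < 1) {x y u q z : E3} (hx : ‖x‖ = 1)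
    (hy : ‖y‖ = 1) (hq : ‖q‖ = 1) (hu : ‖u‖ = 1) (huq : ⟪u, q⟫ = c)
    (hqx : 0 ≤ ⟪x, q⟫) (hxy : 0 ≤ ⟪x, y⟫) {α β : ℝ} (hα : 0 ≤ α)
    (hqz : q = α • z + β • x)
    (hhx : ⟪farNormal c u q, x⟫ = 0) (hhz : ⟪farNormal c u q, z⟫ = 0)
    (hhy : 0 ≤ ⟪farNormal c u q, y⟫) (hgy : c * ⟪u, y⟫ ≤ ⟪q, y⟫)
    (hz : det3 x z u < 0) (hyu : 0 ≤ det3 x y u) (hmax : ⟪x, z⟫ * ⟪x, y⟫ ≤ ⟪y, z⟫) :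
    ⟪x, u⟫ ≤ ⟪x, y⟫ := by
  have hxx := inner_self_eq_one hx
  have hyy := inner_self_eq_one hy
  have hqq := inner_self_eq_one hq
  have hh := farNormal_inner_self hu hq huq
  set h := farNormal c u q with hdef
  have hs : 0 < 1 - c ^ 2 := by nlinarith
  have hue : u = h + c • q := by rw [hdef, farNormal]; abel
  have hhq : ⟪h, q⟫ = 0 := by rw [hdef, farNormal_inner, hqq, huq]; ring
  have hxh : ⟪x, h⟫ = 0 := by rw [real_inner_comm, hhx]
  have hxu : ⟪x, u⟫ = c * ⟪x, q⟫ := by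
    rw [hue, inner_add_right, real_inner_smul_right, hxh, zero_add]
  set C := ⟪x, q⟫ with hC
  set X := ⟪x, y⟫ with hX
  set Y := ⟪h, y⟫ with hY
  set T := det3 x h y with hT
  set S := det3 x h q with hS
  have hxzq : det3 x z q = 0 := by
    rw [hqz, det3_add_right, det3_smul_right, det3_smul_right, det3_self_right, det3_self_outer]
    ring
  have hz' : 0 < det3 x h z := by
    rw [hue, det3_add_right, det3_smul_right, hxzq] at hz
    rw [det3_swap_right]; linarith
  -- In the orthogonal directions x, h, x × h, the vector y has the components X, Y, T and q has C,
  -- 0, S, up to normalization. The maximality hypothesis puts y on the same side as z with respect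
  -- to x and h.
  have hT0 : 0 ≤ T := by
    have := det3_mul_det3 x h y z
    rw [hxx, hxh, hhz, hh, ← hT, ← hX] at this
    have : 0 ≤ T * det3 x h z := by
      rw [this]; linarith [mul_nonneg hs.le (sub_nonneg.2 hmax)]
    exact nonneg_of_mul_nonneg_left this hz'
  have hTT : T ^ 2 = (1 - c ^ 2) - Y ^ 2 - (1 - c ^ 2) * X ^ 2 := by
    have := det3_mul_det3 x h y y
    rw [hxx, hxh, hh, hyy, ← hT, ← hX, ← hY] at this
    linarith
  have hTS : T * S = (1 - c ^ 2) * (⟪y, q⟫ - C * X) := by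
    have := det3_mul_det3 x h y q
    rw [hxx, hxh, hh, hhq, ← hT, ← hX, ← hY, ← hC, ← hS] at this
    linarith
  have hSS : S ^ 2 = (1 - c ^ 2) * (1 - C ^ 2) := by
    have := det3_mul_det3 x h q q
    rw [hxx, hxh, hh, hhq, hqq, ← hC, ← hS] at this
    linarith
  have hS0 : 0 ≤ S := by
    rw [hS, hqz, det3_add_right, det3_smul_right, det3_smul_right, det3_self_outer, mul_zero,
      add_zero]
    exact mul_nonneg hα hz'.le
  have hlune : c * Y ≤ (1 - c ^ 2) * ⟪y, q⟫ := by
    rw [hue, inner_add_left, real_inner_smul_left, ← hY, real_inner_comm y q] at hgy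
    linarith
  have hDT : T ≤ c * det3 x y q := by
    rw [hue, det3_add_right, det3_smul_right, det3_swap_right x h y] at hyu
    linarith
  have hDS : det3 x y q * S = (1 - C ^ 2) * Y := by
    have := det3_mul_det3 x q y h
    rw [hxx, hqq, real_inner_comm h q, hhq, hxh, real_inner_comm h y, ← hY, ← hC,
      det3_swap_right x y q, det3_swap_right x h q] at this
    linarith
  rw [hxu]
  -- If ⟪x, y⟫ < ⟪x, u⟫ = cC, the lune bounds Y by Y < 1 - c², while F1 bounds T by C T ≤ S X. Then
  -- y is too short to have norm one.
  by_contra hlt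
  push Not at hlt
  have hC0 : 0 < C := by
    rcases hqx.eq_or_lt with h0 | h0
    · rw [← h0, mul_zero] at hlt; linarith
    · exact h0
  have F1 : C * T ≤ S * X := by
    rcases hS0.eq_or_lt with h0 | h0
    · have hC1 : C = 1 := by
        rw [← h0] at hSS
        have : (1 - C) * (1 + C) = 0 := by
          have := mul_eq_zero.1 (show (1 - c ^ 2) * (1 - C ^ 2) = 0 by rw [← hSS]; ring)
          rcases this with h | h
          · exact absurd h hs.ne'
          · linarith
        rcases mul_eq_zero.1 this with h | h <;> linarith
      have hxq : x = q := (inner_eq_one_iff_of_norm_eq_one hx hq).1 (hC ▸ hC1)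
      rw [← hxq, det3_self_outer, mul_zero] at hDT
      rw [← h0, zero_mul]
      have := mul_nonneg hC0.le (sub_nonneg.2 hDT)
      linarith
    · have e1 : T * S ≤ c * ((1 - C ^ 2) * Y) := by
        rw [← hDS]; linarith [mul_le_mul_of_nonneg_right hDT hS0]
      have hS1 : 0 ≤ 1 - C ^ 2 := by
        have := sq_nonneg S
        rw [hSS] at this
        exact nonneg_of_mul_nonneg_right this hs
      have e2 : (1 - C ^ 2) * (c * Y) ≤ (1 - C ^ 2) * ((1 - c ^ 2) * ⟪y, q⟫) :=
        mul_le_mul_of_nonneg_left hlune hS1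
      have e3 : (1 - c ^ 2) * ⟪y, q⟫ = T * S + (1 - c ^ 2) * (C * X) := by linarith
      have e4 : T * S ≤ (1 - C ^ 2) * (T * S) + S ^ 2 * (C * X) := by
        rw [hSS]; rw [e3] at e2; linarith
      have e5 : (S * C) * (C * T) ≤ (S * C) * (S * X) := by linarith
      exact le_of_mul_le_mul_left e5 (mul_pos h0 hC0)
  have F2 : C * ((1 - c ^ 2) * ⟪y, q⟫) ≤ (1 - c ^ 2) * X := by
    have e3 : (1 - c ^ 2) * ⟪y, q⟫ = T * S + (1 - c ^ 2) * (C * X) := by linarith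
    have := mul_le_mul_of_nonneg_left F1 hS0
    rw [e3]
    have e6 : S * (S * X) = (1 - c ^ 2) * (1 - C ^ 2) * X := by rw [← hSS]; ring
    linarith
  have F3 : Y < 1 - c ^ 2 := by
    have e1 : (C * c) * Y < (C * c) * (1 - c ^ 2) := by
      have := mul_le_mul_of_nonneg_left hlune hC0.le
      have := mul_lt_mul_of_pos_left hlt hs
      linarith
    exact lt_of_mul_lt_mul_left e1 (mul_pos hC0 hc0).le
  have F4 : (C * T) ^ 2 ≤ (S * X) ^ 2 := pow_le_pow_left₀ (mul_nonneg hC0.le hT0) F1 2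
  have F5 : Y ^ 2 < (1 - c ^ 2) ^ 2 := pow_lt_pow_left₀ F3 hhy two_ne_zero
  have F6 : X ^ 2 < (c * C) ^ 2 := pow_lt_pow_left₀ hlt hxy two_ne_zero
  rw [mul_pow, hTT, mul_pow, hSS] at F4
  have F7 : C ^ 2 * Y ^ 2 < C ^ 2 * (1 - c ^ 2) ^ 2 := mul_lt_mul_of_pos_left F5 (pow_pos hC0 2)
  have F8 := mul_lt_mul_of_pos_left F6 hs
  linarith

namespace AltitudePolygon

variable {c : ℝ} {n : ℤ} {w q : ℤ → E3}

lemma exists_half (H : AltitudePolygon c n w q) :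
    ∃ p : ℕ, n = 2 * p + 1 ∧ 1 ≤ p ∧ ∀ i, IsOpposite c n w q i (i + p) := by
  obtain ⟨m, hm⟩ := H.exists_opposite 0
  have h1 := H.two_mul_eq hm
  have h2 := hm.lt
  refine ⟨m.toNat, by omega, by omega, fun i => ?_⟩
  obtain ⟨m', hm'⟩ := H.exists_opposite i
  have h3 := H.two_mul_eq hm'
  rwa [show i + (m.toNat : ℤ) = m' by omega]

/-- The two strip inequalities combine to (1 - c²)⟪w i, w k⟫ ≥ 0. -/
lemma inner_nonneg (H : AltitudePolygon c n w q) (i k : ℤ) : 0 ≤ ⟪w i, w k⟫ := by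
  obtain ⟨h1, h2⟩ := H.strip i k
  have := H.c_pos
  nlinarith [H.one_sub_sq_pos]

/-- The distance of the foot of the altitude from `w i` to the end points of the opposite side. -/
lemma inner_foot_left (H : AltitudePolygon c n w q) {i m : ℤ} (h : IsOpposite c n w q i m) :
    ⟪q i, w m⟫ = ⟪w i, w m⟫ / c := by
  have := h.left
  rw [farNormal_inner] at this
  rw [eq_div_iff H.c_pos.ne']; linarith

lemma inner_foot_right (H : AltitudePolygon c n w q) {i m : ℤ} (h : IsOpposite c n w q i m) :
    ⟪q i, w (m + 1)⟫ = ⟪w i, w (m + 1)⟫ / c := by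
  have := h.right
  rw [farNormal_inner] at this
  rw [eq_div_iff H.c_pos.ne']; linarith

lemma angle_path_le (y : ℕ → E3) (p : ℕ) :
    angle (y 0) (y p) ≤ ∑ j ∈ Finset.range p, angle (y j) (y (j + 1)) ∨ p = 0 := by
  induction p with
  | zero => right; rfl
  | succ p ih =>
    left
    rw [Finset.sum_range_succ]
    rcases ih with ih | rfl
    · linarith [angle_le_angle_add_angle (y 0) (y p) (y (p + 1))]
    · simp

lemma combination_apex {y0 y1 P q : E3} {a b α β : ℝ} (hq : q = α • y0 + β • y1)
    (hP : P = a • y1 - b • y0) : a • q = (a * α + b * β) • y0 + β • P := by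
  rw [hq, hP]; module

/-- The pair need not be at maximal distance. Comparing the two boundary chains between w a and w (a
+ p) bounds their distance by the parts of the two legs next to the apex, which is the hypothesis of
`cos_le_of_le_add`. -/
lemma diameter_pair (H : AltitudePolygon c n w q) {p : ℕ} (hn : n = 2 * p + 1) (hp : 1 ≤ p)
    (hopp : ∀ i, IsOpposite c n w q i (i + p)) (a : ℤ) :
    c * Real.cos (angle (w a) (w (a + p)) / 2) ≤ Real.cos (angle (w a) (w (a + p))) := by
  -- μ k is the distance from the foot of w k to w (k + p). It is also the distance from the foot of
  -- w (k + p) to w k, because the inner product is symmetric and k + 2p + 1 is k modulo n; so each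
  -- piece occurs on two sides.
  set μ : ℤ → ℝ := fun k => Real.arccos (⟪w k, w (k + p)⟫ / c) with hμ
  have hμper : ∀ k, μ (k + n) = μ k := by
    intro k
    simp only [hμ]
    rw [H.w_add, show k + n + (p : ℤ) = k + p + n by ring, H.w_add]
  have hleft : ∀ i, angle (q i) (w (i + p)) = μ i := by
    intro i
    rw [angle_eq_arccos (H.norm_q i) (H.norm_w _), H.inner_foot_left (hopp i)]
  have hright : ∀ i, angle (q i) (w (i + p + 1)) = μ (i + p + 1) := by
    intro i
    rw [angle_eq_arccos (H.norm_q i) (H.norm_w _), H.inner_foot_right (hopp i), hμ]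
    simp only
    rw [show i + (p : ℤ) + 1 + p = i + n by omega, H.w_add, real_inner_comm]
  have hq0 : ∀ i, q i ≠ 0 := by
    intro i h; have := H.norm_q i; rw [h, norm_zero] at this; norm_num at this
  have hside : ∀ i, angle (w (i + p)) (w (i + p + 1)) = μ i + μ (i + p + 1) := by
    intro i
    obtain ⟨α, β, hα, hβ, h⟩ := (hopp i).combination
    rw [angle_eq_add_of_combination (hq0 i) one_pos hα hβ (by rw [one_smul]; exact h),
      angle_comm, hleft, hright]
  -- the chain from `w a` to `w (a + p)`
  have hchain1 : angle (w a) (w (a + p)) ≤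
      ∑ j ∈ Finset.range p, (μ (a + p + 1 + j) + μ (a + 1 + j)) := by
    rcases angle_path_le (fun k => w (a + k)) p with h | h
    · simp only [Nat.cast_zero, add_zero, Nat.cast_add, Nat.cast_one] at h
      refine h.trans (le_of_eq (Finset.sum_congr rfl fun j _ => ?_))
      have := hside (a + j - p)
      rw [show a + (j : ℤ) - p + p = a + j by ring] at this
      rw [← add_assoc, this, ← hμper (a + j - p)]
      congr 2 <;> [skip; ring]
      rw [hn]; ring
    · omega
  set y : ℕ → E3 := fun k => w (a + p + k) with hy
  have hpos : ∀ i j k : ℕ, i < j → j < k → k ≤ p + 1 → 0 < det3 (y i) (y j) (y k) := by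
    intro i j k hij hjk hk
    exact H.det_pos _ _ _ (by omega) (by omega) (by omega)
  have hy0 : y 0 = w (a + p) := by simp [hy]
  have hy1 : y 1 = w (a + p + 1) := by simp [hy]
  have hyp : y p = w (a + p + p) := by simp [hy]
  have hyp1 : y (p + 1) = w (a + p + p + 1) := by simp only [hy]; push_cast; congr 1; ring
  have hya : w (a + p + p + 1) = w a := by
    rw [show a + (p : ℤ) + p + 1 = a + n by omega, H.w_add]
  set P := chainApex y p 0 with hP
  have hP0 : P ≠ 0 := chainApex_ne_zero (by omega) hpos
  have hchain2 : ∑ j ∈ Finset.range (p + 1), (μ (a + j) + μ (a + p + 1 + j)) ≤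
      angle (y 0) P + angle P (y (p + 1)) := by
    have := chain_length_le hpos (p - 1) 0 (by omega)
    rw [← Finset.range_eq_Ico] at this
    refine le_trans (le_of_eq (Finset.sum_congr rfl fun j _ => ?_)) this
    have h1 := hside (a + j)
    simp only [hy]
    push_cast
    rw [show a + (p : ℤ) + j = a + j + p by ring, show a + (p : ℤ) + (j + 1) = a + j + p + 1 by ring,
      h1, show a + (p : ℤ) + 1 + j = a + j + p + 1 by ring]
  -- The pieces of the two chains cancel except for μ a and μ (a + n) in the chain with p + 1 sides.
  have hsum : angle (w a) (w (a + p)) + 2 * μ a ≤ angle (y 0) P + angle P (y (p + 1)) := by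
    rw [Finset.sum_add_distrib] at hchain1 hchain2
    rw [Finset.sum_range_succ'] at hchain2
    rw [Finset.sum_range_succ (fun j : ℕ => μ (a + p + 1 + j))] at hchain2
    have e1 : ∑ k ∈ Finset.range p, μ (a + ((k + 1 : ℕ) : ℤ)) =
        ∑ k ∈ Finset.range p, μ (a + 1 + k) :=
      Finset.sum_congr rfl fun k _ => by push_cast; congr 1; ring
    have e2 : μ (a + p + 1 + p) = μ a := by rw [← hμper a, hn]; congr 1; ring
    rw [e1, e2, Nat.cast_zero, add_zero] at hchain2
    linarith
  obtain ⟨α, β, hα, hβ, hqa⟩ := (hopp a).combination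
  rw [← hy0, ← hy1] at hqa
  obtain ⟨α', β', hα', hβ', hqp⟩ := (hopp (a + p)).combination
  rw [← hyp, ← hyp1] at hqp
  -- The foot of w a lies on the leg from w (a + p) to P, at distance μ a from w (a + p); likewise
  -- for the other leg in `hA`.
  have hB : angle (y 0) P = μ a + angle (q a) P := by
    have d1 := det3_nonneg_of_le hpos (i := 0 + 1) (j := p) (k := p + 1) (by omega) (by omega) le_rfl
    have d0 := hpos 0 p (p + 1) (by omega) (by omega) le_rfl
    rw [angle_eq_add_of_combination (hq0 a) d0
      (by positivity) hβ (combination_apex hqa (P := P) rfl), angle_comm, hy0, hleft]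
  have hA : angle P (y (p + 1)) = μ a + angle (q (a + p)) P := by
    have d1 := det3_nonneg_of_le hpos (i := 0) (j := 0 + 1) (k := p) (by omega) (by omega) (by omega)
    have d0 := hpos 0 (0 + 1) (p + 1) (by omega) (by omega) le_rfl
    rw [angle_comm, angle_eq_add_of_combination (hq0 (a + p)) d0
      (by positivity) hα' (combination_apex (hqp.trans (add_comm _ _)) (chainApex_eq y p 0)),
      angle_comm, hyp1, hright, show a + (p : ℤ) + p + 1 = a + n by omega, hμper]
  have hcos : ∀ i, ⟪farNormal c (w i) (q i), P⟫ = 0 →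
      Real.cos (angle (w i) P) = c * Real.cos (angle (q i) P) := by
    intro i h
    rw [farNormal_inner] at h
    rw [cos_angle, cos_angle, H.norm_w, H.norm_q, one_mul, ← mul_div_assoc]
    congr 1; linarith
  have hc1 : Real.cos (μ a + angle (q (a + p)) P) = c * Real.cos (angle (q a) P) := by
    rw [← hA, hyp1, hya, angle_comm]
    apply hcos
    have h1 := (hopp a).left
    have h2 := (hopp a).right
    rw [← hy0] at h1
    rw [← hy1] at h2
    rw [hP, chainApex, inner_sub_right, real_inner_smul_right, real_inner_smul_right, h1]
    rw [zero_add, h2]; ring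
  have hc2 : Real.cos (μ a + angle (q a) P) = c * Real.cos (angle (q (a + p)) P) := by
    rw [← hB, hy0]
    apply hcos
    have h1 := (hopp (a + p)).left
    have h2 := (hopp (a + p)).right
    rw [← hyp] at h1
    rw [← hyp1] at h2
    rw [hP, chainApex_eq, inner_sub_right, real_inner_smul_right, real_inner_smul_right, h1, h2]
    ring
  have hc3 : Real.cos (angle (w a) (w (a + p))) = c * Real.cos (μ a) := by
    rw [cos_angle_of_norm (H.norm_w _) (H.norm_w _), ← hleft,
      cos_angle_of_norm (H.norm_q _) (H.norm_w _), H.inner_foot_left (hopp a),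
      mul_div_cancel₀ _ H.c_pos.ne']
  refine cos_le_of_le_add H.c_pos H.c_lt_one (Real.arccos_nonneg _) (angle_nonneg _ _)
    (angle_nonneg _ _) (angle_nonneg _ _) ?_ ?_ ?_ hc1 hc2 hc3 (by linarith)
  · rw [angle_eq_arccos (H.norm_w _) (H.norm_w _)]
    exact Real.arccos_le_pi_div_two.2 (H.inner_nonneg _ _)
  · change μ a + _ ≤ _
    rw [← hB]; exact angle_le_pi _ _
  · change μ a + _ ≤ _
    rw [← hA]; exact angle_le_pi _ _

/-- A lower bound for the scalar products of the vertices. -/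
lemma exists_inner_bound (H : AltitudePolygon c n w q) :
    ∃ t : ℝ, 0 ≤ t ∧ t ≤ 1 ∧ c * √((1 + t) / 2) ≤ t ∧ ∀ i j, t ≤ ⟪w i, w j⟫ := by
  obtain ⟨p, hn, hp, hopp⟩ := H.exists_half
  suffices h : ∃ a, ∀ i j, ⟪w a, w (a + p)⟫ ≤ ⟪w i, w j⟫ by
    obtain ⟨a, ha⟩ := h
    have hd := H.diameter_pair hn hp hopp a
    have h0 := H.inner_nonneg a (a + p)
    have hang : angle (w a) (w (a + p)) ≤ Real.pi / 2 := by
      rw [angle_eq_arccos (H.norm_w _) (H.norm_w _)]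
      exact Real.arccos_le_pi_div_two.2 h0
    have hpi := Real.pi_pos
    rw [Real.cos_half (by linarith [angle_nonneg (w a) (w (a + p))]) (by linarith),
      cos_angle_of_norm (H.norm_w _) (H.norm_w _)] at hd
    refine ⟨_, h0, ?_, hd, ha⟩
    have := real_inner_le_norm (w a) (w (a + p))
    rwa [H.norm_w, H.norm_w, mul_one] at this
  have hn3 := H.three_le
  -- a pair of vertices at maximal distance
  obtain ⟨⟨i, j⟩, hij, hmin⟩ := Finset.exists_min_image (Finset.Ico 0 n ×ˢ Finset.Ico 0 n)
    (fun k : ℤ × ℤ => ⟪w k.1, w k.2⟫) ⟨(0, 0), by simp; omega⟩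
  have hmin' : ∀ i' j', ⟪w i, w j⟫ ≤ ⟪w i', w j'⟫ := by
    intro i' j'
    obtain ⟨a, r, h1, h2, rfl⟩ := H.exists_rep 0 i'
    obtain ⟨b, r', h3, h4, rfl⟩ := H.exists_rep 0 j'
    have := hmin (i' + r * n, j' + r' * n) (by
      rw [Finset.mem_product, Finset.mem_Ico, Finset.mem_Ico]; dsimp only; omega)
    simpa only [H.w_add_mul] using this
  rw [Finset.mem_product, Finset.mem_Ico, Finset.mem_Ico] at hij
  dsimp only at hij
  -- Going around the polygon the shorter way, two distinct vertices are at most p steps apart.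
  have hcase : i = j ∨ ∃ x k : ℤ, 0 < k ∧ k ≤ p ∧ ⟪w i, w j⟫ = ⟪w x, w (x + k)⟫ := by
    rcases lt_trichotomy i j with h | h | h
    · right
      rcases le_or_gt (j - i) p with h' | h'
      · exact ⟨i, j - i, by omega, h', by rw [add_sub_cancel]⟩
      · refine ⟨j, n - (j - i), by omega, by omega, ?_⟩
        rw [show j + (n - (j - i)) = i + n by ring, H.w_add, real_inner_comm]
    · left; exact h
    · right
      rcases le_or_gt (i - j) p with h' | h'
      · exact ⟨j, i - j, by omega, h', by rw [add_sub_cancel, real_inner_comm]⟩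
      · refine ⟨i, n - (i - j), by omega, by omega, ?_⟩
        rw [show i + (n - (i - j)) = j + n by ring, H.w_add]
  rcases hcase with rfl | ⟨x, k, hk0, hkp, hxk⟩
  · refine ⟨0, fun i' j' => le_trans ?_ (hmin' i' j')⟩
    rw [inner_self_eq_one (H.norm_w _)]
    have := real_inner_le_norm (w 0) (w (0 + p))
    rwa [H.norm_w, H.norm_w, mul_one] at this
  refine ⟨x, fun i' j' => le_trans ?_ (hmin' i' j')⟩
  rw [hxk]
  rcases hkp.eq_or_lt with rfl | hkp
  · exact le_rfl
  obtain ⟨α, β, hα, hβ, hq⟩ := (hopp (x + p)).combination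
  have hend : x + (p : ℤ) + p + 1 = x + n := by omega
  have hr := (hopp (x + p)).right
  rw [hend, H.w_add] at hq hr
  refine inner_le_of_between H.c_pos H.c_lt_one (H.norm_w x) (H.norm_w (x + k))
    (H.norm_q (x + p)) (H.norm_w (x + p)) (H.inner_w_q _) ?_ (H.inner_nonneg _ _) hα hq hr
    (hopp (x + p)).left (H.far_nonneg _ _) (H.strip _ _).1 ?_ ?_ ?_
  · rw [hq, inner_add_right, real_inner_smul_right, real_inner_smul_right]
    exact add_nonneg (mul_nonneg hα (H.inner_nonneg _ _)) (mul_nonneg hβ (H.inner_nonneg _ _))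
  · rw [det3_swap_right]
    linarith [H.det_pos x (x + p) (x + p + p) (by omega) (by omega) (by omega)]
  · exact (H.det_pos x (x + k) (x + p) (by omega) (by omega) (by omega)).le
  -- Maximality in the form ⟪x, z⟫⟪x, y⟫ ≤ ⟪x, y⟫ ≤ ⟪y, z⟫.
  · have h1 : ⟪w x, w (x + p + p)⟫ ≤ 1 := by
      have := real_inner_le_norm (w x) (w (x + p + p))
      rwa [H.norm_w, H.norm_w, mul_one] at this
    have h2 := hmin' (x + k) (x + p + p)
    rw [hxk] at h2
    nlinarith [H.inner_nonneg x (x + k)]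

end AltitudePolygon

/-! ### Points of the sphere as unit vectors -/

lemma norm_coe (x : S2) : ‖(x : E3)‖ = 1 := norm_eq_of_mem_sphere x

lemma coe_ne_zero (x : S2) : (x : E3) ≠ 0 := by
  intro h; have := norm_coe x; rw [h, norm_zero] at this; norm_num at this

/-- The point of the sphere in the direction of a nonzero vector. -/
def direction (x : E3) (hx : x ≠ 0) : S2 :=
  ⟨‖x‖⁻¹ • x, by
    rw [mem_sphere_zero_iff_norm, norm_smul, norm_inv, norm_norm,
      inv_mul_cancel₀ (norm_ne_zero_iff.2 hx)]⟩

lemma coe_direction (x : E3) (hx : x ≠ 0) : (direction x hx : E3) = ‖x‖⁻¹ • x := rfl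

lemma norm_smul_direction (x : E3) (hx : x ≠ 0) : ‖x‖ • (direction x hx : E3) = x := by
  rw [coe_direction, smul_smul, mul_inv_cancel₀ (norm_ne_zero_iff.2 hx), one_smul]

lemma direction_inner_pos_iff {x : E3} (hx : x ≠ 0) {y : E3} :
    0 ≤ ⟪y, (direction x hx : E3)⟫ ↔ 0 ≤ ⟪y, x⟫ := by
  rw [coe_direction, real_inner_smul_right]
  exact mul_nonneg_iff_of_pos_left (inv_pos.2 (norm_pos_iff.2 hx))

lemma sdist_eq_arccos (a b : S2) : sdist a b = Real.arccos ⟪(a : E3), (b : E3)⟫ :=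
  angle_eq_arccos (norm_coe a) (norm_coe b)

lemma sdist_lt_pi_iff (a b : S2) : sdist a b < Real.pi ↔ (a : E3) ≠ -b := by
  have h1 : ⟪(a : E3), (b : E3)⟫ = -1 ↔ (a : E3) = -b :=
    inner_eq_neg_one_iff_of_norm_eq_one (norm_coe a) (norm_coe b)
  have h2 := Real.arccos_eq_pi (x := ⟪(a : E3), (b : E3)⟫)
  have h3 : (-1 : ℝ) ≤ ⟪(a : E3), (b : E3)⟫ :=
    neg_one_le_real_inner_of_norm_eq_one (norm_coe a) (norm_coe b)
  rw [sdist_eq_arccos, (Real.arccos_le_pi _).lt_iff_ne, ne_eq, ne_eq, not_iff_not, h2, ← h1]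
  exact ⟨fun h => le_antisymm h h3, fun h => h.le⟩

lemma mem_hemisphere_iff (g x : S2) : x ∈ hemisphere g ↔ 0 ≤ ⟪(g : E3), (x : E3)⟫ := by
  rw [hemisphere, disk, Set.mem_ofPred_eq, sdist_eq_arccos, Real.arccos_le_pi_div_two]

lemma inner_le_one (x y : S2) : ⟪(x : E3), (y : E3)⟫ ≤ 1 := by
  have := real_inner_le_norm (x : E3) (y : E3)
  rwa [norm_coe, norm_coe, mul_one] at this

lemma neg_one_le_inner (x y : S2) : -1 ≤ ⟪(x : E3), (y : E3)⟫ :=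
  neg_one_le_real_inner_of_norm_eq_one (norm_coe x) (norm_coe y)

lemma eq_of_smul_eq {x y : S2} {t : ℝ} (ht : 0 ≤ t) (h : (x : E3) = t • (y : E3)) : x = y := by
  have := congrArg norm h
  rw [norm_smul, norm_coe, norm_coe, mul_one, Real.norm_eq_abs, abs_of_nonneg ht] at this
  rw [← this, one_smul] at h
  exact Subtype.ext h

/-! ### The cone over a spherically convex set -/

lemma IsConvex.add_smul_mem {C : Set S2} (hC : IsConvex C) {x y : S2} (hx : x ∈ C) (hy : y ∈ C)
    {s t : ℝ} (hs : 0 < s) (ht : 0 < t) :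
    ∃ h : s • (x : E3) + t • (y : E3) ≠ 0, direction _ h ∈ C := by
  have hne : s • (x : E3) + t • (y : E3) ≠ 0 := by
    intro h
    have h1 : s • (x : E3) = -(t • (y : E3)) := eq_neg_of_add_eq_zero_left h
    have h2 := congrArg norm h1
    rw [norm_neg, norm_smul, norm_smul, norm_coe, norm_coe, Real.norm_of_nonneg hs.le,
      Real.norm_of_nonneg ht.le, mul_one, mul_one] at h2
    rw [← h2, ← smul_neg] at h1
    exact (sdist_lt_pi_iff x y).1 (hC x hx y hy).1 (smul_right_injective _ hs.ne' h1)
  refine ⟨hne, (hC x hx y hy).2 ?_⟩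
  refine ⟨‖s • (x : E3) + t • (y : E3)‖⁻¹ * s, ‖s • (x : E3) + t • (y : E3)‖⁻¹ * t,
    by positivity, by positivity, ?_⟩
  rw [coe_direction, smul_add, smul_smul, smul_smul]

/-- The cone over a spherically convex set. -/
def IsConvex.cone {C : Set S2} (hC : IsConvex C) : Submodule ℝ≥0 E3 where
  carrier := {z | z = 0 ∨ ∃ h : z ≠ 0, direction z h ∈ C}
  zero_mem' := Or.inl rfl
  add_mem' := by
    rintro a b (rfl | ⟨ha, ha'⟩) hb
    · rwa [zero_add]
    rcases hb with rfl | ⟨hb, hb'⟩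
    · rw [add_zero]; exact Or.inr ⟨ha, ha'⟩
    · have := hC.add_smul_mem ha' hb' (norm_pos_iff.2 ha) (norm_pos_iff.2 hb)
      simp only [norm_smul_direction] at this
      exact Or.inr this
  smul_mem' := by
    rintro r a (rfl | ⟨ha, ha'⟩)
    · rw [smul_zero]; exact Or.inl rfl
    rcases eq_or_ne r 0 with rfl | hr
    · rw [zero_smul]; exact Or.inl rfl
    · have hr' : (0 : ℝ) < r := lt_of_le_of_ne r.coe_nonneg (fun h => hr (NNReal.coe_eq_zero.1 h.symm))
      have hne : r • a ≠ 0 := smul_ne_zero hr ha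
      refine Or.inr ⟨hne, ?_⟩
      have : direction (r • a) hne = direction a ha := by
        apply Subtype.ext
        rw [coe_direction, coe_direction, NNReal.smul_def, norm_smul, smul_smul,
          Real.norm_of_nonneg hr'.le, mul_inv, mul_right_comm, inv_mul_cancel₀ hr'.ne', one_mul]
      rwa [this]

lemma IsConvex.mem_cone_iff {C : Set S2} (hC : IsConvex C) {z : E3} :
    z ∈ hC.cone ↔ z = 0 ∨ ∃ h : z ≠ 0, direction z h ∈ C := Iff.rfl

lemma direction_coe (x : S2) : direction (x : E3) (coe_ne_zero x) = x := by
  apply Subtype.ext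
  rw [coe_direction, norm_coe, inv_one, one_smul]

lemma IsConvex.coe_mem_cone_iff {C : Set S2} (hC : IsConvex C) {x : S2} :
    (x : E3) ∈ hC.cone ↔ x ∈ C := by
  rw [hC.mem_cone_iff]
  constructor
  · rintro (h | ⟨h, h'⟩)
    · exact absurd h (coe_ne_zero x)
    · rwa [direction_coe] at h'
  · intro h
    exact Or.inr ⟨coe_ne_zero x, by rwa [direction_coe]⟩

lemma IsConvex.smul_mem_cone {C : Set S2} (hC : IsConvex C) {z : E3} (hz : z ∈ hC.cone) {t : ℝ}
    (ht : 0 ≤ t) : t • z ∈ hC.cone := by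
  have := hC.cone.smul_mem ⟨t, ht⟩ hz
  exact this

lemma IsConvex.cone_pointed {C : Set S2} (hC : IsConvex C) {z : E3} (hz : z ∈ hC.cone)
    (hz' : -z ∈ hC.cone) : z = 0 := by
  by_contra h
  rw [hC.mem_cone_iff] at hz hz'
  rcases hz with hz | ⟨_, hz⟩
  · exact h hz
  rcases hz' with hz' | ⟨h', hz'⟩
  · exact h (neg_eq_zero.1 hz')
  apply (sdist_lt_pi_iff _ _).1 (hC _ hz _ hz').1
  rw [coe_direction, coe_direction, norm_neg, smul_neg, neg_neg]

/-- Away from 0 normalization is continuous and the trace of the cone on the sphere is compact; so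
the complement, which does not contain 0, is open. -/
lemma IsConvex.cone_isClosed {C : Set S2} (hC : IsConvex C) (hcl : IsClosed C) :
    IsClosed (hC.cone : Set E3) := by
  have hS : IsClosed ((fun x : S2 => (x : E3)) '' C) :=
    (hcl.isCompact.image continuous_subtype_val).isClosed
  have h1 : (hC.cone : Set E3)ᶜ = {z | z ≠ 0} ∩
      (fun z : E3 => ‖z‖⁻¹ • z) ⁻¹' ((fun x : S2 => (x : E3)) '' C)ᶜ := by
    ext z
    simp only [Set.mem_compl_iff, SetLike.mem_coe, hC.mem_cone_iff, Set.mem_inter_iff,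
      Set.mem_ofPred_eq, Set.mem_preimage, Set.mem_image, not_or, not_exists]
    refine and_congr_right fun hz => ⟨fun h x => ?_, fun h hz' hd => h _ ⟨hd, rfl⟩⟩
    rintro ⟨hx, hxz⟩
    refine h hz ?_
    have : direction z hz = x := Subtype.ext hxz.symm
    rwa [this]
  rw [← isOpen_compl_iff, h1]
  refine ContinuousOn.isOpen_inter_preimage ?_ isOpen_ne hS.isOpen_compl
  exact (continuousOn_id.norm.inv₀ fun z hz => norm_ne_zero_iff.2 hz).smul continuousOn_id

/-- A vector lies in the cone over a closed convex set if it lies in all supporting half-spaces. -/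
lemma IsConvex.mem_cone_of_forall {C : Set S2} (hC : IsConvex C) (hcl : IsClosed C) {p : E3}
    (hp : ∀ y : E3, (∀ x ∈ C, 0 ≤ ⟪y, (x : E3)⟫) → 0 ≤ ⟪y, p⟫) : p ∈ hC.cone := by
  by_contra hmem
  have hconv : Convex ℝ (hC.cone : Set E3) := by
    intro a ha b hb s t hs ht _
    exact hC.cone.add_mem (hC.smul_mem_cone ha hs) (hC.smul_mem_cone hb ht)
  obtain ⟨f, u, hfu, hf⟩ := geometric_hahn_banach_point_closed hconv (hC.cone_isClosed hcl) hmem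
  have hu : u < 0 := by simpa using hf 0 hC.cone.zero_mem
  have hnn : ∀ x ∈ C, 0 ≤ f (x : E3) := by
    intro x hx
    by_contra hneg
    push Not at hneg
    have := hf ((u / f x) • (x : E3)) (hC.smul_mem_cone (hC.coe_mem_cone_iff.2 hx)
      (div_nonneg_of_nonpos hu.le hneg.le))
    rw [map_smul, smul_eq_mul, div_mul_cancel₀ _ hneg.ne] at this
    exact lt_irrefl _ this
  have hrepr : ∀ x, ⟪(InnerProductSpace.toDual ℝ E3).symm f, x⟫ = f x := fun x =>
    InnerProductSpace.toDual_symm_apply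
  have := hp ((InnerProductSpace.toDual ℝ E3).symm f) (fun x hx => by
    rw [hrepr]; exact hnn x hx)
  rw [hrepr] at this
  linarith

lemma span_le_cone {C : Set S2} (hC : IsConvex C) {A : Set S2} (hA : A ⊆ C) :
    Submodule.span ℝ≥0 ((fun x : S2 => (x : E3)) '' A) ≤ hC.cone := by
  rw [Submodule.span_le]
  rintro _ ⟨x, hx, rfl⟩
  exact hC.coe_mem_cone_iff.2 (hA hx)

lemma smul_mem_span {A : Set E3} {z : E3} (hz : z ∈ Submodule.span ℝ≥0 A) {t : ℝ} (ht : 0 ≤ t) :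
    t • z ∈ Submodule.span ℝ≥0 A := by
  have := (Submodule.span ℝ≥0 A).smul_mem ⟨t, ht⟩ hz
  exact this

/-- The convex hull of a subset of a convex set, by means of nonnegative combinations. -/
lemma mem_hull_iff {D : Set S2} (hD : IsConvex D) {A : Set S2} (hA : A ⊆ D) {x : S2} :
    x ∈ hull A ↔ (x : E3) ∈ Submodule.span ℝ≥0 ((fun x : S2 => (x : E3)) '' A) := by
  constructor
  · intro hx
    refine hx {x : S2 | (x : E3) ∈ Submodule.span ℝ≥0 ((fun x : S2 => (x : E3)) '' A)} ⟨?_, ?_⟩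
    · intro a ha b hb
      refine ⟨?_, ?_⟩
      · rw [sdist_lt_pi_iff]
        intro h
        refine coe_ne_zero a (hD.cone_pointed (span_le_cone hD hA ha) ?_)
        rw [h, neg_neg]
        exact span_le_cone hD hA hb
      · rintro z ⟨s, t, hs, ht, hz⟩
        rw [Set.mem_ofPred_eq, hz]
        exact Submodule.add_mem _ (smul_mem_span ha hs) (smul_mem_span hb ht)
    · intro a ha
      exact Submodule.subset_span ⟨a, ha, rfl⟩
  · rintro hx C ⟨hC, hAC⟩
    exact hC.coe_mem_cone_iff.1 (span_le_cone hC hAC hx)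

/-! ### Lunes and thickness -/

/-- The vectors of the dual cone of a set on the sphere. -/
def Supports (y : E3) (C : Set S2) : Prop := ∀ x ∈ C, 0 ≤ ⟪y, (x : E3)⟫

lemma supports_iff_subset (g : S2) (C : Set S2) : Supports (g : E3) C ↔ C ⊆ hemisphere g :=
  forall₂_congr fun x _ => (mem_hemisphere_iff g x).symm

lemma Supports.mono {y : E3} {C D : Set S2} (h : Supports y D) (hCD : C ⊆ D) : Supports y C :=
  fun x hx => h x (hCD hx)

lemma isLunePair_iff (g h : S2) : IsLunePair g h ↔
    -1 < ⟪(g : E3), (h : E3)⟫ ∧ ⟪(g : E3), (h : E3)⟫ < 1 := by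
  rw [(neg_one_le_inner g h).lt_iff_ne, (inner_le_one g h).lt_iff_ne, IsLunePair, and_comm]
  refine and_congr ?_ ?_
  · rw [ne_comm (a := (-1 : ℝ)), ne_eq, ne_eq,
      inner_eq_neg_one_iff_of_norm_eq_one (norm_coe g) (norm_coe h), Subtype.ext_iff]
    rfl
  · rw [ne_eq, ne_eq, inner_eq_one_iff_of_norm_eq_one (norm_coe g) (norm_coe h), Subtype.ext_iff]

/-- The tangent directions are the far normals for the parameter k = ⟪g, h⟫. They have equal length,
and their angle has cosine -k. -/
lemma luneThickness_eq {g h : S2} (hgh : IsLunePair g h) :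
    luneThickness g h = Real.pi - Real.arccos ⟪(g : E3), (h : E3)⟫ := by
  obtain ⟨h1, h2⟩ := (isLunePair_iff g h).1 hgh
  set k := ⟪(g : E3), (h : E3)⟫ with hk
  have hgg := inner_self_eq_one (norm_coe g)
  have hhh := inner_self_eq_one (norm_coe h)
  have hkk : ⟪(h : E3), (g : E3)⟫ = k := real_inner_comm _ _
  have hpos : 0 < 1 - k ^ 2 := by nlinarith
  have e1 : tangentDir g h = farNormal k h g := by rw [tangentDir, farNormal]
  have e2 : tangentDir h g = farNormal k g h := by rw [tangentDir, farNormal, hkk]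
  have n1 : ‖tangentDir g h‖ ^ 2 = 1 - k ^ 2 := by
    rw [← real_inner_self_eq_norm_sq, e1, farNormal_inner_self (norm_coe h) (norm_coe g) hkk]
  have n2 : ‖tangentDir h g‖ ^ 2 = 1 - k ^ 2 := by
    rw [← real_inner_self_eq_norm_sq, e2, farNormal_inner_self (norm_coe g) (norm_coe h) rfl]
  have n3 : ‖tangentDir g h‖ = ‖tangentDir h g‖ :=
    (sq_eq_sq₀ (norm_nonneg _) (norm_nonneg _)).1 (n1.trans n2.symm)
  rw [luneThickness, angle, n3, ← sq, n2, e1, e2,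
    farNormal_inner_swap (norm_coe g) (norm_coe h) rfl, neg_div,
    mul_div_cancel_right₀ _ hpos.ne', Real.arccos_neg]

lemma thickness_le {C : Set S2} {g h : S2} (hgh : IsLunePair g h) (hg : Supports (g : E3) C)
    (hh : Supports (h : E3) C) :
    thickness C ≤ Real.pi - Real.arccos ⟪(g : E3), (h : E3)⟫ := by
  have hmem : Real.pi - Real.arccos ⟪(g : E3), (h : E3)⟫ ∈
      {t | ∃ g h : S2, IsLunePair g h ∧ C ⊆ lune g h ∧ t = luneThickness g h} :=
    Exists.intro g (Exists.intro h ⟨hgh,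
      Set.subset_inter ((supports_iff_subset g C).1 hg) ((supports_iff_subset h C).1 hh),
      (luneThickness_eq hgh).symm⟩)
  have hbdd : BddBelow {t | ∃ g h : S2, IsLunePair g h ∧ C ⊆ lune g h ∧ t = luneThickness g h} := by
    refine ⟨0, ?_⟩
    rintro t ⟨g, h, -, -, rfl⟩
    exact angle_nonneg _ _
  exact csInf_le hbdd hmem

lemma exists_of_thickness_lt {C : Set S2} {t : ℝ} (ht : thickness C < t)
    (hne : ∃ g h : S2, IsLunePair g h ∧ Supports (g : E3) C ∧ Supports (h : E3) C) :
    ∃ g h : S2, IsLunePair g h ∧ Supports (g : E3) C ∧ Supports (h : E3) C ∧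
      Real.pi - Real.arccos ⟪(g : E3), (h : E3)⟫ < t := by
  obtain ⟨g₀, h₀, hgh₀, hg₀, hh₀⟩ := hne
  have hmem : luneThickness g₀ h₀ ∈
      {t | ∃ g h : S2, IsLunePair g h ∧ C ⊆ lune g h ∧ t = luneThickness g h} :=
    Exists.intro g₀ (Exists.intro h₀ ⟨hgh₀, Set.subset_inter ((supports_iff_subset g₀ C).1 hg₀)
      ((supports_iff_subset h₀ C).1 hh₀), rfl⟩)
  obtain ⟨_, ⟨g, h, hgh, hsub, rfl⟩, hlt⟩ := exists_lt_of_csInf_lt ⟨_, hmem⟩ ht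
  refine ⟨g, h, hgh, (supports_iff_subset g C).2 fun x hx => (hsub hx).1,
    (supports_iff_subset h C).2 fun x hx => (hsub hx).2, ?_⟩
  rwa [← luneThickness_eq hgh]

lemma exists_lunePair_of_thickness_pos {C : Set S2} (h : 0 < thickness C) :
    ∃ g h : S2, IsLunePair g h ∧ Supports (g : E3) C ∧ Supports (h : E3) C := by
  by_contra hcon
  have : {t | ∃ g h : S2, IsLunePair g h ∧ C ⊆ lune g h ∧ t = luneThickness g h} = ∅ := by
    rw [Set.eq_empty_iff_forall_notMem]
    rintro t ⟨g, h, hgh, hsub, -⟩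
    exact hcon ⟨g, h, hgh, (supports_iff_subset g C).2 fun x hx => (hsub hx).1,
      (supports_iff_subset h C).2 fun x hx => (hsub hx).2⟩
  -- The infimum of the empty set is 0 by convention, so positive thickness guarantees that some
  -- lune contains the set.
  rw [thickness, this, Real.sInf_empty] at h
  exact lt_irrefl _ h

/-- A nonzero supporting vector is positive at interior points. -/
lemma Supports.pos_of_interior {C : Set S2} {y : E3} (hy : y ≠ 0) (hs : Supports y C) {x : S2}
    (hx : x ∈ interior C) : 0 < ⟪y, (x : E3)⟫ := by
  refine lt_of_le_of_ne (hs x (interior_subset hx)) fun h0 => ?_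
  have hort : ⟪(x : E3), (direction y hy : E3)⟫ = 0 := by
    rw [coe_direction, real_inner_smul_right, real_inner_comm, ← h0, mul_zero]
  have hnorm : ∀ t : ℝ, Real.cos t • (x : E3) - Real.sin t • (direction y hy : E3) ∈
      Metric.sphere (0 : E3) 1 := by
    intro t
    rw [mem_sphere_zero_iff_norm, ← sq_eq_sq₀ (norm_nonneg _) zero_le_one,
      ← real_inner_self_eq_norm_sq]
    simp only [inner_sub_left, inner_sub_right, real_inner_smul_left, real_inner_smul_right,
      inner_self_eq_one (norm_coe _), hort, real_inner_comm (x : E3) (direction y hy : E3)]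
    nlinarith [Real.sin_sq_add_cos_sq t]
  -- Moving from x along the great circle away from y stays in C for a short time, although ⟪y, ·⟫
  -- becomes negative at once.
  set γ : ℝ → S2 := fun t => ⟨_, hnorm t⟩ with hγ
  have hcont : Continuous γ := by
    refine Continuous.subtype_mk ?_ _
    fun_prop
  have hγ0 : γ 0 = x := by
    apply Subtype.ext
    simp [hγ]
  have hev : ∀ᶠ t in 𝓝 (0 : ℝ), γ t ∈ interior C :=
    (hcont.tendsto 0).eventually (isOpen_interior.mem_nhds (by rwa [hγ0]))
  have hev2 : ∀ᶠ t in 𝓝[>] (0 : ℝ), t < 1 :=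
    nhdsWithin_le_nhds (gt_mem_nhds one_pos)
  obtain ⟨t, ⟨ht1, ht2⟩, ht0⟩ :=
    (((hev.filter_mono nhdsWithin_le_nhds).and hev2).and self_mem_nhdsWithin).exists
  have ht0' : (0 : ℝ) < t := ht0
  have h1 := hs _ (interior_subset ht1)
  have hsin : 0 < Real.sin t := Real.sin_pos_of_pos_of_lt_pi ht0' (by linarith [Real.pi_gt_three])
  have hyd : 0 < ⟪y, (direction y hy : E3)⟫ := by
    rw [coe_direction, real_inner_smul_right]
    exact mul_pos (inv_pos.2 (norm_pos_iff.2 hy)) (real_inner_self_pos.2 hy)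
  simp only [hγ, inner_sub_right, real_inner_smul_right, ← h0] at h1
  nlinarith [mul_pos hsin hyd]

/-! ### Optimal lunes and their feet -/

/-- No two half-spaces containing `C` meet in an angle with cosine larger than `c`. -/
def DualBound (c : ℝ) (C : Set S2) : Prop :=
  ∀ y z : E3, Supports y C → Supports z C → -(c * (‖y‖ * ‖z‖)) ≤ ⟪y, z⟫

lemma Supports.smul {y : E3} {C : Set S2} (hy : Supports y C) {t : ℝ} (ht : 0 ≤ t) :
    Supports (t • y) C := fun x hx => by
  rw [real_inner_smul_left]; exact mul_nonneg ht (hy x hx)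

lemma Supports.add {y z : E3} {C : Set S2} (hy : Supports y C) (hz : Supports z C) :
    Supports (y + z) C := fun x hx => by
  rw [inner_add_left]; exact add_nonneg (hy x hx) (hz x hx)

lemma dualBound_of_unit {c : ℝ} {C : Set S2} (h : ∀ g h : S2, Supports (g : E3) C →
    Supports (h : E3) C → -c ≤ ⟪(g : E3), (h : E3)⟫) : DualBound c C := by
  intro y z hy hz
  rcases eq_or_ne y 0 with rfl | hy0
  · simp
  rcases eq_or_ne z 0 with rfl | hz0
  · simp
  have h1 := h (direction y hy0) (direction z hz0) (hy.smul (by positivity)) (hz.smul (by positivity))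
  have h2 : ⟪y, z⟫ = ‖y‖ * ‖z‖ * ⟪(direction y hy0 : E3), (direction z hz0 : E3)⟫ := by
    conv_lhs => rw [← norm_smul_direction y hy0, ← norm_smul_direction z hz0]
    rw [real_inner_smul_left, real_inner_smul_right]; ring
  rw [h2]
  nlinarith [mul_nonneg (norm_nonneg y) (norm_nonneg z)]

lemma thickness_nonneg (C : Set S2) : 0 ≤ thickness C := by
  refine Real.sInf_nonneg ?_
  rintro t ⟨g, h, -, -, rfl⟩
  exact angle_nonneg _ _

lemma inner_ne_neg_one_of_supports {C : Set S2} (hC : (interior C).Nonempty) {g h : S2}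
    (hg : Supports (g : E3) C) (hh : Supports (h : E3) C) : -1 < ⟪(g : E3), (h : E3)⟫ := by
  obtain ⟨x, hx⟩ := hC
  refine lt_of_le_of_ne (neg_one_le_inner g h) fun he => ?_
  have h1 : (g : E3) = -(h : E3) :=
    (inner_eq_neg_one_iff_of_norm_eq_one (norm_coe g) (norm_coe h)).1 he.symm
  have h2 := hg.pos_of_interior (coe_ne_zero g) hx
  rw [h1, inner_neg_left] at h2
  linarith [hh x (interior_subset hx)]

lemma isClosed_supports (C : Set S2) : IsClosed {g : S2 | Supports (g : E3) C} := by
  simp only [Supports, Set.ofPred_forall]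
  refine isClosed_biInter fun x _ => isClosed_le continuous_const ?_
  exact continuous_subtype_val.inner continuous_const

/-- The thickness of a convex body is attained. -/
lemma exists_optimal_lune {C : Set S2} (hC : IsConvexBody C)
    (hp : ∃ g h : S2, IsLunePair g h ∧ Supports (g : E3) C ∧ Supports (h : E3) C) :
    ∃ g h : S2, Supports (g : E3) C ∧ Supports (h : E3) C ∧
      -1 < ⟪(g : E3), (h : E3)⟫ ∧ ⟪(g : E3), (h : E3)⟫ = - Real.cos (thickness C) ∧
      Real.cos (thickness C) < 1 ∧ DualBound (Real.cos (thickness C)) C := by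
  obtain ⟨g₀, h₀, hgh₀, hg₀, hh₀⟩ := hp
  have hK : IsCompact ({g : S2 | Supports (g : E3) C} ×ˢ {h : S2 | Supports (h : E3) C}) :=
    ((isClosed_supports C).prod (isClosed_supports C)).isCompact
  have hcont : Continuous fun p : S2 × S2 => ⟪(p.1 : E3), (p.2 : E3)⟫ :=
    (continuous_subtype_val.comp continuous_fst).inner (continuous_subtype_val.comp continuous_snd)
  obtain ⟨⟨g, h⟩, ⟨hg, hh⟩, hmin⟩ := hK.exists_isMinOn ⟨(g₀, h₀), hg₀, hh₀⟩ hcont.continuousOn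
  have hmin' : ∀ g' h' : S2, Supports (g' : E3) C → Supports (h' : E3) C →
      ⟪(g : E3), (h : E3)⟫ ≤ ⟪(g' : E3), (h' : E3)⟫ := fun g' h' hg' hh' =>
    hmin (show (g', h') ∈ _ from ⟨hg', hh'⟩)
  have hlow := inner_ne_neg_one_of_supports hC.2.2 hg hh
  have hup : ⟪(g : E3), (h : E3)⟫ < 1 :=
    (hmin' g₀ h₀ hg₀ hh₀).trans_lt ((isLunePair_iff g₀ h₀).1 hgh₀).2
  have hth : thickness C = Real.pi - Real.arccos ⟪(g : E3), (h : E3)⟫ := by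
    refine le_antisymm (thickness_le ((isLunePair_iff g h).2 ⟨hlow, hup⟩) hg hh) ?_
    refine le_of_not_gt fun hlt => ?_
    obtain ⟨g', h', -, hg', hh', hlt'⟩ := exists_of_thickness_lt hlt ⟨g₀, h₀, hgh₀, hg₀, hh₀⟩
    have := Real.arccos_le_arccos (hmin' g' h' hg' hh')
    linarith
  have hcos : Real.cos (thickness C) = -⟪(g : E3), (h : E3)⟫ := by
    rw [hth, Real.cos_pi_sub, Real.cos_arccos hlow.le hup.le]
  refine ⟨g, h, hg, hh, hlow, by rw [hcos, neg_neg], by rw [hcos]; linarith, ?_⟩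
  apply dualBound_of_unit
  intro g' h' hg' hh'
  rw [hcos, neg_neg]
  exact hmin' g' h' hg' hh'

/-- The centers of the semicircles bounding an optimal lune belong to the body. -/
lemma DualBound.foot_mem_cone {c : ℝ} (hc : 0 ≤ c) {C : Set S2} (hC : IsConvexBody C)
    (hd : DualBound c C) {g h : S2} (hg : Supports (g : E3) C) (hh : Supports (h : E3) C)
    (hgh : ⟪(g : E3), (h : E3)⟫ = -c) : (g : E3) + c • (h : E3) ∈ hC.2.1.cone := by
  apply hC.2.1.mem_cone_of_forall hC.1
  intro y hy
  -- First variation: replacing h by h + δy must not beat the optimum. The norm is estimated by ‖z‖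
  -- ≤ (1 + ‖z‖²)/2 to avoid square roots.
  have key : ∀ δ : ℝ, 0 < δ → -(δ * (c * ‖y‖ ^ 2 / 2)) ≤ ⟪y, (g : E3) + c • (h : E3)⟫ := by
    intro δ hδ
    have h1 := hd g (h + δ • y) hg (hh.add (Supports.smul hy hδ.le))
    have h2 : ‖(h : E3) + δ • y‖ ^ 2 = 1 + 2 * (δ * ⟪(h : E3), y⟫) + δ ^ 2 * ‖y‖ ^ 2 := by
      rw [norm_add_sq_real, norm_coe, real_inner_smul_right, norm_smul, Real.norm_of_nonneg hδ.le]
      ring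
    have h3 : ‖(h : E3) + δ • y‖ ≤ (1 + ‖(h : E3) + δ • y‖ ^ 2) / 2 := by
      nlinarith [sq_nonneg (‖(h : E3) + δ • y‖ - 1)]
    rw [norm_coe, one_mul, inner_add_right, real_inner_smul_right, hgh] at h1
    have h4 := mul_le_mul_of_nonneg_left h3 hc
    rw [h2] at h4
    rw [inner_add_right, real_inner_smul_right, real_inner_comm (g : E3) y, real_inner_comm (h : E3) y]
    have h5 : 0 ≤ δ * (⟪(g : E3), y⟫ + c * ⟪(h : E3), y⟫ + δ * (c * ‖y‖ ^ 2 / 2)) := by nlinarith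
    have h6 := nonneg_of_mul_nonneg_right h5 hδ
    linarith
  have hlim : Tendsto (fun δ : ℝ => -(δ * (c * ‖y‖ ^ 2 / 2))) (𝓝[>] 0) (𝓝 0) := by
    have : Tendsto (fun δ : ℝ => -(δ * (c * ‖y‖ ^ 2 / 2))) (𝓝 0) (𝓝 (-(0 * (c * ‖y‖ ^ 2 / 2)))) :=
      (tendsto_id.mul_const _).neg
    rw [zero_mul, neg_zero] at this
    exact this.mono_left nhdsWithin_le_nhds
  exact le_of_tendsto hlim (by filter_upwards [self_mem_nhdsWithin] with δ hδ using key δ hδ)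

/-- An optimal lune containing a body of thickness less than `π / 2`. -/
lemma DualBound.exists_feet {c : ℝ} (hc0 : 0 < c) (hc1 : c < 1) {C : Set S2} (hC : IsConvexBody C)
    (hd : DualBound c C) {g h : S2} (hg : Supports (g : E3) C) (hh : Supports (h : E3) C)
    (hgh : ⟪(g : E3), (h : E3)⟫ = -c) :
    ∃ p q : S2, p ∈ C ∧ q ∈ C ∧ ⟪(p : E3), (q : E3)⟫ = c ∧
      (q : E3) - c • (p : E3) = √(1 - c ^ 2) • (g : E3) ∧
      (p : E3) - c • (q : E3) = √(1 - c ^ 2) • (h : E3) := by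
  have hhg : ⟪(h : E3), (g : E3)⟫ = -c := by rw [real_inner_comm]; exact hgh
  have h1 : 0 < 1 - c ^ 2 := by nlinarith
  have hs : 0 < √(1 - c ^ 2) := Real.sqrt_pos.2 h1
  have hss : √(1 - c ^ 2) * √(1 - c ^ 2) = 1 - c ^ 2 := Real.mul_self_sqrt h1.le
  set s := √(1 - c ^ 2) with hsdef
  have hgg := inner_self_eq_one (norm_coe g)
  have hhh := inner_self_eq_one (norm_coe h)
  have hq : ‖s⁻¹ • ((g : E3) + c • (h : E3))‖ = 1 := by
    rw [← sq_eq_sq₀ (norm_nonneg _) zero_le_one, ← real_inner_self_eq_norm_sq]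
    simp only [real_inner_smul_left, real_inner_smul_right, inner_add_left, inner_add_right, hgg,
      hhh, hgh, hhg]
    field_simp
    rw [sq, sq s, hss]; ring
  have hp : ‖s⁻¹ • ((h : E3) + c • (g : E3))‖ = 1 := by
    rw [← sq_eq_sq₀ (norm_nonneg _) zero_le_one, ← real_inner_self_eq_norm_sq]
    simp only [real_inner_smul_left, real_inner_smul_right, inner_add_left, inner_add_right, hgg,
      hhh, hgh, hhg]
    field_simp
    rw [sq, sq s, hss]; ring
  refine ⟨⟨_, mem_sphere_zero_iff_norm.2 hp⟩, ⟨_, mem_sphere_zero_iff_norm.2 hq⟩, ?_, ?_, ?_, ?_, ?_⟩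
  · rw [← hC.2.1.coe_mem_cone_iff]
    exact hC.2.1.smul_mem_cone (hd.foot_mem_cone hc0.le hC hh hg hhg) (inv_nonneg.2 hs.le)
  · rw [← hC.2.1.coe_mem_cone_iff]
    exact hC.2.1.smul_mem_cone (hd.foot_mem_cone hc0.le hC hg hh hgh) (inv_nonneg.2 hs.le)
  · simp only [real_inner_smul_left, real_inner_smul_right, inner_add_left, inner_add_right, hgg,
      hhh, hgh, hhg]
    field_simp
    rw [sq s, hss]; ring
  · show s⁻¹ • ((g : E3) + c • (h : E3)) - c • s⁻¹ • ((h : E3) + c • (g : E3)) = s • (g : E3)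
    have : s⁻¹ • ((g : E3) + c • (h : E3)) - c • s⁻¹ • ((h : E3) + c • (g : E3))
        = (s⁻¹ * (1 - c ^ 2)) • (g : E3) := by module
    rw [this, ← hss, inv_mul_cancel_left₀ hs.ne']
  · show s⁻¹ • ((h : E3) + c • (g : E3)) - c • s⁻¹ • ((g : E3) + c • (h : E3)) = s • (h : E3)
    have : s⁻¹ • ((h : E3) + c • (g : E3)) - c • s⁻¹ • ((g : E3) + c • (h : E3))
        = (s⁻¹ * (1 - c ^ 2)) • (h : E3) := by module
    rw [this, ← hss, inv_mul_cancel_left₀ hs.ne']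

/-! ### Truncating a reduced body -/

lemma isConvexBody_inter {V : Set S2} (hV : IsConvexBody V) {m : E3} {x₀ : S2}
    (hx₀ : x₀ ∈ interior V) (hm : 0 < ⟪m, (x₀ : E3)⟫) :
    IsConvexBody {x ∈ V | 0 ≤ ⟪m, (x : E3)⟫} := by
  have hcont : Continuous fun x : S2 => ⟪m, (x : E3)⟫ := continuous_const.inner continuous_subtype_val
  refine ⟨hV.1.inter (isClosed_le continuous_const hcont), ?_, x₀, ?_⟩
  · rintro a ⟨ha, ha'⟩ b ⟨hb, hb'⟩
    refine ⟨(hV.2.1 a ha b hb).1, fun x hx => ⟨(hV.2.1 a ha b hb).2 hx, ?_⟩⟩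
    obtain ⟨s, t, hs, ht, hx⟩ := hx
    rw [hx, inner_add_right, real_inner_smul_right, real_inner_smul_right]
    exact add_nonneg (mul_nonneg hs ha') (mul_nonneg ht hb')
  · refine mem_interior.2 ⟨interior V ∩ {x | 0 < ⟪m, (x : E3)⟫}, ?_,
      isOpen_interior.inter (isOpen_lt continuous_const hcont), hx₀, hm⟩
    rintro x ⟨hx, hx'⟩
    exact ⟨interior_subset hx, le_of_lt hx'⟩

/-- A foot of the optimal lune of a truncated body lies on the truncating great circle. -/
lemma foot_on_cut {V : Set S2} (hV : IsConvex V) {m : E3}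
    {g p : S2} (hg : Supports (g : E3) {x ∈ V | 0 ≤ ⟪m, (x : E3)⟫}) (hgV : ¬ Supports (g : E3) V)
    (hp : p ∈ {x ∈ V | 0 ≤ ⟪m, (x : E3)⟫}) (hgp : ⟪(g : E3), (p : E3)⟫ = 0) : ⟪m, (p : E3)⟫ = 0 := by
  refine le_antisymm (le_of_not_gt fun hpos => hgV fun x hx => ?_) hp.2
  -- If p were strictly inside the cut, the arc from p to a point x of V with ⟪g, x⟫ < 0 would meet
  -- the cut in a point of the truncated body where g is negative.
  by_contra hneg
  push Not at hneg
  have hmx : ⟪m, (x : E3)⟫ < 0 := by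
    by_contra h
    push Not at h
    exact absurd (hg x ⟨hx, h⟩) (not_le.2 hneg)
  obtain ⟨hne, hmem⟩ := hV.add_smul_mem hp.1 hx (neg_pos.2 hmx) hpos
  have hmem' : direction _ hne ∈ {x ∈ V | 0 ≤ ⟪m, (x : E3)⟫} := by
    refine ⟨hmem, (direction_inner_pos_iff hne).2 ?_⟩
    rw [inner_add_right, real_inner_smul_right, real_inner_smul_right]
    linarith
  have := (direction_inner_pos_iff hne).1 (hg _ hmem')
  rw [inner_add_right, real_inner_smul_right, real_inner_smul_right, hgp] at this
  nlinarith

lemma inStrip_of_eq {c s : ℝ} (hs : 0 ≤ s) {p q g h x : E3} (h1 : q - c • p = s • g)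
    (h2 : p - c • q = s • h) (hg : 0 ≤ ⟪g, x⟫) (hh : 0 ≤ ⟪h, x⟫) : InStrip c p q x := by
  have e1 := congrArg (fun v => ⟪v, x⟫) h1
  have e2 := congrArg (fun v => ⟪v, x⟫) h2
  simp only [inner_sub_left, real_inner_smul_left] at e1 e2
  exact ⟨by linarith [mul_nonneg hs hg], by linarith [mul_nonneg hs hh]⟩

/-- Truncation makes the thickness drop, so the two hemispheres of an optimal lune of the truncated
body cannot both contain V. The one that fails has its foot on the cut; this foot is called p. -/
lemma IsReducedBody.cut {V : Set S2} (hV : IsReducedBody V) (h0 : 0 < thickness V)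
    (h1 : thickness V < Real.pi / 2) {m : E3} {x₀ e : S2} (hx₀ : x₀ ∈ interior V)
    (hm : 0 < ⟪m, (x₀ : E3)⟫) (he : e ∈ V) (hme : ⟪m, (e : E3)⟫ < 0) :
    ∃ (c : ℝ) (p q : S2), Real.cos (thickness V) < c ∧ c < 1 ∧ p ∈ V ∧ q ∈ V ∧
      ⟪(p : E3), (q : E3)⟫ = c ∧ ⟪m, (p : E3)⟫ = 0 ∧
      (∀ x ∈ V, 0 ≤ ⟪m, (x : E3)⟫ → InStrip c p q x) ∧
      DualBound c {x ∈ V | 0 ≤ ⟪m, (x : E3)⟫} := by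
  have hR := isConvexBody_inter hV.1 hx₀ hm
  set R := {x ∈ V | 0 ≤ ⟪m, (x : E3)⟫} with hRdef
  have hRV : R ⊆ V := fun x hx => hx.1
  have hlt : thickness R < thickness V :=
    hV.2 R hR ⟨hRV, fun h => absurd (h he).2 (not_le.2 hme)⟩
  have hpair := exists_lunePair_of_thickness_pos h0
  obtain ⟨-, -, -, -, -, -, -, hdV⟩ := exists_optimal_lune hV.1 hpair
  obtain ⟨g, h, hg, hh, hl, heq, hc1, hd⟩ := exists_optimal_lune hR (by
    obtain ⟨g, h, hgh, hg, hh⟩ := hpair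
    exact ⟨g, h, hgh, hg.mono hRV, hh.mono hRV⟩)
  have hc : Real.cos (thickness V) < Real.cos (thickness R) :=
    Real.cos_lt_cos_of_nonneg_of_le_pi_div_two (thickness_nonneg R) h1.le hlt
  have hc0 : 0 < Real.cos (thickness R) :=
    (Real.cos_pos_of_mem_Ioo ⟨by linarith, h1⟩).trans hc
  obtain ⟨p, q, hp, hq, hpq, e1, e2⟩ := hd.exists_feet hc0 hc1 hR hg hh heq
  set c := Real.cos (thickness R) with hcdef
  have hs : 0 < √(1 - c ^ 2) := Real.sqrt_pos.2 (by nlinarith)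
  have hqp : ⟪(q : E3), (p : E3)⟫ = c := by rw [real_inner_comm]; exact hpq
  have hgp : ⟪(g : E3), (p : E3)⟫ = 0 := by
    have := congrArg (fun v => ⟪v, (p : E3)⟫) e1
    simp only [inner_sub_left, real_inner_smul_left, hqp, inner_self_eq_one (norm_coe p)] at this
    rw [mul_one, sub_self, eq_comm, mul_eq_zero] at this
    exact this.resolve_left hs.ne'
  have hhq : ⟪(h : E3), (q : E3)⟫ = 0 := by
    have := congrArg (fun v => ⟪v, (q : E3)⟫) e2
    simp only [inner_sub_left, real_inner_smul_left, hpq, inner_self_eq_one (norm_coe q)] at this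
    rw [mul_one, sub_self, eq_comm, mul_eq_zero] at this
    exact this.resolve_left hs.ne'
  by_cases hgV : Supports (g : E3) V
  · by_cases hhV : Supports (h : E3) V
    · have := hdV g h hgV hhV
      rw [norm_coe, norm_coe, heq] at this
      linarith
    · refine ⟨c, q, p, hc, hc1, hRV hq, hRV hp, hqp, foot_on_cut hV.1.2.1 hh hhV hq hhq, ?_, hd⟩
      exact fun x hx hx' => inStrip_of_eq hs.le e2 e1 (hh x ⟨hx, hx'⟩) (hg x ⟨hx, hx'⟩)
  · refine ⟨c, p, q, hc, hc1, hRV hp, hRV hq, hpq, foot_on_cut hV.1.2.1 hg hgV hp hgp, ?_, hd⟩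
    exact fun x hx hx' => inStrip_of_eq hs.le e1 e2 (hg x ⟨hx, hx'⟩) (hh x ⟨hx, hx'⟩)

/-- A lune between feet is no wider than the optimal one. -/
lemma DualBound.le_of_inStrip {c c' : ℝ} (hc' : 0 < c') (hc1 : c' < 1) {C : Set S2}
    (hd : DualBound c C) {p q : S2} (hpq : ⟪(p : E3), (q : E3)⟫ = c')
    (hs : ∀ x ∈ C, InStrip c' p q x) : c' ≤ c := by
  have hqp : ⟪(q : E3), (p : E3)⟫ = c' := by rw [real_inner_comm]; exact hpq
  have hpos : 0 < 1 - c' ^ 2 := by nlinarith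
  have h1 := hd (farNormal c' q p) (farNormal c' p q)
    (fun x hx => by rw [farNormal_inner]; linarith [(hs x hx).1])
    (fun x hx => by rw [farNormal_inner]; linarith [(hs x hx).2])
  have n1 : ‖farNormal c' (p : E3) q‖ ^ 2 = 1 - c' ^ 2 := by
    rw [← real_inner_self_eq_norm_sq, farNormal_inner_self (norm_coe p) (norm_coe q) hpq]
  have n2 : ‖farNormal c' (q : E3) p‖ ^ 2 = 1 - c' ^ 2 := by
    rw [← real_inner_self_eq_norm_sq, farNormal_inner_self (norm_coe q) (norm_coe p) hqp]
  have n3 : ‖farNormal c' (q : E3) p‖ = ‖farNormal c' (p : E3) q‖ :=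
    (sq_eq_sq₀ (norm_nonneg _) (norm_nonneg _)).1 (n2.trans n1.symm)
  rw [n3, ← sq, n1, farNormal_inner_swap (norm_coe p) (norm_coe q) hpq] at h1
  exact le_of_mul_le_mul_right (by linarith) hpos

/-- Every vertex of a reduced polygon is the center of a semicircle bounding a lune of minimal
thickness. -/
lemma IsReducedBody.exists_foot {V : Set S2} (hV : IsReducedBody V) (h0 : 0 < thickness V)
    (h1 : thickness V < Real.pi / 2) {e : S2} (he : e ∈ V) {m k : E3} (hm0 : m ≠ 0)
    (hme : ⟪m, (e : E3)⟫ = 0) (hm : ∀ x ∈ V, x ≠ e → 0 < ⟪m, (x : E3)⟫)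
    (hk : ∀ x ∈ V, 0 < ⟪k, (x : E3)⟫) :
    ∃ q ∈ V, ⟪(e : E3), (q : E3)⟫ = Real.cos (thickness V) ∧
      ∀ x ∈ V, InStrip (Real.cos (thickness V)) e q x := by
  set c := Real.cos (thickness V) with hcdef
  have hc : 0 < c := Real.cos_pos_of_mem_Ioo ⟨by linarith, h1⟩
  obtain ⟨x₀, hx₀⟩ := hV.1.2.2
  have hms : Supports m V := fun x hx => by
    rcases eq_or_ne x e with rfl | hxe
    · exact hme.ge
    · exact (hm x hx hxe).le
  have hmx₀ : 0 < ⟪m, (x₀ : E3)⟫ := hms.pos_of_interior hm0 hx₀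
  have hkx₀ := hk x₀ (interior_subset hx₀)
  -- The cuts m - ε k tend to m and cut off e. The factor in front keeps the interior point x₀
  -- strictly on the remaining side.
  set ε : ℕ → ℝ := fun n => ⟪m, (x₀ : E3)⟫ / (2 * ⟪k, (x₀ : E3)⟫) * (1 / ((n : ℝ) + 1)) with hε
  have hA : 0 < ⟪m, (x₀ : E3)⟫ / (2 * ⟪k, (x₀ : E3)⟫) := by positivity
  have hεpos : ∀ n, 0 < ε n := fun n => mul_pos hA Nat.one_div_pos_of_nat
  have hεle : ∀ n, ε n ≤ ⟪m, (x₀ : E3)⟫ / (2 * ⟪k, (x₀ : E3)⟫) := fun n =>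
    mul_le_of_le_one_right hA.le (by
      rw [div_le_one (by positivity)]; linarith [Nat.cast_nonneg (α := ℝ) n])
  have hε0 : ε 0 = ⟪m, (x₀ : E3)⟫ / (2 * ⟪k, (x₀ : E3)⟫) := by simp [hε]
  have hεlim : Tendsto ε atTop (𝓝 0) := by
    have := (tendsto_one_div_add_atTop_nhds_zero_nat (𝕜 := ℝ)).const_mul
      (⟪m, (x₀ : E3)⟫ / (2 * ⟪k, (x₀ : E3)⟫))
    rwa [mul_zero] at this
  have hinner : ∀ n (x : E3), ⟪m - ε n • k, x⟫ = ⟪m, x⟫ - ε n * ⟪k, x⟫ := fun n x => by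
    rw [inner_sub_left, real_inner_smul_left]
  have hstep := fun n => hV.cut (m := m - ε n • k) h0 h1 hx₀ (by
    rw [hinner]
    have h2 := mul_le_mul_of_nonneg_right (hεle n) hkx₀.le
    have h3 : ⟪m, (x₀ : E3)⟫ / (2 * ⟪k, (x₀ : E3)⟫) * ⟪k, (x₀ : E3)⟫ = ⟪m, (x₀ : E3)⟫ / 2 := by
      field_simp
    linarith) he (by
    rw [hinner, hme]
    linarith [mul_pos (hεpos n) (hk e he)])
  choose a p q hca ha1 hp hq hpq hmp hstrip hdual using hstep
  -- The first cut removes most, so its truncated body is the thinnest. This keeps the limit of the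
  -- cosines strictly below 1 and the limiting lune nondegenerate.
  have hale : ∀ n, a n ≤ a 0 := by
    intro n
    refine (hdual 0).le_of_inStrip (hc.trans (hca n)) (ha1 n) (hpq n) fun x hx => ?_
    refine hstrip n x hx.1 ?_
    have h2 := hx.2
    rw [hinner] at h2 ⊢
    have := mul_le_mul_of_nonneg_right (hεle n) (hk x hx.1).le
    rw [hε0] at h2
    linarith
  obtain ⟨⟨p', q'⟩, -, φ, hφ, hlim⟩ := (isCompact_univ (X := S2 × S2)).tendsto_subseq
    (x := fun n => (p n, q n)) fun _ => Set.mem_univ _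
  have hplim : Tendsto (fun n => (p (φ n) : E3)) atTop (𝓝 (p' : E3)) :=
    (continuous_subtype_val.tendsto _).comp ((continuous_fst.tendsto _).comp hlim)
  have hqlim : Tendsto (fun n => (q (φ n) : E3)) atTop (𝓝 (q' : E3)) :=
    (continuous_subtype_val.tendsto _).comp ((continuous_snd.tendsto _).comp hlim)
  have hp'V : p' ∈ V := hV.1.1.mem_of_tendsto ((continuous_fst.tendsto _).comp hlim)
    (Eventually.of_forall fun n => hp _)
  have hq'V : q' ∈ V := hV.1.1.mem_of_tendsto ((continuous_snd.tendsto _).comp hlim)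
    (Eventually.of_forall fun n => hq _)
  have halim : Tendsto (fun n => a (φ n)) atTop (𝓝 ⟪(p' : E3), (q' : E3)⟫) := by
    have := hplim.inner (𝕜 := ℝ) hqlim
    simpa only [hpq] using this
  have hεφ : Tendsto (fun n => ε (φ n)) atTop (𝓝 0) := hεlim.comp hφ.tendsto_atTop
  -- The limit foot lies on m = 0, which meets V only in e.
  have hp'e : p' = e := by
    by_contra hne
    have h2 : Tendsto (fun n => ⟪m - ε (φ n) • k, (p (φ n) : E3)⟫) atTop
        (𝓝 ⟪m - (0 : ℝ) • k, (p' : E3)⟫) :=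
      (tendsto_const_nhds.sub (hεφ.smul tendsto_const_nhds)).inner hplim
    simp only [hmp] at h2
    have h3 := tendsto_nhds_unique h2 tendsto_const_nhds
    rw [zero_smul, sub_zero] at h3
    exact (hm p' hp'V hne).ne' h3
  subst hp'e
  set a' := ⟪(p' : E3), (q' : E3)⟫ with ha'
  have hca' : c ≤ a' := ge_of_tendsto halim (Eventually.of_forall fun n => (hca _).le)
  have ha'1 : a' < 1 :=
    (le_of_tendsto halim (Eventually.of_forall fun n => hale _)).trans_lt (ha1 0)
  have hst : ∀ x ∈ V, InStrip a' p' q' x := by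
    intro x hx
    -- Every other point of V survives all late cuts, so its strip conditions pass to the limit; at
    -- p' they hold trivially.
    rcases eq_or_ne x p' with rfl | hxe
    · rw [InStrip, inner_self_eq_one (norm_coe x), real_inner_comm, ← ha']
      exact ⟨by linarith, by nlinarith⟩
    · have hev : ∀ᶠ n in atTop, InStrip (a (φ n)) (p (φ n)) (q (φ n)) (x : E3) := by
        have h2 : ∀ᶠ n in atTop, ε (φ n) < ⟪m, (x : E3)⟫ / ⟪k, (x : E3)⟫ :=
          hεφ.eventually (gt_mem_nhds (div_pos (hm x hx hxe) (hk x hx)))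
        filter_upwards [h2] with n hn
        refine hstrip _ x hx ?_
        rw [hinner]
        rw [lt_div_iff₀ (hk x hx)] at hn
        linarith
      have l1 : Tendsto (fun n => ⟪(p (φ n) : E3), (x : E3)⟫) atTop (𝓝 ⟪(p' : E3), (x : E3)⟫) :=
        hplim.inner tendsto_const_nhds
      have l2 : Tendsto (fun n => ⟪(q (φ n) : E3), (x : E3)⟫) atTop (𝓝 ⟪(q' : E3), (x : E3)⟫) :=
        hqlim.inner tendsto_const_nhds
      exact ⟨le_of_tendsto_of_tendsto (halim.mul l1) l2 (hev.mono fun n h => h.1),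
        le_of_tendsto_of_tendsto (halim.mul l2) l1 (hev.mono fun n h => h.2)⟩
  obtain ⟨-, -, -, -, -, -, -, hdV⟩ :=
    exists_optimal_lune hV.1 (exists_lunePair_of_thickness_pos h0)
  have heq : a' = c := le_antisymm (hdV.le_of_inStrip (hc.trans_le hca') ha'1 ha'.symm hst) hca'
  rw [heq] at hst
  exact ⟨q', hq'V, heq, hst⟩

/-! ### Exposed vertices and their cyclic order -/

lemma span_nonneg {y : E3} {A : Set E3} (h : ∀ a ∈ A, 0 ≤ ⟪y, a⟫) {x : E3}
    (hx : x ∈ Submodule.span ℝ≥0 A) : 0 ≤ ⟪y, x⟫ := (span_face h hx).1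

lemma span_pos {y : E3} {A : Set E3} (h : ∀ a ∈ A, 0 < ⟪y, a⟫) {x : E3}
    (hx : x ∈ Submodule.span ℝ≥0 A) (hx0 : x ≠ 0) : 0 < ⟪y, x⟫ := by
  obtain ⟨h1, h2⟩ := span_face (fun a ha => (h a ha).le) hx
  refine lt_of_le_of_ne h1 fun h3 => hx0 ?_
  have h4 := h2 h3.symm
  have h5 : {v ∈ A | ⟪y, v⟫ = 0} = ∅ := by
    rw [Set.eq_empty_iff_forall_notMem]
    rintro a ⟨ha, ha'⟩
    exact (h a ha).ne' ha'
  rwa [h5, Submodule.span_empty, Submodule.mem_bot] at h4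

lemma convex_span (A : Set E3) : Convex ℝ (Submodule.span ℝ≥0 A : Set E3) := by
  intro a ha b hb s t hs ht _
  exact Submodule.add_mem _ (smul_mem_span ha hs) (smul_mem_span hb ht)

lemma exists_inner_lt_of_notMem {ι : Type*} [Finite ι] (f : ι → E3) {b : E3}
    (hb : b ∉ convexHull ℝ (Set.range f)) : ∃ y : E3, ∀ i, ⟪y, b⟫ < ⟪y, f i⟫ := by
  have hcpt : IsCompact (convexHull ℝ (Set.range f)) := 
    (Set.finite_range f).isCompact_convexHull (𝕜 := ℝ)
  obtain ⟨F, u, h1, h2⟩ := geometric_hahn_banach_point_closed (convex_convexHull ℝ _)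
    hcpt.isClosed hb
  have hrepr : ∀ x, ⟪(InnerProductSpace.toDual ℝ E3).symm F, x⟫ = F x := fun x =>
    InnerProductSpace.toDual_symm_apply
  refine ⟨(InnerProductSpace.toDual ℝ E3).symm F, fun i => ?_⟩
  rw [hrepr, hrepr]
  exact h1.trans (h2 _ (subset_convexHull ℝ _ ⟨i, rfl⟩))

/-- Finitely many points of a convex set lie in an open half-space. -/
lemma exists_pos_functional {ι : Type*} [Finite ι] (v : ι → S2) {D : Set S2} (hD : IsConvex D)
    (hv : Set.range v ⊆ D) : ∃ y : E3, ∀ i, 0 < ⟪y, (v i : E3)⟫ := by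
  have hconv : Convex ℝ {z : E3 | z ∈ hD.cone ∧ z ≠ 0} := by
    rintro a ⟨ha, ha0⟩ b ⟨hb, hb0⟩ s t hs ht hst
    refine ⟨hD.cone.add_mem (hD.smul_mem_cone ha hs) (hD.smul_mem_cone hb ht), fun h => ?_⟩
    have h1 : s • a = 0 := by
      refine hD.cone_pointed (hD.smul_mem_cone ha hs) ?_
      rw [eq_neg_of_add_eq_zero_left h, neg_neg]
      exact hD.smul_mem_cone hb ht
    have h2 : t • b = 0 := by rwa [h1, zero_add] at h
    rw [(smul_eq_zero.1 h1).resolve_right ha0, (smul_eq_zero.1 h2).resolve_right hb0] at hst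
    norm_num at hst
  have h0 : (0 : E3) ∉ convexHull ℝ (Set.range fun i => (v i : E3)) := by
    intro h
    refine (convexHull_min ?_ hconv h).2 rfl
    rintro _ ⟨i, rfl⟩
    exact ⟨hD.coe_mem_cone_iff.2 (hv ⟨i, rfl⟩), coe_ne_zero _⟩
  obtain ⟨y, hy⟩ := exists_inner_lt_of_notMem _ h0
  exact ⟨y, fun i => by simpa using hy i⟩

/-- A vertex of a cone is exposed. -/
lemma exists_vertex_support {ι : Type*} [Finite ι] (v : ι → E3) {y : E3}
    (hy : ∀ i, 0 < ⟪y, v i⟫) (i : ι) (hi : v i ∉ Submodule.span ℝ≥0 (v '' {j | j ≠ i})) :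
    ∃ m : E3, ⟪m, v i⟫ = 0 ∧ ∀ j, j ≠ i → 0 < ⟪m, v j⟫ := by
  -- Central projection to the plane ⟪y, ·⟫ = 1 turns the cone into a convex polygon, where the
  -- vertex can be separated from the others.
  have hb : (⟪y, v i⟫)⁻¹ • v i ∉
      convexHull ℝ (Set.range fun j : {j // j ≠ i} => (⟪y, v j⟫)⁻¹ • v j) := by
    intro h
    have h1 := convexHull_min (t := (Submodule.span ℝ≥0 (v '' {j | j ≠ i}) : Set E3)) (by
      rintro _ ⟨⟨j, hj⟩, rfl⟩
      have hmem : v j ∈ v '' {j | j ≠ i} := ⟨j, hj, rfl⟩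
      exact smul_mem_span (Submodule.subset_span hmem) (inv_nonneg.2 (hy j).le))
      (convex_span _) h
    have h2 := smul_mem_span h1 (hy i).le
    rw [smul_smul, mul_inv_cancel₀ (hy i).ne', one_smul] at h2
    exact hi h2
  obtain ⟨z, hz⟩ := exists_inner_lt_of_notMem _ hb
  refine ⟨z - ⟪z, (⟪y, v i⟫)⁻¹ • v i⟫ • y, ?_, fun j hj => ?_⟩
  · rw [inner_sub_left, real_inner_smul_left, real_inner_smul_right]
    field_simp [(hy i).ne']
    ring
  · have h1 := hz ⟨j, hj⟩
    rw [inner_sub_left, real_inner_smul_left]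
    have h2 := mul_lt_mul_of_pos_right h1 (hy j)
    simp only [real_inner_smul_right] at h2 ⊢
    rw [mul_comm ((⟪y, v j⟫)⁻¹), mul_assoc _ ((⟪y, v j⟫)⁻¹), inv_mul_cancel₀ (hy j).ne'] at h2
    linarith

lemma inner_self_mul_det3 {b m : E3} (hb : ‖b‖ = 1) (hm : ⟪m, b⟫ = 0) (x y : E3) :
    ⟪m, m⟫ * det3 b x y = ⟪m, x⟫ * det3 b m y - ⟪m, y⟫ * det3 b m x := by
  have hbb := inner_self_eq_one hb
  have key : ⟪b, b⟫ * (⟪m, m⟫ * det3 b x y) - ⟪m, b⟫ * (⟪m, b⟫ * det3 b x y) =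
      ⟪b, b⟫ * (⟪m, x⟫ * det3 b m y - ⟪m, y⟫ * det3 b m x) -
        ⟪m, b⟫ * (⟪b, x⟫ * det3 b m y - ⟪b, y⟫ * det3 b m x) := by
    simp only [det3, inner_eq_sum]; ring
  rw [hm, hbb] at key
  linarith

lemma mem_span_pair_of_smul_eq {A : Set E3} {x y b : E3} {r s t : ℝ} (hr : 0 < r) (hs : 0 ≤ s)
    (ht : 0 ≤ t) (hx : x ∈ A) (hb : b ∈ A) (h : r • y = s • x + t • b) :
    y ∈ Submodule.span ℝ≥0 A := by
  have h1 : y = r⁻¹ • (s • x + t • b) := by rw [← h, inv_smul_smul₀ hr.ne']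
  rw [h1]
  exact smul_mem_span (Submodule.add_mem _ (smul_mem_span (Submodule.subset_span hx) hs)
    (smul_mem_span (Submodule.subset_span hb) ht)) (inv_nonneg.2 hr.le)

/-- The vertices of a cone can be put in cyclic order. -/
lemma exists_cyclic_order {k : ℕ} (v : Fin k → E3)
    (hv : ∀ i, v i ∉ Submodule.span ℝ≥0 (v '' {j | j ≠ i})) (i₀ : Fin k) (hn : ‖v i₀‖ = 1) {m : E3}
    (hm0 : m ≠ 0) (hm : ⟪m, v i₀⟫ = 0) (hpos : ∀ j, j ≠ i₀ → 0 < ⟪m, v j⟫) :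
    ∃ σ : Equiv.Perm (Fin k), ∀ i j l, i < j → j < l →
      0 < det3 (v (σ i)) (v (σ j)) (v (σ l)) := by
  classical
  have hmm : 0 < ⟪m, m⟫ := real_inner_self_pos.2 hm0
  set b := v i₀ with hbdef
  -- The slope of v j as seen from b; sorting by slope orders the remaining vertices around b.
  set ρ : Fin k → ℝ := fun j => det3 b m (v j) / ⟪m, v j⟫ with hρ
  have hsign : ∀ i j, i ≠ i₀ → j ≠ i₀ →
      ⟪m, m⟫ * det3 b (v i) (v j) = ⟪m, v i⟫ * ⟪m, v j⟫ * (ρ j - ρ i) := by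
    intro i j hi hj
    rw [inner_self_mul_det3 hn hm]
    have := (hpos i hi).ne'
    have := (hpos j hj).ne'
    simp only [hρ]
    field_simp
  have hne : ∀ i j, i ≠ i₀ → j ≠ i₀ → i ≠ j → det3 b (v i) (v j) ≠ 0 := by
    intro i j hi hj hij h0
    -- Two vertices of equal slope satisfy a linear relation with b, and for either sign of its
    -- coefficient one of them is in the cone of the other and b.
    have hrel : ∃ τ : ℝ, τ • b + ⟪m, v j⟫ • v i - ⟪m, v i⟫ • v j = 0 := by
      have hbb := inner_self_eq_one hn
      have hl : ∀ x, det3 b x (cross3 m b) = -⟪m, x⟫ := by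
        intro x
        have key : det3 b x (cross3 m b) = ⟪m, b⟫ * ⟪b, x⟫ - ⟪b, b⟫ * ⟪m, x⟫ := by
          simp only [det3, inner_eq_sum, cross3_zero, cross3_one, cross3_two]; ring
        rw [key, hm, hbb]; ring
      have := det3_relation b (v i) (v j) (cross3 m b)
      rw [h0, hl, hl, zero_smul, sub_zero] at this
      refine ⟨det3 (v i) (v j) (cross3 m b), Eq.trans ?_ this⟩
      module
    obtain ⟨τ, hτ⟩ := hrel
    rcases le_total 0 τ with h | h
    · apply hv j
      refine mem_span_pair_of_smul_eq (hpos i hi) (hpos j hj).le h ⟨i, hij, rfl⟩ ⟨i₀, hj.symm, rfl⟩ ?_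
      rw [← sub_eq_zero, ← neg_eq_zero, ← hτ]; module
    · apply hv i
      refine mem_span_pair_of_smul_eq (hpos j hj) (hpos i hi).le (neg_nonneg.2 h) ⟨j, hij.symm, rfl⟩
        ⟨i₀, hi.symm, rfl⟩ ?_
      rw [← sub_eq_zero, ← hτ]; module
  -- The base vertex has no slope and is placed first.
  set f : Fin k → WithBot ℝ := fun j => if j = i₀ then ⊥ else (ρ j : WithBot ℝ) with hf
  have hfinj : Function.Injective f := by
    intro i j hij
    by_contra hne'
    simp only [hf] at hij
    split_ifs at hij with h1 h2 h2
    · exact hne' (h1.trans h2.symm)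
    · exact WithBot.bot_ne_coe hij
    · exact WithBot.coe_ne_bot hij
    · have h3 := hsign i j h1 h2
      rw [WithBot.coe_injective hij, sub_self, mul_zero] at h3
      exact hne i j h1 h2 hne' ((mul_eq_zero.1 h3).resolve_left hmm.ne')
  set σ := Tuple.sort f with hσ
  have hmono : StrictMono (f ∘ σ) :=
    (Tuple.monotone_sort f).strictMono_of_injective (hfinj.comp σ.injective)
  have hbase : ∀ i j, σ i = i₀ → i ≠ j → i < j := by
    intro i j hi hij
    have h1 : f (σ i) = ⊥ := by simp [hf, hi]
    refine hmono.lt_iff_lt.1 ?_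
    show f (σ i) < f (σ j)
    rw [h1, bot_lt_iff_ne_bot, ← h1]
    exact fun h => hij (σ.injective (hfinj h)).symm
  have hdet : ∀ i j, i < j → σ i ≠ i₀ → σ j ≠ i₀ → 0 < det3 b (v (σ i)) (v (σ j)) := by
    intro i j hij hi hj
    have h1 : f (σ i) < f (σ j) := hmono hij
    simp only [hf, if_neg hi, if_neg hj, WithBot.coe_lt_coe] at h1
    have h2 := hsign _ _ hi hj
    have h3 : 0 < ⟪m, v (σ i)⟫ * ⟪m, v (σ j)⟫ * (ρ (σ j) - ρ (σ i)) :=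
      mul_pos (mul_pos (hpos _ hi) (hpos _ hj)) (sub_pos.2 h1)
    rw [← h2] at h3
    exact pos_of_mul_pos_right h3 hmm.le
  refine ⟨σ, fun i j l hij hjl => ?_⟩
  have hj : σ j ≠ i₀ := fun h => (lt_asymm hij) (hbase j i h hij.ne')
  have hl : σ l ≠ i₀ := fun h => (lt_asymm hjl) (hbase l j h hjl.ne')
  by_cases hi : σ i = i₀
  · rw [hi]
    exact hdet j l hjl hj hl
  -- With the wrong sign of the determinant, the four-vector relation writes the middle vertex as a
  -- nonnegative combination of its neighbors and b.
  · by_contra hcon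
    push Not at hcon
    apply hv (σ j)
    have hrel := det3_relation b (v (σ i)) (v (σ j)) (v (σ l))
    have d1 := hdet i l (hij.trans hjl) hi hl
    have d2 := hdet j l hjl hj hl
    have d3 := hdet i j hij hi hj
    have h1 : v (σ j) = (det3 b (v (σ i)) (v (σ l)))⁻¹ • (det3 b (v (σ j)) (v (σ l)) • v (σ i) +
        det3 b (v (σ i)) (v (σ j)) • v (σ l) +
        (-det3 (v (σ i)) (v (σ j)) (v (σ l))) • b) := by
      rw [eq_inv_smul_iff₀ d1.ne', ← sub_eq_zero, ← hrel]; module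
    have hmem : ∀ x, x ≠ σ j → v x ∈ Submodule.span ℝ≥0 (v '' {l | l ≠ σ j}) := fun x hx =>
      Submodule.subset_span ⟨x, hx, rfl⟩
    rw [h1]
    exact smul_mem_span (Submodule.add_mem _ (Submodule.add_mem _
      (smul_mem_span (hmem _ (σ.injective.ne hij.ne)) d2.le)
      (smul_mem_span (hmem _ (σ.injective.ne hjl.ne')) d3.le))
      (smul_mem_span (hmem _ hj.symm) (neg_nonneg.2 hcon))) (inv_nonneg.2 d1.le)

/-- The representative of an integer modulo `k`. -/
def finMod (k : ℕ) (hk : 0 < k) (z : ℤ) : Fin k :=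
  ⟨(z % k).toNat, by
    have h1 := Int.emod_nonneg z (b := (k : ℤ)) (by omega)
    have h2 := Int.emod_lt_of_pos z (b := (k : ℤ)) (by omega)
    omega⟩

lemma finMod_periodic (k : ℕ) (hk : 0 < k) : Function.Periodic (finMod k hk) k := by
  intro z
  simp [finMod]

lemma finMod_val {k : ℕ} (hk : 0 < k) {z : ℤ} (h0 : 0 ≤ z) (h1 : z < k) :
    ((finMod k hk z : ℕ) : ℤ) = z := by
  simp only [finMod, Int.emod_eq_of_lt h0 h1]
  omega

lemma finMod_coe {k : ℕ} (hk : 0 < k) (i : Fin k) : finMod k hk (i : ℕ) = i := by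
  apply Fin.ext
  have := finMod_val hk (z := (i : ℕ)) (by omega) (by omega)
  omega

/-- After a shift i lies in the fundamental period; indices that pass its end are brought back,
which permutes the arguments cyclically and preserves the determinant. -/
lemma det3_periodic_pos {k : ℕ} (hk : 0 < k) (u : Fin k → E3)
    (hu : ∀ i j l, i < j → j < l → 0 < det3 (u i) (u j) (u l)) (i j l : ℤ) (hij : i < j)
    (hjl : j < l) (hli : l < i + k) :
    0 < det3 (u (finMod k hk i)) (u (finMod k hk j)) (u (finMod k hk l)) := by
  have hper := finMod_periodic k hk
  wlog hi : 0 ≤ i ∧ i < k generalizing i j l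
  · have h1 := Int.emod_nonneg i (b := (k : ℤ)) (by omega)
    have h2 := Int.emod_lt_of_pos i (b := (k : ℤ)) (by omega)
    have h3 := Int.emod_add_mul_ediv i k
    have h4 : ∀ z : ℤ, finMod k hk (z - k * (i / k)) = finMod k hk z := by
      intro z
      have := hper.sub_zsmul_eq (x := z) (i / k)
      rwa [smul_eq_mul, mul_comm] at this
    have := this (i - k * (i / k)) (j - k * (i / k)) (l - k * (i / k)) (by omega) (by omega)
      (by omega) ⟨by omega, by omega⟩
    rwa [h4, h4, h4] at this
  obtain ⟨h0, h1⟩ := hi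
  have hsub : ∀ z : ℤ, finMod k hk (z - k) = finMod k hk z := fun z => hper.sub_eq z
  have hlt : ∀ x y : ℤ, 0 ≤ x → x < y → y < k → finMod k hk x < finMod k hk y := by
    intro x y hx hxy hy
    have e1 := finMod_val hk hx (hxy.trans hy)
    have e2 := finMod_val hk (hx.trans hxy.le) hy
    rw [Fin.lt_def]; omega
  rcases lt_or_ge l k with hl | hl
  · exact hu _ _ _ (hlt _ _ h0 hij (by omega)) (hlt _ _ (by omega) hjl hl)
  rw [← hsub l]
  rcases lt_or_ge j k with hj | hj
  · rw [det3_rotate]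
    exact hu _ _ _ (hlt _ _ (by omega) (by omega) (by omega)) (hlt _ _ h0 hij hj)
  · rw [← hsub j, ← det3_rotate]
    exact hu _ _ _ (hlt _ _ (by omega) (by omega) (by omega))
      (hlt _ _ (by omega) (by omega) (by omega))

/-! ### From reduced polygons to altitude polygons -/

lemma coe_image_range {k : ℕ} (v : Fin k → S2) :
    (fun x : S2 => (x : E3)) '' Set.range v = Set.range fun i => (v i : E3) := by
  rw [← Set.range_comp]; rfl

lemma IsConvexGon.mem_iff {k : ℕ} {v : Fin k → S2} {V : Set S2} (h : IsConvexGon k v V) {x : S2} :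
    x ∈ V ↔ (x : E3) ∈ Submodule.span ℝ≥0 (Set.range fun i => (v i : E3)) := by
  obtain ⟨-, ⟨D, hD, hvD⟩, -, rfl⟩ := h
  rw [mem_hull_iff hD hvD, coe_image_range]

lemma IsConvexGon.vertex_mem {k : ℕ} {v : Fin k → S2} {V : Set S2} (h : IsConvexGon k v V)
    (i : Fin k) : v i ∈ V := h.mem_iff.2 (Submodule.subset_span ⟨i, rfl⟩)

lemma IsConvexGon.notMem_span {k : ℕ} {v : Fin k → S2} {V : Set S2} (h : IsConvexGon k v V)
    (i : Fin k) :
    (v i : E3) ∉ Submodule.span ℝ≥0 ((fun i => (v i : E3)) '' {j | j ≠ i}) := by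
  obtain ⟨-, ⟨D, hD, hvD⟩, h3, -⟩ := h
  intro hmem
  apply h3 i
  rw [mem_hull_iff hD ((Set.image_subset_range _ _).trans hvD), Set.image_image]
  exact hmem

lemma IsConvexGon.supports {k : ℕ} {v : Fin k → S2} {V : Set S2} (h : IsConvexGon k v V) {y : E3}
    (hy : ∀ i, 0 ≤ ⟪y, (v i : E3)⟫) : Supports y V := by
  intro x hx
  refine span_nonneg ?_ (h.mem_iff.1 hx)
  rintro _ ⟨i, rfl⟩
  exact hy i

/-- The vertices of a reduced polygon have large pairwise inner products. -/
theorem IsConvexGon.exists_inner_bound {k : ℕ} {v : Fin k → S2} {V : Set S2}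
    (h : IsConvexGon k v V) (hV : IsReducedBody V) (h0 : 0 < thickness V)
    (h1 : thickness V < Real.pi / 2) :
    ∃ t : ℝ, 0 ≤ t ∧ t ≤ 1 ∧ Real.cos (thickness V) * √((1 + t) / 2) ≤ t ∧
      ∀ i j, t ≤ ⟪(v i : E3), (v j : E3)⟫ := by
  have hk3 : 3 ≤ k := h.1
  have hk0 : 0 < k := by omega
  obtain ⟨D, hD, hvD⟩ := h.2.1
  obtain ⟨y, hy⟩ := exists_pos_functional v hD hvD
  have hyV : ∀ x ∈ V, 0 < ⟪y, (x : E3)⟫ := by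
    intro x hx
    refine span_pos ?_ (h.mem_iff.1 hx) (coe_ne_zero x)
    rintro _ ⟨i, rfl⟩
    exact hy i
  choose m hm hmpos using fun i => exists_vertex_support (fun i => (v i : E3)) hy i (h.notMem_span i)
  have hm0 : ∀ i, m i ≠ 0 := by
    intro i hi
    obtain ⟨j, hj⟩ : ∃ j : Fin k, j ≠ i := by
      have : Nontrivial (Fin k) := Fin.nontrivial_iff_two_le.2 (by omega)
      exact exists_ne i
    have := hmpos i j hj
    rw [hi, inner_zero_left] at this
    exact lt_irrefl _ this
  have hmV : ∀ i, ∀ x ∈ V, x ≠ v i → 0 < ⟪m i, (x : E3)⟫ := by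
    intro i x hx hne
    have hnn : ∀ a ∈ Set.range fun i => (v i : E3), 0 ≤ ⟪m i, a⟫ := by
      rintro _ ⟨j, rfl⟩
      rcases eq_or_ne j i with rfl | hj
      · exact (hm j).ge
      · exact (hmpos i j hj).le
    obtain ⟨h2, h3⟩ := span_face hnn (h.mem_iff.1 hx)
    refine lt_of_le_of_ne h2 fun h4 => hne ?_
    have h5 : (x : E3) ∈ Submodule.span ℝ≥0 {(v i : E3)} := by
      refine Submodule.span_mono ?_ (h3 h4.symm)
      rintro _ ⟨⟨j, rfl⟩, hj⟩
      rcases eq_or_ne j i with rfl | hji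
      · rfl
      · exact absurd hj (hmpos i j hji).ne'
    obtain ⟨r, hr⟩ := Submodule.mem_span_singleton.1 h5
    exact eq_of_smul_eq r.2 hr.symm
  choose q hqV hq hstrip using fun i => hV.exists_foot h0 h1 (h.vertex_mem i) (hm0 i) (hm i) (hmV i) hyV
  obtain ⟨σ, hσ⟩ := exists_cyclic_order (fun i => (v i : E3)) h.notMem_span ⟨0, hk0⟩
    (norm_coe _) (hm0 _) (hm _) (hmpos _)
  have hsurj : Set.range (fun i => (v i : E3)) ⊆
      Set.range fun z : ℤ => (v (σ (finMod k hk0 z)) : E3) := by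
    rintro _ ⟨i, rfl⟩
    refine ⟨((σ.symm i : Fin k) : ℕ), ?_⟩
    simp only [finMod_coe, Equiv.apply_symm_apply]
  obtain ⟨-, -, -, -, -, -, hc1, hdual⟩ :=
    exists_optimal_lune hV.1 (exists_lunePair_of_thickness_pos h0)
  have hsup : ∀ x : E3, (∀ z : ℤ, 0 ≤ ⟪x, (v (σ (finMod k hk0 z)) : E3)⟫) → Supports x V := by
    intro x hx
    refine h.supports fun i => ?_
    obtain ⟨z, hz⟩ := hsurj ⟨i, rfl⟩
    have := hx z
    rwa [show (v (σ (finMod k hk0 z)) : E3) = v i from hz] at this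
  have H : AltitudePolygon (Real.cos (thickness V)) k
      (fun z => (v (σ (finMod k hk0 z)) : E3)) (fun z => (q (σ (finMod k hk0 z)) : E3)) := by
    refine ⟨by exact_mod_cast hk3, Real.cos_pos_of_mem_Ioo ⟨by linarith, h1⟩, hc1, ?_, ?_,
      fun _ => norm_coe _, fun _ => norm_coe _, ?_, fun _ => hq _,
      fun i l => hstrip _ _ (h.vertex_mem _), ?_, ?_⟩
    · intro z; simp only [finMod_periodic k hk0 z]
    · intro z; simp only [finMod_periodic k hk0 z]
    · exact det3_periodic_pos hk0 _ hσ
    · intro i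
      exact Submodule.span_mono hsurj (h.mem_iff.1 (hqV _))
    · intro x z hx hz
      exact hdual x z (hsup x hx) (hsup z hz)
  obtain ⟨t, ht0, ht1, htc, ht⟩ := H.exists_inner_bound
  refine ⟨t, ht0, ht1, htc, fun i j => ?_⟩
  obtain ⟨a, ha⟩ := hsurj ⟨i, rfl⟩
  obtain ⟨b, hb⟩ := hsurj ⟨j, rfl⟩
  have := ht a b
  rwa [show (v (σ (finMod k hk0 a)) : E3) = v i from ha,
    show (v (σ (finMod k hk0 b)) : E3) = v j from hb] at this

/-! ### Jung's theorem on the sphere -/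

lemma norm_sq_sum_ge {ι : Type*} [Fintype ι] {x : ι → E3} {a : ι → ℝ} {t : ℝ} (hx : ∀ i, ‖x i‖ = 1)
    (hxt : ∀ i j, t ≤ ⟪x i, x j⟫) (ha : ∀ i, 0 ≤ a i) (hsum : ∑ i, a i = 1) :
    t + (1 - t) * ∑ i, a i ^ 2 ≤ ‖∑ i, a i • x i‖ ^ 2 := by
  classical
  rw [← real_inner_self_eq_norm_sq, sum_inner]
  simp only [inner_sum, real_inner_smul_left, real_inner_smul_right]
  have h1 : ∀ i j, a i * (a j * (t + if i = j then 1 - t else 0)) ≤ a j * (a i * ⟪x i, x j⟫) := by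
    intro i j
    rw [mul_left_comm (a j)]
    refine mul_le_mul_of_nonneg_left (mul_le_mul_of_nonneg_left ?_ (ha j)) (ha i)
    split_ifs with h
    · subst h
      rw [inner_self_eq_one (hx i)]; linarith
    · rw [add_zero]; exact hxt i j
  refine le_trans (le_of_eq ?_) (Finset.sum_le_sum fun i _ => Finset.sum_le_sum fun j _ => h1 i j)
  have h2 : ∀ i, ∑ j, a i * (a j * (t + if i = j then 1 - t else 0)) =
      t * a i + (1 - t) * a i ^ 2 := by
    intro i
    simp only [mul_add, mul_ite, mul_zero, Finset.sum_add_distrib, Finset.sum_ite_eq,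
      Finset.mem_univ, if_true]
    rw [← Finset.mul_sum, ← Finset.sum_mul, hsum]
    ring
  simp only [h2, Finset.sum_add_distrib, ← Finset.mul_sum, hsum, mul_one]

/-- Jung's theorem on the sphere, for the radius of a spherical disk covering finitely many points
whose distances do not exceed a right angle. -/
lemma exists_disk_center {ι : Type*} [Finite ι] [Nonempty ι] (v : ι → E3) {t : ℝ} (ht0 : 0 ≤ t)
    (ht1 : t ≤ 1) (hv : ∀ i, ‖v i‖ = 1) (hvt : ∀ i j, t ≤ ⟪v i, v j⟫) :
    ∃ k : E3, ‖k‖ = 1 ∧ ∀ i, √((1 + 2 * t) / 3) ≤ ⟪k, v i⟫ := by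
  set K := convexHull ℝ (Set.range v) with hK
  have hKc : IsCompact K := (Set.finite_range v).isCompact_convexHull (𝕜 := ℝ)
  have hKconv : Convex ℝ K := convex_convexHull ℝ _
  have hKne : K.Nonempty := (Set.range_nonempty v).convexHull
  -- The point of the convex hull nearest to the origin gives the direction of the center, and its
  -- norm bounds the cosine of the radius from below.
  obtain ⟨z, hzK, hz⟩ := exists_norm_eq_iInf_of_complete_convex hKne hKc.isClosed.isComplete hKconv 0
  have hmin : ∀ x ∈ K, ‖z‖ ^ 2 ≤ ⟪z, x⟫ := by
    intro x hx
    have := (norm_eq_iInf_iff_real_inner_le_zero hKconv hzK).1 hz x hx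
    rw [zero_sub, inner_neg_left, inner_sub_right, real_inner_self_eq_norm_sq] at this
    linarith
  obtain ⟨κ, _, p, a, hp, hind, ha, hsum, hpz⟩ := eq_pos_convex_span_of_mem_convexHull hzK
  have hpK : ∀ i, p i ∈ K := fun i => subset_convexHull ℝ _ (hp ⟨i, rfl⟩)
  have hpn : ∀ i, ‖p i‖ = 1 := by
    intro i; obtain ⟨j, hj⟩ := hp ⟨i, rfl⟩; rw [← hj]; exact hv j
  have hpt : ∀ i j, t ≤ ⟪p i, p j⟫ := by
    intro i j
    obtain ⟨i', hi'⟩ := hp ⟨i, rfl⟩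
    obtain ⟨j', hj'⟩ := hp ⟨j, rfl⟩
    rw [← hi', ← hj']; exact hvt i' j'
  have hge := norm_sq_sum_ge hpn hpt (fun i => (ha i).le) hsum
  rw [hpz] at hge
  have hκ : Nonempty κ := by
    by_contra hne
    rw [not_nonempty_iff] at hne
    simp at hsum
  have hsqpos : 0 < ∑ i, a i ^ 2 :=
    Finset.sum_pos (fun i _ => pow_pos (ha i) 2) Finset.univ_nonempty
  have hz0 : 0 < ‖z‖ ^ 2 := by
    rcases eq_or_lt_of_le ht1 with h | h
    · subst h; linarith
    · have := mul_pos (sub_pos.2 h) hsqpos; linarith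
  have htight : ∀ i, ⟪z, p i⟫ = ‖z‖ ^ 2 := by
    have h1 : ∑ i, a i * (⟪z, p i⟫ - ‖z‖ ^ 2) = 0 := by
      have h2 : ⟪z, ∑ i, a i • p i⟫ = ‖z‖ ^ 2 := by rw [hpz, real_inner_self_eq_norm_sq]
      simp only [inner_sum, real_inner_smul_right] at h2
      simp only [mul_sub, Finset.sum_sub_distrib, ← Finset.sum_mul, hsum, h2]
      ring
    intro i
    have h3 := (Finset.sum_eq_zero_iff_of_nonneg fun i _ =>
      mul_nonneg (ha i).le (sub_nonneg.2 (hmin _ (hpK i)))).1 h1 i (Finset.mem_univ i)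
    linarith [(mul_eq_zero.1 h3).resolve_left (ha i).ne']
  -- The points in the Carathéodory representation lie in a plane not through 0, so affine
  -- independence becomes linear independence. Hence there are at most three of them, not four.
  have hlin : LinearIndependent ℝ p := by
    rw [Fintype.linearIndependent_iff]
    intro g hg i
    have h1 : ∑ i, g i = 0 := by
      have h2 : ⟪z, ∑ i, g i • p i⟫ = 0 := by rw [hg, inner_zero_right]
      simp only [inner_sum, real_inner_smul_right, htight, ← Finset.sum_mul] at h2
      exact (mul_eq_zero.1 h2).resolve_right hz0.ne'
    exact affineIndependent_iff.1 hind Finset.univ g h1 hg i (Finset.mem_univ i)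
  have hcard : Fintype.card κ ≤ 3 := by
    have := hlin.fintype_card_le_finrank
    rwa [finrank_euclideanSpace, Fintype.card_fin] at this
  have hthird : 1 / 3 ≤ ∑ i, a i ^ 2 := by
    have h1 := sq_sum_le_card_mul_sum_sq (s := Finset.univ) (f := a)
    rw [hsum, Finset.card_univ] at h1
    have h2 : (Fintype.card κ : ℝ) ≤ 3 := by exact_mod_cast hcard
    nlinarith
  have hfin : (1 + 2 * t) / 3 ≤ ‖z‖ ^ 2 := by
    have := mul_le_mul_of_nonneg_left hthird (sub_nonneg.2 ht1)
    linarith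
  have hz1 : 0 < ‖z‖ := by
    refine lt_of_le_of_ne (norm_nonneg z) fun h => ?_
    rw [← h] at hz0
    norm_num at hz0
  refine ⟨‖z‖⁻¹ • z, ?_, fun i => ?_⟩
  · rw [norm_smul, norm_inv, norm_norm, inv_mul_cancel₀ hz1.ne']
  · rw [real_inner_smul_left]
    have h1 := hmin (v i) (subset_convexHull ℝ _ ⟨i, rfl⟩)
    have h2 : ‖z‖ ≤ ‖z‖⁻¹ * ⟪z, v i⟫ := by
      rw [le_inv_mul_iff₀ hz1, ← sq]; exact h1
    refine le_trans ?_ h2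
    rw [← Real.sqrt_sq (norm_nonneg z)]
    exact Real.sqrt_le_sqrt hfin

/-! ### The extremal side length and the covering radius -/

/-- The inner product of two vertices of the regular triangle with altitudes of cosine `c`. -/
def sideInner (c : ℝ) : ℝ := 2 * ((c + √(c ^ 2 + 8)) / 4) ^ 2 - 1

lemma sqrt_add_eight {c : ℝ} (h0 : 0 < c) (h1 : c < 1) :
    √(c ^ 2 + 8) ^ 2 = c ^ 2 + 8 ∧ 2 < √(c ^ 2 + 8) ∧ √(c ^ 2 + 8) < 4 - c := by
  have hs := Real.sq_sqrt (show 0 ≤ c ^ 2 + 8 by positivity)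
  have hn := Real.sqrt_nonneg (c ^ 2 + 8)
  refine ⟨hs, by nlinarith, by nlinarith⟩

lemma sqrt_sideInner {c : ℝ} (h0 : 0 < c) :
    √((1 + sideInner c) / 2) = (c + √(c ^ 2 + 8)) / 4 := by
  rw [sideInner, show (1 + (2 * ((c + √(c ^ 2 + 8)) / 4) ^ 2 - 1)) / 2 =
    ((c + √(c ^ 2 + 8)) / 4) ^ 2 by ring, Real.sqrt_sq (by positivity)]

/-- With y = √((1 + t)/2), the cosine of half a side, the equation is 2y² - cy - 1 = 0, whose
positive root is (c + √(c² + 8))/4. -/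
lemma mul_sqrt_sideInner {c : ℝ} (h0 : 0 < c) (h1 : c < 1) :
    c * √((1 + sideInner c) / 2) = sideInner c := by
  obtain ⟨hs, -, -⟩ := sqrt_add_eight h0 h1
  rw [sqrt_sideInner h0, sideInner]
  linear_combination (-1 / 8) * hs

lemma sideInner_pos {c : ℝ} (h0 : 0 < c) (h1 : c < 1) : 0 < sideInner c := by
  rw [← mul_sqrt_sideInner h0 h1, sqrt_sideInner h0]
  positivity

lemma sideInner_lt_one {c : ℝ} (h0 : 0 < c) (h1 : c < 1) : sideInner c < 1 := by
  obtain ⟨hs, h2, h3⟩ := sqrt_add_eight h0 h1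
  rw [sideInner]
  nlinarith

/-- The function 2y² - cy - 1 is increasing where both roots y in question could differ: 2(y + y') >
c once y' > 1/2. -/
lemma sideInner_le {c t : ℝ} (h0 : 0 < c) (h1 : c < 1) (ht : 0 ≤ t)
    (h : c * √((1 + t) / 2) ≤ t) : sideInner c ≤ t := by
  obtain ⟨hs, h2, h3⟩ := sqrt_add_eight h0 h1
  have e1 := mul_sqrt_sideInner h0 h1
  have e2 := sqrt_sideInner h0
  have e3 : sideInner c = 2 * √((1 + sideInner c) / 2) ^ 2 - 1 := by rw [e2, sideInner]
  have e4 : t = 2 * √((1 + t) / 2) ^ 2 - 1 := by rw [Real.sq_sqrt (by positivity)]; ring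
  have hy := Real.sqrt_nonneg ((1 + t) / 2)
  have hy0 : 0 ≤ √((1 + sideInner c) / 2) := Real.sqrt_nonneg _
  by_contra hlt
  push Not at hlt
  have h5 : √((1 + t) / 2) < √((1 + sideInner c) / 2) :=
    Real.sqrt_lt_sqrt (by positivity) (by linarith)
  have h6 : 1 / 2 < √((1 + sideInner c) / 2) := by rw [e2]; linarith
  nlinarith

lemma sideInner_unique {c t : ℝ} (h0 : 0 < c) (h1 : c < 1) (ht : 0 ≤ t)
    (h : c * √((1 + t) / 2) = t) : t = sideInner c := by
  refine le_antisymm ?_ (sideInner_le h0 h1 ht h.le)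
  have e1 := mul_sqrt_sideInner h0 h1
  have hp := sideInner_pos h0 h1
  have e3 : sideInner c = 2 * √((1 + sideInner c) / 2) ^ 2 - 1 := by
    rw [Real.sq_sqrt (by positivity)]; ring
  have e4 : t = 2 * √((1 + t) / 2) ^ 2 - 1 := by rw [Real.sq_sqrt (by positivity)]; ring
  by_contra hlt
  push Not at hlt
  have h5 : √((1 + sideInner c) / 2) < √((1 + t) / 2) :=
    Real.sqrt_lt_sqrt (by positivity) (by linarith)
  have h6 : 1 / 2 < √((1 + sideInner c) / 2) := by
    obtain ⟨hs, h2, h3⟩ := sqrt_add_eight h0 h1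
    rw [sqrt_sideInner h0]; linarith
  nlinarith

lemma coverRadius_facts {ω : ℝ} (h0 : 0 < ω) (h1 : ω < Real.pi / 2) :
    0 < coverRadius ω ∧ coverRadius ω < Real.pi / 2 ∧
      Real.cos (coverRadius ω) = √((1 + 2 * sideInner (Real.cos ω)) / 3) := by
  have hc0 : 0 < Real.cos ω := Real.cos_pos_of_mem_Ioo ⟨by linarith, h1⟩
  have hc1 : Real.cos ω < 1 := by
    have := Real.cos_lt_cos_of_nonneg_of_le_pi_div_two le_rfl h1.le h0
    rwa [Real.cos_zero] at this
  set c := Real.cos ω with hc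
  obtain ⟨hs, h2, h3⟩ := sqrt_add_eight hc0 hc1
  have hsin : Real.sin (gammaAngle ω) = (-c + √(c ^ 2 + 8)) / 4 := by
    rw [gammaAngle, ← hc, Real.sin_arcsin (by linarith) (by linarith)]
  -- The numbers (√(c² + 8) ± c)/4 have product 1/2, so 1/(2 sin γ) is the cosine of half a side.
  have hprod : 1 / (4 * Real.sin (gammaAngle ω) ^ 2) = ((c + √(c ^ 2 + 8)) / 4) ^ 2 := by
    have h4 : 0 < Real.sin (gammaAngle ω) := by rw [hsin]; linarith
    rw [div_eq_iff (by positivity), hsin]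
    have h5 : (c + √(c ^ 2 + 8)) / 4 * ((-c + √(c ^ 2 + 8)) / 4) = 1 / 2 := by
      linear_combination (1 / 16) * hs
    calc (1 : ℝ) = 4 * (1 / 2) ^ 2 := by norm_num
      _ = _ := by rw [← h5]; ring
  have hR : coverRadius ω =
      Real.arcsin (2 / √3 * √((1 - sideInner c) / 2)) := by
    rw [coverRadius, hprod, sideInner]
    congr 3
    ring
  have ht0 := sideInner_pos hc0 hc1
  have ht1 := sideInner_lt_one hc0 hc1
  set A := 2 / √3 * √((1 - sideInner c) / 2) with hA
  have hApos : 0 < A := by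
    have : 0 < √((1 - sideInner c) / 2) := Real.sqrt_pos.2 (by linarith)
    positivity
  have hA2 : A ^ 2 = 2 * (1 - sideInner c) / 3 := by
    rw [hA, mul_pow, div_pow, Real.sq_sqrt (by norm_num), Real.sq_sqrt (by linarith)]; ring
  have hA1 : A < 1 := by nlinarith
  rw [hR]
  refine ⟨Real.arcsin_pos.2 hApos, Real.arcsin_lt_pi_div_two.2 hA1, ?_⟩
  rw [Real.cos_arcsin, hA2]
  congr 1
  ring

lemma mem_disk_iff {k x : S2} {r : ℝ} (h0 : 0 ≤ r) (h1 : r ≤ Real.pi) :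
    x ∈ disk k r ↔ Real.cos r ≤ ⟪(k : E3), (x : E3)⟫ := by
  rw [disk, Set.mem_ofPred_eq, sdist_eq_arccos]
  constructor
  · intro h
    have := Real.cos_le_cos_of_nonneg_of_le_pi (Real.arccos_nonneg _) h1 h
    rwa [Real.cos_arccos (neg_one_le_inner _ _) (inner_le_one _ _)] at this
  · intro h
    have := Real.arccos_le_arccos h
    rwa [Real.arccos_cos h0 h1] at this

/-- A disk not larger than a hemisphere contains a polygon if it contains its vertices. -/
lemma IsConvexGon.subset_disk {n : ℕ} {v : Fin n → S2} {V : Set S2} (h : IsConvexGon n v V) {k : S2}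
    {r : ℝ} (h0 : 0 ≤ r) (h1 : r ≤ Real.pi / 2) (hv : ∀ i, v i ∈ disk k r) : V ⊆ disk k r := by
  have hrπ : r ≤ Real.pi := by linarith [Real.pi_pos]
  have hcos : 0 ≤ Real.cos r := Real.cos_nonneg_of_mem_Icc ⟨by linarith [Real.pi_pos], h1⟩
  intro x hx
  have key : ∀ z ∈ Submodule.span ℝ≥0 (Set.range fun i => (v i : E3)),
      Real.cos r * ‖z‖ ≤ ⟪(k : E3), z⟫ := by
    intro z hz
    induction hz using Submodule.span_induction with
    | mem z hz =>
      obtain ⟨i, rfl⟩ := hz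
      rw [norm_coe, mul_one]
      exact (mem_disk_iff h0 hrπ).1 (hv i)
    | zero => simp
    | add a b _ _ ha hb =>
      rw [inner_add_right]
      have := mul_le_mul_of_nonneg_left (norm_add_le a b) hcos
      linarith
    | smul s a _ ha =>
      rw [NNReal.smul_def, norm_smul, real_inner_smul_right, Real.norm_of_nonneg s.coe_nonneg]
      have := mul_le_mul_of_nonneg_left ha s.coe_nonneg
      rw [mul_left_comm]
      exact this
  have := key _ (h.mem_iff.1 hx)
  rw [norm_coe, mul_one] at this
  exact (mem_disk_iff h0 hrπ).2 this

theorem exists_disk_of_reduced {V : Set S2} (hp : IsConvexPolygon V) (hV : IsReducedBody V)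
    (h0 : 0 < thickness V) (h1 : thickness V < Real.pi / 2) :
    ∃ k : S2, V ⊆ disk k (coverRadius (thickness V)) := by
  obtain ⟨n, v, h⟩ := hp
  obtain ⟨t, ht0, ht1, htc, ht⟩ := h.exists_inner_bound hV h0 h1
  have hne : Nonempty (Fin n) := ⟨⟨0, by have := h.1; omega⟩⟩
  obtain ⟨k, hk, hkv⟩ := exists_disk_center (fun i => (v i : E3)) ht0 ht1 (fun i => norm_coe _) ht
  obtain ⟨hR0, hR1, hR⟩ := coverRadius_facts h0 h1
  refine ⟨⟨k, mem_sphere_zero_iff_norm.2 hk⟩, h.subset_disk hR0.le hR1.le fun i => ?_⟩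
  rw [mem_disk_iff hR0.le (by linarith [Real.pi_pos]), hR]
  refine le_trans (Real.sqrt_le_sqrt ?_) (hkv i)
  have hc0 : 0 < Real.cos (thickness V) := Real.cos_pos_of_mem_Ioo ⟨by linarith, h1⟩
  have hc1 : Real.cos (thickness V) < 1 := by
    have := Real.cos_lt_cos_of_nonneg_of_le_pi_div_two le_rfl h1.le h0
    rwa [Real.cos_zero] at this
  have := sideInner_le hc0 hc1 ht0 htc
  linarith

/-! ### Triples of vectors with equal inner products -/

/-- Three unit vectors with pairwise inner product `t`, linearly independent. -/
structure RegularTriple (t : ℝ) (v : Fin 3 → E3) : Prop where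
  gram : ∀ i j, ⟪v i, v j⟫ = if i = j then 1 else t
  lt_one : t < 1
  pos : 0 < 1 + 2 * t

/-- The normal vectors of the planes through two of three vectors with pairwise inner product `t`. -/
def triNormal (t : ℝ) (v : Fin 3 → E3) (i : Fin 3) : E3 :=
  (1 + 2 * t) • v i - t • (v 0 + v 1 + v 2)

namespace RegularTriple

variable {t : ℝ} {v : Fin 3 → E3}

lemma norm_eq (H : RegularTriple t v) (i : Fin 3) : ‖v i‖ = 1 := by
  rw [← sq_eq_sq₀ (norm_nonneg _) zero_le_one, ← real_inner_self_eq_norm_sq, H.gram, if_pos rfl,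
    one_pow]

lemma inner_sum (H : RegularTriple t v) (i : Fin 3) : ⟪v i, v 0 + v 1 + v 2⟫ = 1 + 2 * t := by
  simp only [inner_add_right, H.gram]
  fin_cases i <;> simp <;> ring

lemma d_pos (H : RegularTriple t v) : 0 < (1 - t) * (1 + 2 * t) :=
  mul_pos (sub_pos.2 H.lt_one) H.pos

/-- Up to the factor (1 - t)(1 + 2t) the normals form the dual basis. -/
lemma normal_inner (H : RegularTriple t v) (i j : Fin 3) :
    ⟪triNormal t v i, v j⟫ = if i = j then (1 - t) * (1 + 2 * t) else 0 := by
  rw [triNormal, inner_sub_left, real_inner_smul_left, real_inner_smul_left,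
    real_inner_comm (v j) (v 0 + v 1 + v 2), H.inner_sum, H.gram]
  split_ifs <;> ring

lemma normal_inner_normal (H : RegularTriple t v) (i j : Fin 3) :
    ⟪triNormal t v i, triNormal t v j⟫ =
      if i = j then (1 + t) * ((1 - t) * (1 + 2 * t)) else -t * ((1 - t) * (1 + 2 * t)) := by
  have h : ⟪triNormal t v i, v 0 + v 1 + v 2⟫ = (1 - t) * (1 + 2 * t) := by
    simp only [inner_add_right, H.normal_inner]
    fin_cases i <;> simp
  conv_lhs => rw [triNormal.eq_def t v j, inner_sub_right, real_inner_smul_right,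
    real_inner_smul_right, H.normal_inner, h]
  split_ifs <;> ring

lemma det_ne_zero (H : RegularTriple t v) : det3 (v 0) (v 1) (v 2) ≠ 0 := by
  intro h
  have h1 := det3_mul_det3 (v 0) (v 1) (v 2) (v 2)
  simp only [h, H.gram] at h1
  simp at h1
  have := mul_pos (sub_pos.2 H.lt_one) H.d_pos
  nlinarith

lemma dual_expansion (H : RegularTriple t v) (x : E3) :
    ((1 - t) * (1 + 2 * t)) • x = ⟪v 0, x⟫ • triNormal t v 0 + ⟪v 1, x⟫ • triNormal t v 1 +
      ⟪v 2, x⟫ • triNormal t v 2 := by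
  rw [← sub_eq_zero]
  refine eq_zero_of_inner_eq_zero H.det_ne_zero ?_ ?_ ?_ <;>
  · simp only [inner_sub_left, inner_add_left, real_inner_smul_left, H.normal_inner,
      real_inner_comm _ x]
    simp
    ring

lemma inner_expansion (H : RegularTriple t v) (x y : E3) :
    ((1 - t) * (1 + 2 * t)) * ⟪x, y⟫ = ⟪v 0, x⟫ * ⟪triNormal t v 0, y⟫ +
      ⟪v 1, x⟫ * ⟪triNormal t v 1, y⟫ + ⟪v 2, x⟫ * ⟪triNormal t v 2, y⟫ := by
  have := congrArg (fun z => ⟪z, y⟫) (H.dual_expansion x)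
  simpa only [inner_add_left, real_inner_smul_left] using this

lemma expansion (H : RegularTriple t v) (x : E3) :
    ((1 - t) * (1 + 2 * t)) • x = ⟪triNormal t v 0, x⟫ • v 0 + ⟪triNormal t v 1, x⟫ • v 1 +
      ⟪triNormal t v 2, x⟫ • v 2 := by
  refine ext_inner_left ℝ fun y => ?_
  rw [real_inner_smul_right, H.inner_expansion]
  simp only [inner_add_right, real_inner_smul_right, real_inner_comm y (v _)]
  ring

/-- The difference of the two sides is exactly the sum of the nonnegative terms `h1` and `h2`. -/
lemma facet_inequality_aux {X a b : ℝ} (hX : 0 ≤ X) (ht : 0 < t) (ht1 : t < 1)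
    (h : (1 + t) * X ≤ t * (a + b)) (hab : 0 ≤ a + b) :
    ((1 + t) * X - t * (a + b)) ^ 2 ≤
      2 * t ^ 2 * ((1 + t) * (X ^ 2 + a ^ 2 + b ^ 2) - 2 * t * (X * a + X * b + a * b)) := by
  have h1 : 0 ≤ X * (((1 - t) * (1 + 2 * t)) * (2 * (t * (a + b)) - (1 + t) * X)) := by
    refine mul_nonneg hX (mul_nonneg (mul_nonneg (by linarith) (by linarith)) ?_)
    have := mul_nonneg ht.le hab
    linarith
  have h2 : 0 ≤ t ^ 2 * (1 + 2 * t) * (a - b) ^ 2 := by positivity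
  linarith

lemma facet_inequality_fin (ht : 0 < t) (ht1 : t < 1) (b : Fin 3 → ℝ) (hb : ∀ j, 0 ≤ b j)
    (i : Fin 3) (h : (1 + 2 * t) * b i - t * (b 0 + b 1 + b 2) ≤ 0) :
    ((1 + 2 * t) * b i - t * (b 0 + b 1 + b 2)) ^ 2 ≤
      2 * t ^ 2 * (b 0 * ((1 + 2 * t) * b 0 - t * (b 0 + b 1 + b 2)) +
        b 1 * ((1 + 2 * t) * b 1 - t * (b 0 + b 1 + b 2)) +
        b 2 * ((1 + 2 * t) * b 2 - t * (b 0 + b 1 + b 2))) := by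
  have hb0 := hb 0
  have hb1 := hb 1
  have hb2 := hb 2
  fin_cases i
  · replace h : (1 + 2 * t) * b 0 - t * (b 0 + b 1 + b 2) ≤ 0 := h
    have := facet_inequality_aux hb0 ht ht1 (a := b 1) (b := b 2) (by linarith) (by linarith)
    show ((1 + 2 * t) * b 0 - t * (b 0 + b 1 + b 2)) ^ 2 ≤ _
    linarith
  · replace h : (1 + 2 * t) * b 1 - t * (b 0 + b 1 + b 2) ≤ 0 := h
    have := facet_inequality_aux hb1 ht ht1 (a := b 0) (b := b 2) (by linarith) (by linarith)
    show ((1 + 2 * t) * b 1 - t * (b 0 + b 1 + b 2)) ^ 2 ≤ _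
    linarith
  · replace h : (1 + 2 * t) * b 2 - t * (b 0 + b 1 + b 2) ≤ 0 := h
    have := facet_inequality_aux hb2 ht ht1 (a := b 0) (b := b 1) (by linarith) (by linarith)
    show ((1 + 2 * t) * b 2 - t * (b 0 + b 1 + b 2)) ^ 2 ≤ _
    linarith

/-- A lune with one hemisphere bounded by a side of the triangle is no narrower than arccos c. In
the coordinates ⟪v j, h⟫ the claim becomes a quadratic inequality after squaring. -/
lemma facet_inequality (H : RegularTriple t v) (ht : 0 < t) {c : ℝ} (hc : 0 ≤ c)
    (hct : c ^ 2 * (1 + t) = 2 * t ^ 2) (i : Fin 3) {h : E3} (hh : ∀ j, 0 ≤ ⟪h, v j⟫) :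
    -(c * (‖triNormal t v i‖ * ‖h‖)) ≤ ⟪triNormal t v i, h⟫ := by
  have hd := H.d_pos
  have hb : ∀ j, 0 ≤ ⟪v j, h⟫ := fun j => by rw [real_inner_comm]; exact hh j
  have hn : ∀ i, ⟪triNormal t v i, h⟫ = (1 + 2 * t) * ⟪v i, h⟫ -
      t * (⟪v 0, h⟫ + ⟪v 1, h⟫ + ⟪v 2, h⟫) := fun i => by
    rw [triNormal, inner_sub_left, real_inner_smul_left, real_inner_smul_left, inner_add_left,
      inner_add_left]
  have hnn : ‖triNormal t v i‖ ^ 2 = (1 + t) * ((1 - t) * (1 + 2 * t)) := by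
    rw [← real_inner_self_eq_norm_sq, H.normal_inner_normal, if_pos rfl]
  have hhh := H.inner_expansion h h
  rw [real_inner_self_eq_norm_sq, hn, hn, hn] at hhh
  by_contra hlt
  push Not at hlt
  have hX : 0 ≤ c * (‖triNormal t v i‖ * ‖h‖) := by positivity
  have hsq : (c * (‖triNormal t v i‖ * ‖h‖)) ^ 2 = 2 * t ^ 2 * ((1 - t) * (1 + 2 * t) * ‖h‖ ^ 2) := by
    rw [mul_pow, mul_pow, hnn, ← hct]; ring
  rw [hhh] at hsq
  have hneg : ⟪triNormal t v i, h⟫ ≤ 0 := by linarith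
  have hlt2 : (c * (‖triNormal t v i‖ * ‖h‖)) ^ 2 < ⟪triNormal t v i, h⟫ ^ 2 := by nlinarith
  rw [hsq, hn] at hlt2
  rw [hn] at hneg
  exact absurd (facet_inequality_fin ht H.lt_one (fun j => ⟪v j, h⟫) hb i hneg) (not_le.2 hlt2)

/-- A support vector of a triangle at a point that is not a vertex is normal to a side. -/
lemma vertex_or_facet (H : RegularTriple t v) {p g : E3} (hp : ∀ i, 0 ≤ ⟪triNormal t v i, p⟫)
    (hg : ∀ i, 0 ≤ ⟪g, v i⟫) (hg0 : g ≠ 0) (hgp : ⟪g, p⟫ = 0) :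
    (∃ i, ∃ r : ℝ, 0 ≤ r ∧ p = r • v i) ∨ ∃ i, ∃ r : ℝ, 0 ≤ r ∧ g = r • triNormal t v i := by
  have hd := H.d_pos
  have hg' : ∀ i, 0 ≤ ⟪v i, g⟫ := fun i => by rw [real_inner_comm]; exact hg i
  have h0 := H.inner_expansion g p
  -- Complementary slackness: a vanishing sum of three nonnegative products. Each factorwise choice
  -- leaves p on the ray of a vertex or g on the ray of a normal.
  rw [hgp, mul_zero] at h0
  have e1 := mul_nonneg (hg' 0) (hp 0)
  have e2 := mul_nonneg (hg' 1) (hp 1)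
  have e3 := mul_nonneg (hg' 2) (hp 2)
  have z0 : ⟪v 0, g⟫ * ⟪triNormal t v 0, p⟫ = 0 := by linarith
  have z1 : ⟪v 1, g⟫ * ⟪triNormal t v 1, p⟫ = 0 := by linarith
  have z2 : ⟪v 2, g⟫ * ⟪triNormal t v 2, p⟫ = 0 := by linarith
  have hge := H.dual_expansion g
  have hpe := H.expansion p
  have hdi : 0 ≤ ((1 - t) * (1 + 2 * t))⁻¹ := (inv_pos.2 hd).le
  have solve : ∀ {x y : E3} {r : ℝ}, 0 ≤ r → ((1 - t) * (1 + 2 * t)) • x = r • y →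
      ∃ r' : ℝ, 0 ≤ r' ∧ x = r' • y := fun {x y r} hr hxy =>
    ⟨((1 - t) * (1 + 2 * t))⁻¹ * r, mul_nonneg hdi hr, by
      rw [mul_smul, ← hxy, inv_smul_smul₀ hd.ne']⟩
  rcases mul_eq_zero.1 z0 with a0 | a0 <;> rcases mul_eq_zero.1 z1 with a1 | a1 <;>
    rcases mul_eq_zero.1 z2 with a2 | a2
  · rw [a0, a1, a2] at hge
    simp only [zero_smul, add_zero] at hge
    exact absurd ((smul_eq_zero.1 hge).resolve_left hd.ne') hg0
  · rw [a0, a1, zero_smul, zero_smul, zero_add, zero_add] at hge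
    exact Or.inr ⟨2, solve (hg' 2) hge⟩
  · rw [a0, a2, zero_smul, zero_smul, zero_add, add_zero] at hge
    exact Or.inr ⟨1, solve (hg' 1) hge⟩
  · rw [a1, a2, zero_smul, zero_smul, add_zero, add_zero] at hpe
    exact Or.inl ⟨0, solve (hp 0) hpe⟩
  · rw [a1, a2, zero_smul, zero_smul, add_zero, add_zero] at hge
    exact Or.inr ⟨0, solve (hg' 0) hge⟩
  · rw [a0, a2, zero_smul, zero_smul, zero_add, add_zero] at hpe
    exact Or.inl ⟨1, solve (hp 1) hpe⟩
  · rw [a0, a1, zero_smul, zero_smul, zero_add, zero_add] at hpe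
    exact Or.inl ⟨2, solve (hp 2) hpe⟩
  · rw [a0, a1, a2] at hpe
    simp only [zero_smul, add_zero] at hpe
    have hp0 := (smul_eq_zero.1 hpe).resolve_left hd.ne'
    exact Or.inl ⟨0, 0, le_rfl, by rw [hp0, zero_smul]⟩

end RegularTriple

/-! ### Regular triangles on the sphere -/

lemma IsConvexGon.isConvex {k : ℕ} {v : Fin k → S2} {V : Set S2} (h : IsConvexGon k v V) :
    IsConvex V := by
  obtain ⟨-, ⟨D, hD, hvD⟩, -, rfl⟩ := h
  intro a ha b hb
  refine ⟨(hD a (ha D ⟨hD, hvD⟩) b (hb D ⟨hD, hvD⟩)).1, fun x hx C hC => ?_⟩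
  exact (hC.1 a (ha C hC) b (hb C hC)).2 hx

lemma IsConvexGon.subset_of_vertices {k : ℕ} {v : Fin k → S2} {V C : Set S2}
    (h : IsConvexGon k v V) (hC : IsConvex C) (hv : ∀ i, v i ∈ C) : V ⊆ C := by
  obtain ⟨-, -, -, rfl⟩ := h
  exact fun x hx => hx C ⟨hC, by rintro _ ⟨i, rfl⟩; exact hv i⟩

/-- The triangle `T` has the vertices `v i`, with pairwise inner product `t`. -/
structure EquilateralTriangle (t : ℝ) (v : Fin 3 → S2) (T : Set S2) : Prop where
  gon : IsConvexGon 3 v T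
  triple : RegularTriple t fun i => (v i : E3)

namespace EquilateralTriangle

variable {t : ℝ} {v : Fin 3 → S2} {T : Set S2}

/-- The normal vectors of the sides. -/
abbrev normal (t : ℝ) (v : Fin 3 → S2) (i : Fin 3) : E3 := triNormal t (fun i => (v i : E3)) i

lemma mem_iff (H : EquilateralTriangle t v T) {x : S2} :
    x ∈ T ↔ ∀ i, 0 ≤ ⟪normal t v i, (x : E3)⟫ := by
  have hd := H.triple.d_pos
  rw [H.gon.mem_iff]
  constructor
  · intro hx i
    refine span_nonneg ?_ hx
    rintro _ ⟨j, rfl⟩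
    have := H.triple.normal_inner i j
    rw [this]
    split_ifs
    · exact hd.le
    · exact le_rfl
  · intro hx
    have h1 := H.triple.expansion (x : E3)
    have h2 : (x : E3) = ((1 - t) * (1 + 2 * t))⁻¹ • (((1 - t) * (1 + 2 * t)) • (x : E3)) := by
      rw [inv_smul_smul₀ hd.ne']
    rw [h2, h1]
    have hm : ∀ i : Fin 3, (v i : E3) ∈ Submodule.span ℝ≥0 (Set.range fun i => (v i : E3)) :=
      fun i => Submodule.subset_span ⟨i, rfl⟩
    exact smul_mem_span (Submodule.add_mem _ (Submodule.add_mem _ (smul_mem_span (hm 0) (hx 0))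
      (smul_mem_span (hm 1) (hx 1))) (smul_mem_span (hm 2) (hx 2))) (inv_pos.2 hd).le

lemma isConvexBody (H : EquilateralTriangle t v T) : IsConvexBody T := by
  have hcont : ∀ i, Continuous fun x : S2 => ⟪normal t v i, (x : E3)⟫ := fun i =>
    continuous_const.inner continuous_subtype_val
  refine ⟨?_, H.gon.isConvex, ?_⟩
  · have : T = ⋂ i, {x : S2 | 0 ≤ ⟪normal t v i, (x : E3)⟫} := by
      ext x; simp only [Set.mem_iInter]; exact H.mem_iff
    rw [this]
    exact isClosed_iInter fun i => isClosed_le continuous_const (hcont i)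
  · set s : E3 := (v 0 : E3) + v 1 + v 2 with hs
    have hpos : ∀ i, 0 < ⟪normal t v i, s⟫ := by
      intro i
      simp only [hs, inner_add_right]
      have h := fun j => H.triple.normal_inner i j
      rw [h, h, h]
      fin_cases i <;> simpa using H.triple.d_pos
    have hs0 : s ≠ 0 := by
      intro h
      have := hpos 0
      rw [h, inner_zero_right] at this
      exact lt_irrefl _ this
    refine ⟨direction s hs0, mem_interior.2 ⟨⋂ i, {x : S2 | 0 < ⟪normal t v i, (x : E3)⟫}, ?_,
      isOpen_iInter_of_finite fun i => isOpen_lt continuous_const (hcont i), ?_⟩⟩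
    · intro x hx
      rw [Set.mem_iInter] at hx
      exact H.mem_iff.2 fun i => (hx i).le
    · rw [Set.mem_iInter]
      intro i
      show 0 < ⟪normal t v i, (direction s hs0 : E3)⟫
      rw [coe_direction, real_inner_smul_right]
      exact mul_pos (inv_pos.2 (norm_pos_iff.2 hs0)) (hpos i)

lemma supports_normal (H : EquilateralTriangle t v T) (i : Fin 3) : Supports (normal t v i) T :=
  fun _ hx => H.mem_iff.1 hx i

lemma normal_ne_zero (H : EquilateralTriangle t v T) (i : Fin 3) : normal t v i ≠ 0 := by
  intro h
  have := H.triple.normal_inner i i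
  rw [if_pos rfl] at this
  rw [show triNormal t (fun i => (v i : E3)) i = 0 from h, inner_zero_left] at this
  exact H.triple.d_pos.ne this

lemma norm_normal_sq (H : EquilateralTriangle t v T) (i : Fin 3) :
    ‖normal t v i‖ ^ 2 = (1 + t) * ((1 - t) * (1 + 2 * t)) := by
  rw [← real_inner_self_eq_norm_sq, H.triple.normal_inner_normal, if_pos rfl]

lemma exists_lunePair (H : EquilateralTriangle t v T) :
    ∃ g h : S2, IsLunePair g h ∧ Supports (g : E3) T ∧ Supports (h : E3) T := by
  have hd := H.triple.d_pos
  have hp := H.triple.pos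
  refine ⟨direction _ (H.normal_ne_zero 0), direction _ (H.normal_ne_zero 1), ?_,
    (H.supports_normal 0).smul (by positivity), (H.supports_normal 1).smul (by positivity)⟩
  have h0 := norm_pos_iff.2 (H.normal_ne_zero 0)
  have hn : ‖normal t v 1‖ = ‖normal t v 0‖ :=
    (sq_eq_sq₀ (norm_nonneg _) (norm_nonneg _)).1
      ((H.norm_normal_sq 1).trans (H.norm_normal_sq 0).symm)
  have h1 := H.triple.normal_inner_normal 0 1
  rw [if_neg (by decide)] at h1
  rw [isLunePair_iff, coe_direction, coe_direction, real_inner_smul_left, real_inner_smul_right, hn,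
    h1, ← mul_assoc, ← mul_inv, ← sq, H.norm_normal_sq, inv_mul_eq_div]
  have hpos : 0 < (1 + t) * ((1 - t) * (1 + 2 * t)) := mul_pos (by linarith) hd
  rw [lt_div_iff₀ hpos, div_lt_one hpos]
  constructor <;> nlinarith

lemma thickness_le_pi (H : EquilateralTriangle t v T) : thickness T ≤ Real.pi := by
  obtain ⟨g, h, hgh, hg, hh⟩ := H.exists_lunePair
  linarith [thickness_le hgh hg hh, Real.arccos_nonneg ⟪(g : E3), (h : E3)⟫]

/-- The midpoint of the side opposite to the vertex `v i`, not normalized. -/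
def mid (v : Fin 3 → S2) (i : Fin 3) : E3 := (v 0 : E3) + v 1 + v 2 - v i

lemma inner_mid (H : EquilateralTriangle t v T) (i j : Fin 3) :
    ⟪(v j : E3), mid v i⟫ = if i = j then 2 * t else 1 + t := by
  have h1 := H.triple.inner_sum j
  have h2 := H.triple.gram j i
  rw [mid, inner_sub_right, h1, h2]
  by_cases h : i = j
  · rw [if_pos h.symm, if_pos h]; ring
  · rw [if_neg (Ne.symm h), if_neg h]; ring

lemma mid_inner_self (H : EquilateralTriangle t v T) (i : Fin 3) : ⟪mid v i, mid v i⟫ = 2 * (1 + t) := by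
  conv_lhs => rw [mid.eq_def, inner_sub_left, inner_add_left, inner_add_left]
  rw [← mid.eq_def, H.inner_mid, H.inner_mid, H.inner_mid, H.inner_mid]
  fin_cases i <;> simp <;> ring

end EquilateralTriangle

namespace EquilateralTriangle

variable {t : ℝ} {v : Fin 3 → S2} {T : Set S2}

/-- The altitude of the triangle at the vertex `v i`. -/
lemma exists_altitude (H : EquilateralTriangle t v T) (ht : 0 < t) {c : ℝ} (hc0 : 0 < c)
    (hct : c * √((1 + t) / 2) = t) (i : Fin 3) :
    c < 1 ∧ ∃ q : S2, ⟪(v i : E3), (q : E3)⟫ = c ∧ Supports ((v i : E3) - c • (q : E3)) T ∧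
      (∀ j, j ≠ i → 0 < ⟪(q : E3) - c • (v i : E3), (v j : E3)⟫) := by
  have ht1 := H.triple.lt_one
  -- y is the cosine of half a side; the foot of the altitude is the normalized midpoint of the
  -- opposite side.
  set y := √((1 + t) / 2) with hy
  have hy2 : y ^ 2 = (1 + t) / 2 := Real.sq_sqrt (by linarith)
  have hy0 : 0 < y := Real.sqrt_pos.2 (by linarith)
  have hty : t < y := by nlinarith
  have hc1 : c < 1 := by
    by_contra h
    push Not at h
    nlinarith
  have hn : ‖mid v i‖ = 2 * y := by
    rw [← sq_eq_sq₀ (norm_nonneg _) (by positivity), ← real_inner_self_eq_norm_sq,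
      H.mid_inner_self, mul_pow, hy2]
    ring
  have hm0 : mid v i ≠ 0 := by
    rw [← norm_pos_iff, hn]; positivity
  have hq : ∀ j, ⟪(v j : E3), (direction _ hm0 : E3)⟫ = if i = j then c else y := by
    intro j
    rw [coe_direction, real_inner_smul_right, H.inner_mid, hn]
    split_ifs
    · rw [inv_mul_eq_div, div_eq_iff (by positivity)]; linarith
    · rw [inv_mul_eq_div, div_eq_iff (by positivity)]; linarith
  have hg := H.triple.gram
  refine ⟨hc1, direction _ hm0, by rw [hq, if_pos rfl], H.gon.supports fun j => ?_, fun j hj => ?_⟩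
  · rw [inner_sub_left, real_inner_smul_left, real_inner_comm, real_inner_comm (v j : E3), hq, hg]
    by_cases h : i = j
    · rw [if_pos h, if_pos h.symm]; nlinarith
    · rw [if_neg h, if_neg (Ne.symm h)]; linarith
  · rw [inner_sub_left, real_inner_smul_left, real_inner_comm, hq, hg, if_neg hj.symm,
      if_neg hj.symm]
    nlinarith

/-- If t ≤ 0, any two supporting vectors have nonnegative inner product, and an optimal lune has
thickness at least π / 2. -/
lemma pos_of_thickness (H : EquilateralTriangle t v T) (h1 : thickness T < Real.pi / 2) : 0 < t := by
  by_contra hcon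
  push Not at hcon
  obtain ⟨g, h, hg, hh, -, heq, -, -⟩ := exists_optimal_lune H.isConvexBody H.exists_lunePair
  have hc : 0 < Real.cos (thickness T) :=
    Real.cos_pos_of_mem_Ioo ⟨by linarith [thickness_nonneg T, Real.pi_pos], h1⟩
  have hd := H.triple.d_pos
  have h2 := H.triple.inner_expansion (g : E3) (h : E3)
  have hgi : ∀ i, 0 ≤ ⟪(v i : E3), (g : E3)⟫ := fun i => by
    rw [real_inner_comm]; exact hg _ (H.gon.vertex_mem i)
  have hhi : ∀ i, 0 ≤ ⟪triNormal t (fun i => (v i : E3)) i, (h : E3)⟫ := by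
    intro i
    have hb : ∀ i, 0 ≤ ⟪(v i : E3), (h : E3)⟫ := fun i => by
      rw [real_inner_comm]; exact hh _ (H.gon.vertex_mem i)
    rw [triNormal, inner_sub_left, real_inner_smul_left, real_inner_smul_left, inner_add_left,
      inner_add_left]
    have h3 := mul_nonneg H.triple.pos.le (hb i)
    have h4 := mul_nonneg (neg_nonneg.2 hcon) (add_nonneg (add_nonneg (hb 0) (hb 1)) (hb 2))
    linarith
  have h5 : 0 ≤ (1 - t) * (1 + 2 * t) * ⟪(g : E3), (h : E3)⟫ := by
    rw [h2]
    exact add_nonneg (add_nonneg (mul_nonneg (hgi 0) (hhi 0)) (mul_nonneg (hgi 1) (hhi 1)))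
      (mul_nonneg (hgi 2) (hhi 2))
  rw [heq] at h5
  nlinarith

/-- The thickness of an equilateral triangle is the length of its altitudes. -/
lemma cos_thickness (H : EquilateralTriangle t v T) (ht : 0 < t) {c : ℝ} (hc0 : 0 < c)
    (hct : c * √((1 + t) / 2) = t) : Real.cos (thickness T) = c := by
  have ht1 := H.triple.lt_one
  obtain ⟨g, h, hg, hh, hl, heq, hc1', hd⟩ := exists_optimal_lune H.isConvexBody H.exists_lunePair
  set c' := Real.cos (thickness T) with hc'
  obtain ⟨hc1, q, hq, hsup, hpos⟩ := H.exists_altitude ht hc0 hct 0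
  have hle : c ≤ c' := by
    refine hd.le_of_inStrip hc0 hc1 hq fun x hx => ⟨?_, ?_⟩
    · have hs : Supports ((q : E3) - c • (v 0 : E3)) T := by
        refine H.gon.supports fun j => ?_
        by_cases hj : j = 0
        · rw [hj, inner_sub_left, real_inner_smul_left, inner_self_eq_one (norm_coe _),
            real_inner_comm, hq]
          linarith
        · exact (hpos j hj).le
      have := hs x hx
      rw [inner_sub_left, real_inner_smul_left] at this
      linarith
    · have := hsup x hx
      rw [inner_sub_left, real_inner_smul_left] at this
      linarith
  refine le_antisymm ?_ hle
  have hc2 : c ^ 2 * (1 + t) = 2 * t ^ 2 := by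
    have h2 : √((1 + t) / 2) ^ 2 = (1 + t) / 2 := Real.sq_sqrt (by linarith)
    calc c ^ 2 * (1 + t) = 2 * (c * √((1 + t) / 2)) ^ 2 := by rw [mul_pow, h2]; ring
      _ = 2 * t ^ 2 := by rw [hct]
  obtain ⟨p, r, hp, hr, hpr, e1, e2⟩ := hd.exists_feet (hc0.trans_le hle) hc1' H.isConvexBody hg hh heq
  have hs : 0 < √(1 - c' ^ 2) := Real.sqrt_pos.2 (by nlinarith)
  have hrp : ⟪(r : E3), (p : E3)⟫ = c' := by rw [real_inner_comm]; exact hpr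
  have hgp : ⟪(g : E3), (p : E3)⟫ = 0 := by
    have := congrArg (fun v => ⟪v, (p : E3)⟫) e1
    simp only [inner_sub_left, real_inner_smul_left, hrp, inner_self_eq_one (norm_coe p)] at this
    rw [mul_one, sub_self, eq_comm, mul_eq_zero] at this
    exact this.resolve_left hs.ne'
  have hhr : ⟪(h : E3), (r : E3)⟫ = 0 := by
    have := congrArg (fun v => ⟪v, (r : E3)⟫) e2
    simp only [inner_sub_left, real_inner_smul_left, hpr, inner_self_eq_one (norm_coe r)] at this
    rw [mul_one, sub_self, eq_comm, mul_eq_zero] at this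
    exact this.resolve_left hs.ne'
  have facet : ∀ {a b : S2}, Supports (b : E3) T → ∀ i (s : ℝ), 0 ≤ s →
      (a : E3) = s • triNormal t (fun i => (v i : E3)) i → -c ≤ ⟪(a : E3), (b : E3)⟫ := by
    intro a b hb i s hs0 ha
    have h1 := mul_le_mul_of_nonneg_left
      (H.triple.facet_inequality ht hc0.le hc2 i fun j => hb _ (H.gon.vertex_mem j)) hs0
    have h2 : s * ‖triNormal t (fun i => (v i : E3)) i‖ = 1 := by
      have h3 := norm_coe a
      rwa [ha, norm_smul, Real.norm_of_nonneg hs0] at h3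
    rw [norm_coe, mul_one] at h1
    rw [ha, real_inner_smul_left]
    calc -c = s * -(c * ‖triNormal t (fun i => (v i : E3)) i‖) := by
          rw [mul_neg, mul_left_comm, h2, mul_one]
      _ ≤ _ := h1
  -- If one normal of an optimal lune is normal to a side, the facet inequality applies. Otherwise
  -- both feet are vertices, and then c' = t < c, since c' = 1 is excluded.
  rcases H.triple.vertex_or_facet (H.mem_iff.1 hp) (fun j => hg _ (H.gon.vertex_mem j))
    (coe_ne_zero g) hgp with ⟨i, s, hs0, hpi⟩ | ⟨i, s, hs0, hgi⟩
  · rcases H.triple.vertex_or_facet (H.mem_iff.1 hr) (fun j => hh _ (H.gon.vertex_mem j))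
      (coe_ne_zero h) hhr with ⟨j, s', hs0', hrj⟩ | ⟨j, s', hs0', hhj⟩
    · have h3 := H.triple.gram i j
      rw [← eq_of_smul_eq hs0 hpi, ← eq_of_smul_eq hs0' hrj, hpr] at h3
      split_ifs at h3
      · linarith
      · have h4 : √((1 + t) / 2) < 1 := by
          rw [Real.sqrt_lt' one_pos]; linarith
        rw [h3, ← hct]
        nlinarith
    · have := facet hg j s' hs0' hhj
      rw [real_inner_comm, heq] at this
      linarith
  · have := facet hh i s hs0 hgi
    rw [heq] at this
    linarith

/-- A proper convex subbody R misses some vertex v i. The near normal g of the altitude at v i is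
then bounded away from 0 on the compact R, which leaves room to tilt it and narrow the lune. -/
lemma isReducedBody (H : EquilateralTriangle t v T) (h1 : thickness T < Real.pi / 2) :
    IsReducedBody T := by
  refine ⟨H.isConvexBody, fun R hR hRT => ?_⟩
  have ht := H.pos_of_thickness h1
  have ht1 := H.triple.lt_one
  have hy0 : 0 < √((1 + t) / 2) := Real.sqrt_pos.2 (by linarith)
  have hc0 : 0 < t / √((1 + t) / 2) := div_pos ht hy0
  have hct : t / √((1 + t) / 2) * √((1 + t) / 2) = t := div_mul_cancel₀ _ hy0.ne'
  have hcos := H.cos_thickness ht hc0 hct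
  set c := t / √((1 + t) / 2) with hcdef
  obtain ⟨i, hi⟩ : ∃ i, v i ∉ R := by
    by_contra hcon
    push Not at hcon
    exact hRT.2 (H.gon.subset_of_vertices hR.2.1 hcon)
  obtain ⟨hc1, q, hq, hsup, hpos⟩ := H.exists_altitude ht hc0 hct i
  have hpair : ∃ g h : S2, IsLunePair g h ∧ Supports (g : E3) R ∧ Supports (h : E3) R := by
    obtain ⟨g, h, hgh, hg, hh⟩ := H.exists_lunePair
    exact ⟨g, h, hgh, hg.mono hRT.1, hh.mono hRT.1⟩
  obtain ⟨-, -, -, -, -, -, -, hd⟩ := exists_optimal_lune hR hpair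
  have hqv : ⟪(q : E3), (v i : E3)⟫ = c := by rw [real_inner_comm]; exact hq
  set g := farNormal c (q : E3) (v i) with hgdef
  set h := farNormal c (v i : E3) q with hhdef
  have hg0 : ∀ x ∈ R, 0 < ⟪g, (x : E3)⟫ := by
    intro x hx
    have hvi : ⟪g, (v i : E3)⟫ = 0 := by
      rw [hgdef, farNormal_inner, hqv, inner_self_eq_one (norm_coe _)]; ring
    have hnn : ∀ a ∈ Set.range fun i => (v i : E3), 0 ≤ ⟪g, a⟫ := by
      rintro _ ⟨j, rfl⟩
      rcases eq_or_ne j i with rfl | hj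
      · exact hvi.ge
      · exact (hpos j hj).le
    obtain ⟨h2, h3⟩ := span_face hnn (H.gon.mem_iff.1 (hRT.1 hx))
    refine lt_of_le_of_ne h2 fun h4 => ?_
    have h5 : (x : E3) ∈ Submodule.span ℝ≥0 {(v i : E3)} := by
      refine Submodule.span_mono ?_ (h3 h4.symm)
      rintro _ ⟨⟨j, rfl⟩, hj⟩
      rcases eq_or_ne j i with rfl | hji
      · rfl
      · exact absurd hj (hpos j hji).ne'
    obtain ⟨r, hr⟩ := Submodule.mem_span_singleton.1 h5
    exact hi ((eq_of_smul_eq r.2 hr.symm) ▸ hx)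
  have hRne : R.Nonempty := hR.2.2.mono interior_subset
  obtain ⟨x₀, hx₀, hmin⟩ := hR.1.isCompact.exists_isMinOn hRne
    (f := fun x : S2 => ⟪g, (x : E3)⟫) (continuous_const.inner continuous_subtype_val).continuousOn
  have hδ := hg0 x₀ hx₀
  set δ := ⟪g, (x₀ : E3)⟫ with hδdef
  set s := 1 - c ^ 2 with hsdef
  have hs : 0 < s := by rw [hsdef]; nlinarith
  have hhh : ⟪h, h⟫ = s := farNormal_inner_self (norm_coe _) (norm_coe _) hq
  have hgg : ⟪g, g⟫ = s := farNormal_inner_self (norm_coe _) (norm_coe _) hqv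
  have hgh : ⟪g, h⟫ = -(c * s) := farNormal_inner_swap (norm_coe _) (norm_coe _) hq
  have hhn : ‖h‖ ^ 2 = s := by rw [← real_inner_self_eq_norm_sq, hhh]
  have hhpos : 0 < ‖h‖ := by
    refine lt_of_le_of_ne (norm_nonneg h) fun h0 => ?_
    rw [← h0] at hhn; norm_num at hhn; linarith
  -- The largest tilt for which |⟪ηh, x⟫| ≤ δ holds on the whole sphere, so g - ηh still supports R.
  set η := δ / ‖h‖ with hη
  have hηpos : 0 < η := div_pos hδ hhpos
  have hsupp : Supports (g - η • h) R := by
    intro x hx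
    rw [inner_sub_left, real_inner_smul_left]
    have h2 : δ ≤ ⟪g, (x : E3)⟫ := hmin hx
    have h3 : ⟪h, (x : E3)⟫ ≤ ‖h‖ := by
      have := real_inner_le_norm h (x : E3)
      rwa [norm_coe, mul_one] at this
    have h4 : η * ⟪h, (x : E3)⟫ ≤ δ := by
      calc η * ⟪h, (x : E3)⟫ ≤ η * ‖h‖ := mul_le_mul_of_nonneg_left h3 hηpos.le
        _ = δ := div_mul_cancel₀ _ hhpos.ne'
    linarith
  have hsupph : Supports h R := fun x hx => hsup x (hRT.1 hx)
  have hb := hd _ _ hsupp hsupph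
  rw [inner_sub_left, real_inner_smul_left, hgh, hhh] at hb
  have hgn : ‖g - η • h‖ ^ 2 = s * (1 + 2 * η * c + η ^ 2) := by
    rw [← real_inner_self_eq_norm_sq]
    simp only [inner_sub_left, inner_sub_right, real_inner_smul_left, real_inner_smul_right, hgg,
      hhh, hgh, real_inner_comm g h]
    ring
  have hlt : c < Real.cos (thickness R) := by
    by_contra hcon
    push Not at hcon
    have h2 : (c + η) * s ≤ c * (‖g - η • h‖ * ‖h‖) := by
      have := mul_le_mul_of_nonneg_right hcon
        (mul_nonneg (norm_nonneg (g - η • h)) (norm_nonneg h))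
      linarith
    have h3 : ((c + η) * s) ^ 2 ≤ (c * (‖g - η • h‖ * ‖h‖)) ^ 2 :=
      pow_le_pow_left₀ (by positivity) h2 2
    rw [mul_pow c, mul_pow ‖g - η • h‖, hgn, hhn] at h3
    have h4 : 0 < s ^ 2 * (s * (2 * c * η + η ^ 2)) := by positivity
    have h5 : ((c + η) * s) ^ 2 - c ^ 2 * (s * (1 + 2 * η * c + η ^ 2) * s) =
        s ^ 2 * ((1 - c ^ 2) * (2 * c * η + η ^ 2)) := by ring
    rw [← hsdef] at h5
    linarith
  by_contra hcon
  push Not at hcon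
  rw [← hcos] at hlt
  have hRpi : thickness R ≤ Real.pi := by
    obtain ⟨a, b, hab, ha, hb'⟩ := hpair
    linarith [thickness_le hab ha hb', Real.arccos_nonneg ⟪(a : E3), (b : E3)⟫]
  exact absurd (Real.cos_le_cos_of_nonneg_of_le_pi (thickness_nonneg T) hRpi hcon) (not_le.2 hlt)

/-- The center of an equilateral triangle is the center of the smallest disk containing it. -/
lemma cos_le_of_subset_disk (H : EquilateralTriangle t v T) {k : S2} {r : ℝ} (h0 : 0 ≤ r)
    (h1 : r ≤ Real.pi) (hT : T ⊆ disk k r) : Real.cos r ≤ √((1 + 2 * t) / 3) := by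
  have h2 : ∀ i, Real.cos r ≤ ⟪(k : E3), (v i : E3)⟫ := fun i =>
    (mem_disk_iff h0 h1).1 (hT (H.gon.vertex_mem i))
  set s : E3 := (v 0 : E3) + v 1 + v 2 with hs
  have h3 : 3 * Real.cos r ≤ ⟪(k : E3), s⟫ := by
    rw [hs, inner_add_right, inner_add_right]
    linarith [h2 0, h2 1, h2 2]
  have h4 : ⟪(k : E3), s⟫ ≤ ‖s‖ := by
    have := real_inner_le_norm (k : E3) s
    rwa [norm_coe, one_mul] at this
  have h5 : ‖s‖ ^ 2 = 3 * (1 + 2 * t) := by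
    rw [← real_inner_self_eq_norm_sq]
    conv_lhs => rw [hs, inner_add_left, inner_add_left]
    have := H.triple.inner_sum
    rw [this, this, this]
    ring
  rcases le_total (Real.cos r) 0 with h6 | h6
  · exact h6.trans (Real.sqrt_nonneg _)
  · refine Real.le_sqrt_of_sq_le ?_
    have h7 : (3 * Real.cos r) ^ 2 ≤ ‖s‖ ^ 2 := pow_le_pow_left₀ (by positivity) (h3.trans h4) 2
    rw [h5] at h7
    linarith

end EquilateralTriangle

/-! ### Regular triangles of prescribed thickness -/

lemma IsRegularTriangle.exists_equilateral {T : Set S2} (h : IsRegularTriangle T) :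
    ∃ (t : ℝ) (v : Fin 3 → S2), EquilateralTriangle t v T := by
  obtain ⟨v, hg, ⟨h1, h2⟩, -⟩ := h
  have hinj : ∀ a b c d : S2, sdist a b = sdist c d → ⟪(a : E3), (b : E3)⟫ = ⟪(c : E3), (d : E3)⟫ := by
    intro a b c d h
    rw [sdist_eq_arccos, sdist_eq_arccos] at h
    exact Real.arccos_injOn ⟨neg_one_le_inner _ _, inner_le_one _ _⟩
      ⟨neg_one_le_inner _ _, inner_le_one _ _⟩ h
  have e1 := hinj _ _ _ _ h1
  have e2 := hinj _ _ _ _ h2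
  set t := ⟪(v 0 : E3), (v 1 : E3)⟫ with ht
  have f1 : ⟪(v 1 : E3), (v 2 : E3)⟫ = t := e1.symm
  have f2 : ⟪(v 2 : E3), (v 0 : E3)⟫ = t := e2.symm.trans f1
  have f3 : ⟪(v 1 : E3), (v 0 : E3)⟫ = t := by rw [real_inner_comm]
  have f4 : ⟪(v 2 : E3), (v 1 : E3)⟫ = t := by rw [real_inner_comm]; exact f1
  have f5 : ⟪(v 0 : E3), (v 2 : E3)⟫ = t := by rw [real_inner_comm]; exact f2
  have hgram : ∀ i j, ⟪(v i : E3), (v j : E3)⟫ = if i = j then 1 else t := by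
    intro i j
    by_cases hij : i = j
    · rw [hij, if_pos rfl]; exact inner_self_eq_one (norm_coe _)
    · rw [if_neg hij]
      fin_cases i <;> fin_cases j <;> first | exact absurd rfl hij | assumption
  refine ⟨t, v, hg, hgram, ?_, ?_⟩
  · refine lt_of_le_of_ne (inner_le_one _ _) fun h3 => hg.notMem_span 0 ?_
    have h4 : (v 0 : E3) = v 1 :=
      (inner_eq_one_iff_of_norm_eq_one (norm_coe _) (norm_coe _)).1 h3
    rw [h4]
    exact Submodule.subset_span ⟨1, by simp, rfl⟩
  -- The vertices lie in an open half-space, so their sum is nonzero; its squared norm is 3(1 + 2t).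
  · obtain ⟨D, hD, hvD⟩ := hg.2.1
    obtain ⟨y, hy⟩ := exists_pos_functional v hD hvD
    have hs : (v 0 : E3) + v 1 + v 2 ≠ 0 := by
      intro h3
      have h4 : ⟪y, (v 0 : E3) + v 1 + v 2⟫ = 0 := by rw [h3, inner_zero_right]
      rw [inner_add_right, inner_add_right] at h4
      linarith [hy 0, hy 1, hy 2]
    have h5 := real_inner_self_pos.2 hs
    simp only [inner_add_left, inner_add_right, hgram] at h5
    simp at h5
    linarith

lemma vertexAngle_eq {t : ℝ} {p q r : S2} (h1 : ⟪(p : E3), (q : E3)⟫ = t)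
    (h2 : ⟪(p : E3), (r : E3)⟫ = t) (h3 : ⟪(q : E3), (r : E3)⟫ = t) :
    vertexAngle q p r = Real.arccos ((t - t ^ 2) / (1 - t ^ 2)) := by
  have h1' : ⟪(q : E3), (p : E3)⟫ = t := by rw [real_inner_comm]; exact h1
  have h2' : ⟪(r : E3), (p : E3)⟫ = t := by rw [real_inner_comm]; exact h2
  have n1 : ‖tangentDir p q‖ ^ 2 = 1 - t ^ 2 := by
    rw [← real_inner_self_eq_norm_sq, tangentDir, h1]
    exact farNormal_inner_self (norm_coe q) (norm_coe p) h1'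
  have n2 : ‖tangentDir p r‖ ^ 2 = 1 - t ^ 2 := by
    rw [← real_inner_self_eq_norm_sq, tangentDir, h2]
    exact farNormal_inner_self (norm_coe r) (norm_coe p) h2'
  have n3 : ‖tangentDir p r‖ = ‖tangentDir p q‖ :=
    (sq_eq_sq₀ (norm_nonneg _) (norm_nonneg _)).1 (n2.trans n1.symm)
  have h4 : ⟪tangentDir p q, tangentDir p r⟫ = t - t ^ 2 := by
    simp only [tangentDir, h1, h2, inner_sub_left, inner_sub_right, real_inner_smul_left,
      real_inner_smul_right, h1', h3, inner_self_eq_one (norm_coe p)]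
    ring
  rw [vertexAngle, angle, n3, ← sq, n1, h4]

lemma RegularTriple.exists {t : ℝ} (h0 : 0 < 1 + 2 * t) (h1 : t < 1) :
    ∃ v : Fin 3 → E3, RegularTriple t v := by
  have ha := Real.sq_sqrt (show 0 ≤ 1 - t by linarith)
  have hb := Real.sq_sqrt h0.le
  set α := √(1 - t) with hα
  set γ := √(1 + 2 * t) with hγ
  -- The columns of the positive square root of the Gram matrix, whose eigenvalues are 1 - t (twice)
  -- and 1 + 2t.
  refine ⟨fun i => WithLp.toLp 2 fun j => (γ - α) / 3 + if j = i then α else 0, ?_, h1, h0⟩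
  intro i j
  rw [inner_eq_sum]
  fin_cases i <;> fin_cases j <;> simp <;> linarith

lemma exists_regularTriangle {t : ℝ} (h0 : 0 < 1 + 2 * t) (h1 : t < 1) :
    ∃ (v : Fin 3 → S2) (T : Set S2), EquilateralTriangle t v T ∧ IsRegularTriangle T := by
  obtain ⟨u, hu⟩ := RegularTriple.exists h0 h1
  have hd := hu.d_pos
  set v : Fin 3 → S2 := fun i => ⟨u i, mem_sphere_zero_iff_norm.2 (hu.norm_eq i)⟩ with hv
  have hvu : ∀ i, (v i : E3) = u i := fun _ => rfl
  set D : Set S2 := {x | ∀ i, 0 ≤ ⟪triNormal t u i, (x : E3)⟫} with hD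
  have hconv : IsConvex D := by
    intro a ha b hb
    refine ⟨(sdist_lt_pi_iff a b).2 fun hab => coe_ne_zero a ?_, ?_⟩
    · have h2 : ∀ i, ⟪triNormal t u i, (a : E3)⟫ = 0 := by
        intro i
        have h3 := ha i
        have h4 := hb i
        rw [hab, inner_neg_right] at h3 ⊢
        linarith
      have h5 := hu.expansion (a : E3)
      rw [h2, h2, h2] at h5
      simp only [zero_smul, add_zero] at h5
      exact (smul_eq_zero.1 h5).resolve_left hd.ne'
    · rintro x ⟨r, s, hr, hs, hx⟩ i
      rw [hx, inner_add_right, real_inner_smul_right, real_inner_smul_right]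
      exact add_nonneg (mul_nonneg hr (ha i)) (mul_nonneg hs (hb i))
  have hvD : Set.range v ⊆ D := by
    rintro _ ⟨j, rfl⟩ i
    rw [hvu, hu.normal_inner]
    split_ifs
    · exact hd.le
    · exact le_rfl
  have hgon : IsConvexGon 3 v (hull (Set.range v)) := by
    refine ⟨le_rfl, ⟨D, hconv, hvD⟩, fun i hi => ?_, rfl⟩
    rw [mem_hull_iff hconv ((Set.image_subset_range _ _).trans hvD)] at hi
    have h2 : 0 ≤ ⟪-triNormal t u i, (v i : E3)⟫ := by
      refine span_nonneg ?_ hi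
      rintro _ ⟨_, ⟨j, hj, rfl⟩, rfl⟩
      have hj' : i ≠ j := fun h => hj h.symm
      show 0 ≤ ⟪-triNormal t u i, u j⟫
      rw [inner_neg_left, hu.normal_inner, if_neg hj', neg_zero]
    rw [inner_neg_left, hvu, hu.normal_inner, if_pos rfl] at h2
    linarith
  have hg : ∀ i j, i ≠ j → ⟪(v i : E3), (v j : E3)⟫ = t := fun i j hij => by
    rw [hvu, hvu, hu.gram, if_neg hij]
  have hsd : ∀ i j, i ≠ j → sdist (v i) (v j) = Real.arccos t := fun i j hij => by
    rw [sdist_eq_arccos, hg i j hij]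
  have hva : ∀ i j k, i ≠ j → j ≠ k → i ≠ k → vertexAngle (v i) (v j) (v k) =
      Real.arccos ((t - t ^ 2) / (1 - t ^ 2)) := fun i j k hij hjk hik =>
    vertexAngle_eq (hg j i hij.symm) (hg j k hjk) (hg i k hik)
  refine ⟨v, hull (Set.range v), ⟨hgon, hu⟩, v, hgon, ⟨?_, ?_⟩, ?_, ?_⟩
  · rw [hsd _ _ (by decide), hsd _ _ (by decide)]
  · rw [hsd _ _ (by decide), hsd _ _ (by decide)]
  · rw [hva _ _ _ (by decide) (by decide) (by decide), hva _ _ _ (by decide) (by decide) (by decide)]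
  · rw [hva _ _ _ (by decide) (by decide) (by decide), hva _ _ _ (by decide) (by decide) (by decide)]

lemma cos_pos_and_lt_one {ω : ℝ} (h0 : 0 < ω) (h1 : ω < Real.pi / 2) :
    0 < Real.cos ω ∧ Real.cos ω < 1 := by
  refine ⟨Real.cos_pos_of_mem_Ioo ⟨by linarith, h1⟩, ?_⟩
  have := Real.cos_lt_cos_of_nonneg_of_le_pi_div_two le_rfl h1.le h0
  rwa [Real.cos_zero] at this

lemma exists_regularTriangle_of_thickness {ω : ℝ} (h0 : 0 < ω) (h1 : ω < Real.pi / 2) :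
    ∃ T : Set S2, IsRegularTriangle T ∧ thickness T = ω := by
  obtain ⟨hc0, hc1⟩ := cos_pos_and_lt_one h0 h1
  have ht := sideInner_pos hc0 hc1
  obtain ⟨v, T, H, hT⟩ := exists_regularTriangle (t := sideInner (Real.cos ω)) (by linarith)
    (sideInner_lt_one hc0 hc1)
  refine ⟨T, hT, ?_⟩
  have hcos := H.cos_thickness ht hc0 (mul_sqrt_sideInner hc0 hc1)
  exact Real.injOn_cos ⟨thickness_nonneg T, H.thickness_le_pi⟩ ⟨h0.le, by linarith⟩ hcos

/-- The side of an equilateral triangle is determined by its thickness. -/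
lemma EquilateralTriangle.eq_sideInner {t : ℝ} {v : Fin 3 → S2} {T : Set S2}
    (H : EquilateralTriangle t v T) (h0 : 0 < thickness T) (h1 : thickness T < Real.pi / 2) :
    t = sideInner (Real.cos (thickness T)) := by
  obtain ⟨hc0, hc1⟩ := cos_pos_and_lt_one h0 h1
  have ht := H.pos_of_thickness h1
  have hy0 : 0 < √((1 + t) / 2) := Real.sqrt_pos.2 (by linarith)
  have hct : t / √((1 + t) / 2) * √((1 + t) / 2) = t := div_mul_cancel₀ _ hy0.ne'
  refine sideInner_unique hc0 hc1 ht.le ?_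
  rw [H.cos_thickness ht (div_pos ht hy0) hct, hct]

lemma EquilateralTriangle.coverRadius_le {t : ℝ} {v : Fin 3 → S2} {T : Set S2}
    (H : EquilateralTriangle t v T) (h0 : 0 < thickness T) (h1 : thickness T < Real.pi / 2) {k : S2}
    {r : ℝ} (hr0 : 0 ≤ r) (hr1 : r ≤ Real.pi / 2) (hT : T ⊆ disk k r) :
    coverRadius (thickness T) ≤ r := by
  have hrπ : r ≤ Real.pi := by linarith [Real.pi_pos]
  have h2 := H.cos_le_of_subset_disk hr0 hrπ hT
  obtain ⟨hR0, hR1, hR⟩ := coverRadius_facts h0 h1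
  rw [H.eq_sideInner h0 h1, ← hR] at h2
  by_contra hlt
  push Not at hlt
  have := Real.cos_lt_cos_of_nonneg_of_le_pi_div_two hr0 hR1.le hlt
  linarith

end

end SphericalPolygon

/-! ### The theorem -/

open SphericalPolygon
theorem theorem5p2 (ω : ℝ) (hω0 : 0 < ω) (hω1 : ω < Real.pi / 2) :
    -- every reduced polygon of thickness `ω` lies in a disk of radius `coverRadius ω`
    (∀ V : Set S2, IsConvexPolygon V → IsReducedBody V → thickness V = ω →
      ∃ k : S2, V ⊆ disk k (coverRadius ω)) ∧
    -- regular triangles of thickness `ω` exist, are reduced, and need this radius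
    (∃ T : Set S2, IsRegularTriangle T ∧ thickness T = ω) ∧
    (∀ T : Set S2, IsRegularTriangle T → thickness T = ω →
      IsReducedBody T ∧
      IsLeast {r : ℝ | r ∈ Set.Ioc 0 (Real.pi / 2) ∧ ∃ k : S2, T ⊆ disk k r} (coverRadius ω)) ∧
    -- hence `coverRadius ω` is the smallest radius that suffices for all of them
    IsLeast {r : ℝ | r ∈ Set.Ioc 0 (Real.pi / 2) ∧
      ∀ V : Set S2, IsConvexPolygon V → IsReducedBody V → thickness V = ω →
        ∃ k : S2, V ⊆ disk k r} (coverRadius ω) := by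
  obtain ⟨hR0, hR1, -⟩ := coverRadius_facts hω0 hω1
  have hA : ∀ V : Set S2, IsConvexPolygon V → IsReducedBody V → thickness V = ω →
      ∃ k : S2, V ⊆ disk k (coverRadius ω) := by
    rintro V hp hV rfl
    exact exists_disk_of_reduced hp hV hω0 hω1
  have hpoly : ∀ T, IsRegularTriangle T → IsConvexPolygon T := by
    rintro T ⟨v, hv, -⟩
    exact ⟨3, v, hv⟩
  have hred : ∀ T, IsRegularTriangle T → thickness T = ω → IsReducedBody T := by
    rintro T hT rfl
    obtain ⟨t, v, H⟩ := hT.exists_equilateral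
    exact H.isReducedBody hω1
  have hmin : ∀ T, IsRegularTriangle T → thickness T = ω → ∀ r : ℝ, r ∈ Set.Ioc 0 (Real.pi / 2) →
      (∃ k : S2, T ⊆ disk k r) → coverRadius ω ≤ r := by
    rintro T hT rfl r hr ⟨k, hk⟩
    obtain ⟨t, v, H⟩ := hT.exists_equilateral
    exact H.coverRadius_le hω0 hω1 hr.1.le hr.2 hk
  have hE := exists_regularTriangle_of_thickness hω0 hω1
  refine ⟨hA, hE, fun T hT hω => ⟨hred T hT hω, ⟨⟨hR0, hR1.le⟩, hA T (hpoly T hT) (hred T hT hω) hω⟩,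
    fun r hr => hmin T hT hω r hr.1 hr.2⟩, ⟨⟨hR0, hR1.le⟩, hA⟩, fun r hr => ?_⟩
  obtain ⟨T, hT, hω⟩ := hE
  exact hmin T hT hω r hr.1 (hr.2 T (hpoly T hT) (hred T hT hω) hω)
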